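/- Time basis. Let $l\ge 2$ and $0=t_0<t_1<\dots<t_{l-1}=T$. Let $f(t)=\frac12\operatorname{erf}(2\operatorname{artanh}t)+\frac12$ for $|t|<1$, $f(t)=0$ for $t\le-1$, $f(t)=1$ for $t\ge1$, and $f_{a,b}(t)=f\bigl(2\frac{t-a}{b-a}-1\bigr)$. Let $\rho_{a,b,c}$ equal $f_{a,b}$ on $[a,b]$, $1-f_{b,c}$ on $[b,c]$ and $0$ elsewhere. Put $\mu_1=1-f_{t_0,t_1}$ on $[t_0,t_1]$, $\mu_l=f_{t_{l-2},t_{l-1}}$ on $[t_{l-2},t_{l-1}]$ (both extended by zero) and $\mu_i=\rho_{t_{i-2},t_{i-1},t_i}$ for $2\le i\le l-1$. With the Legendre polynomials $P_m$ and a degree $p\ge 0$, the basis functions in time are $b_{1,m}(t)=8\mu_1(t)(t/t_1)^2P_{m-2}(\frac{2}{t_1}t-1)$ for $2\le m\le\max(2,p)$, $b_{i,m}(t)=\mu_i(t)P_m\bigl(2\frac{t-t_{i-2}}{t_i-t_{i-2}}-1\bigr)$ for $2\le i\le l-1$, $0\le m\le p$, and $b_{l,m}(t)=\mu_l(t)P_m\bigl(2\frac{t-t_{l-2}}{t_{l-1}-t_{l-2}}-1\bigr)$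 for $0\le m\le p$. Integral and quadrature. For nondegenerate triangles $\tau_1,\tau_2\subset\mathbb R^3$, basis functions $b=b_{i,m}$ and $\beta=b_{k,m'}$ in time, and functions $\varphi_j$ on $\tau_2$, $\varphi_l$ on $\tau_1$ that are polynomials of degree at most $q$ there, let $\psi(r)=\int_0^T\dot b(t-r)\,\beta(t)\,dt$ and consider $$I=\int_{\tau_1}\int_{\tau_2}\frac{\varphi_j(y)\,\varphi_l(x)}{4\pi\|x-y\|}\,\psi(\|x-y\|)\,d\Gamma_y\,d\Gamma_x .$$ Transform $I$ to $[0,1]^4$ by parametrizing a triangle with vertices $A_0,A_1,A_2$ as $(\xi_1,\xi_2)\mapsto A_0+\xi_1(A_1-A_0)+\xi_1\xi_2(A_2-A_1)$, and let $E_n$ be the absolute error of the tensor Gauss–Legendre quadrature with $n$ points in each of the four directions. Theorem. Let the time grid, $p,q\ge0$, $D>0$ and $h>0$ be given. There is a constant $C>0$, and for every $\lambda\in(0,\frac23)$ there is $n_\lambda\in\mathbb N$, such that the following holds for all $n>n_\lambda$: for all triangles $\tau_1,\tau_2$ of diameter at most $h$ and distance at least $D$, all basis functions $b_{i,m}$,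 $b_{k,m'}$ in time as above, and all $\varphi_j,\varphi_l$ as above with $|\varphi_j|\le M_j$ on $\tau_2$ and $|\varphi_l|\le M_l$ on $\tau_1$, $$E_n\le C\,M_j\,M_l\cdot\frac{\ln(n)^{1/2}}{\ln(n)-2}\cdot n^{-\lambda\ln(n)+2},$$ where in the case $i=1$, $k=l$ (first basis function differentiated, last basis function as test function) it is assumed in addition that $\|x-y\|\le T$ for all $(x,y)\in\tau_1\times\tau_2$ or $\|x-y\|\ge T$ for all such $(x,y)$. -/

import Mathlib

open scoped MeasureTheory

noncomputable section

namespace RetardedQuad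

/-- Three-dimensional Euclidean space. -/
abbrev E3 : Type := EuclideanSpace ℝ (Fin 3)

/-- The (real) error function. -/
def erf (x : ℝ) : ℝ := 2 / √Real.pi * ∫ s in (0 : ℝ)..x, Real.exp (-s ^ 2)

/-- The smooth, non-analytic step function which is `0` left of `-1` and `1` right of `1`. -/
def step (t : ℝ) : ℝ :=
  if t ≤ -1 then 0
  else if 1 ≤ t then 1
  else 1 / 2 * erf (2 * Real.artanh t) + 1 / 2

/-- The step function transported from `[-1,1]` to `[a,b]`. -/
def stepOn (a b t : ℝ) : ℝ := step (2 * ((t - a) / (b - a)) - 1)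

/-- The bump function on `[a,c]` with joint `b`. -/
def bump (a b c t : ℝ) : ℝ :=
  if a ≤ t ∧ t ≤ b then stepOn a b t
  else if b ≤ t ∧ t ≤ c then 1 - stepOn b c t
  else 0

/-- The Legendre polynomial of degree `n` (Rodrigues' formula, so that its value at `1` is `1`). -/
def legendre (n : ℕ) : Polynomial ℝ :=
  Polynomial.C (1 / (2 ^ n * (n.factorial : ℝ))) *
    (Polynomial.derivative^[n]) ((Polynomial.X ^ 2 - 1) ^ n)

/-- `0 = t₀ < t₁ < ⋯ < t_{l-1} = T`, a time grid with `l ≥ 2` points. -/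
def IsTimeGrid (l : ℕ) (t : ℕ → ℝ) (T : ℝ) : Prop :=
  2 ≤ l ∧ t 0 = 0 ∧ (∀ j, j + 1 < l → t j < t (j + 1)) ∧ t (l - 1) = T

/-- The partition of unity `μ₁, …, μ_l` of `[0,T]` subordinate to the grid, extended by zero
outside `[0,T]`. -/
def partUnity (l : ℕ) (t : ℕ → ℝ) (i : ℕ) (s : ℝ) : ℝ :=
  if i = 1 then (Set.Icc (t 0) (t 1)).indicator (fun s => 1 - stepOn (t 0) (t 1) s) s
  else if i = l then
    (Set.Icc (t (l - 2)) (t (l - 1))).indicator (stepOn (t (l - 2)) (t (l - 1))) s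
  else bump (t (i - 2)) (t (i - 1)) (t i) s

/-- The basis function in time with partition-of-unity index `i ∈ {1, …, l}` and polynomial
index `m`. -/
def timeBasis (l : ℕ) (t : ℕ → ℝ) (i m : ℕ) (s : ℝ) : ℝ :=
  if i = 1 then
    partUnity l t 1 s * 8 * (s / t 1) ^ 2 * (legendre (m - 2)).eval (2 / t 1 * s - 1)
  else if i = l then
    partUnity l t l s *
      (legendre m).eval (2 * ((s - t (l - 2)) / (t (l - 1) - t (l - 2))) - 1)
  else
    partUnity l t i s * (legendre m).eval (2 * ((s - t (i - 2)) / (t i - t (i - 2))) - 1)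

/-- The admissible index pairs of basis functions in time for the polynomial degree `p`. -/
def IsTimeIndex (l p i m : ℕ) : Prop :=
  (i = 1 ∧ 2 ≤ m ∧ m ≤ max 2 p) ∨ (2 ≤ i ∧ i ≤ l ∧ m ≤ p)

/-- `ψ(r) = ∫₀ᵀ b'(s - r) β(s) ds` for two basis functions `b`, `β` in time. -/
def psi (T : ℝ) (b β : ℝ → ℝ) (r : ℝ) : ℝ := ∫ s in (0 : ℝ)..T, deriv b (s - r) * β s

/-- The integrand `φ_j(y) φ_l(x) / (4 π ‖x - y‖) ψ(‖x - y‖)` of a matrix entry. -/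
def integrand (φj φl : E3 → ℝ) (ψ : ℝ → ℝ) (x y : E3) : ℝ :=
  φj y * φl x / (4 * Real.pi * ‖x - y‖) * ψ ‖x - y‖

/-- The double surface integral `∫_{τ₁} ∫_{τ₂} k(x,y) dΓ_y dΓ_x`. -/
def surfaceIntegral (τ₁ τ₂ : Affine.Triangle ℝ E3) (k : E3 → E3 → ℝ) : ℝ :=
  ∫ x in τ₁.closedInterior, (∫ y in τ₂.closedInterior, k x y ∂μHE[2]) ∂μHE[2]

/-- The affine map that takes the reference triangle `{0 ≤ s₂ ≤ s₁ ≤ 1}` to the triangle `τ`. -/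
def chart (τ : Affine.Triangle ℝ E3) (s : Fin 2 → ℝ) : E3 :=
  τ.points 0 + s 0 • (τ.points 1 - τ.points 0) + s 1 • (τ.points 2 - τ.points 1)

/-- The surface element of `chart τ` (square root of its Gram determinant). -/
def gram (τ : Affine.Triangle ℝ E3) : ℝ :=
  √(‖τ.points 1 - τ.points 0‖ ^ 2 * ‖τ.points 2 - τ.points 1‖ ^ 2 -
    (inner ℝ (τ.points 1 - τ.points 0) (τ.points 2 - τ.points 1)) ^ 2)

/-- On the triangle `τ`, `φ` is a polynomial of degree at most `q` in affine coordinates of `τ`. -/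
def IsPolyOn (τ : Affine.Triangle ℝ E3) (q : ℕ) (φ : E3 → ℝ) : Prop :=
  ∃ P : MvPolynomial (Fin 2) ℝ, P.totalDegree ≤ q ∧
    ∀ s : Fin 2 → ℝ, 0 ≤ s 1 → s 1 ≤ s 0 → s 0 ≤ 1 → φ (chart τ s) = MvPolynomial.eval s P

/-- The nodes of the `n`-point Gauss–Legendre rule on `[-1,1]`. -/
def gaussNodes (n : ℕ) : Finset ℝ := (legendre n).roots.toFinset

/-- The (interpolatory) Gauss–Legendre weight of the node `a` on `[-1,1]`. -/
def gaussWeight (n : ℕ) (a : ℝ) : ℝ :=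
  ∫ s in (-1 : ℝ)..1, (Lagrange.basis (gaussNodes n) id a).eval s

/-- The `n`-point Gauss–Legendre rule on `[0,1]`. -/
def gauss (n : ℕ) (g : ℝ → ℝ) : ℝ :=
  ∑ a ∈ gaussNodes n, gaussWeight n a / 2 * g ((1 + a) / 2)

/-- The tensor Gauss–Legendre rule on `[0,1]⁴`, `n` points in each direction. -/
def tensorGauss (n : ℕ) (g : ℝ → ℝ → ℝ → ℝ → ℝ) : ℝ :=
  gauss n fun ξ₁ => gauss n fun ξ₂ => gauss n fun η₁ => gauss n fun η₂ => g ξ₁ ξ₂ η₁ η₂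

/-- The pull-back of `k` on `τ₁ × τ₂` to the cube `[0,1]⁴`, Jacobian included: the reference
triangles are parametrized by `(ξ₁, ξ₂) ↦ (ξ₁, ξ₁ ξ₂)`. -/
def cubeIntegrand (τ₁ τ₂ : Affine.Triangle ℝ E3) (k : E3 → E3 → ℝ) (ξ₁ ξ₂ η₁ η₂ : ℝ) : ℝ :=
  gram τ₁ * ξ₁ * (gram τ₂ * η₁) * k (chart τ₁ ![ξ₁, ξ₁ * ξ₂]) (chart τ₂ ![η₁, η₁ * η₂])

/-- The absolute error of the tensor Gauss–Legendre quadrature of `∫_{τ₁} ∫_{τ₂} k`. -/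
def quadError (n : ℕ) (τ₁ τ₂ : Affine.Triangle ℝ E3) (k : E3 → E3 → ℝ) : ℝ :=
  |surfaceIntegral τ₁ τ₂ k - tensorGauss n (cubeIntegrand τ₁ τ₂ k)|

end RetardedQuad

end

namespace RetardedQuad

open scoped ContDiff
open Set Filter Topology

/-! The rate `n ^ (-λ log n)` is typical of functions whose k-th derivatives grow like exp(a k²) for
every a > 1/4; this class is `LogSq`. The radial kernel ψ(r)/r is of this class once ψ is replaced
by a smooth extension, and everything else in the integrand is polynomial.

The number 1/4 comes from the step function. Its derivative is a constant times exp(-(log(1+t) -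
log(1-t))²) / ((1+t)(1-t)), which is holomorphic in the unit disc. With d = 1 - |t|, Cauchy's
estimate on a disc of radius d/2 costs k! (2/d)^k, while the Gaussian factor behaves like exp(-log²
d); the maximum of d^(-k) exp(-log² d) over d is exp(k²/4) (`abs_stepDeriv_le`). The class is stable
under products, differentiation, averaging over a parameter and composition with inner functions
obeying analytic bounds K^k k!. It therefore contains the smooth extension of ψ (`logSq_psiExt`)
and, away from y = 0, the function ψ(√y)/√y (`logSq_comp_sqrt_div_sqrt`).

A Jackson estimate for Chebyshev partial sums, explicit in the order k
(`abs_sub_chebPartialSum_le`), bounds the error of approximation in degree N essentially by exp(a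
k²) N^(-k). The choice k ≈ log N / (2a) yields exp(-log² N / (4a)). For a = 3/10 the exponent is 5/6
> 2/3, and the surplus absorbs all constants and powers of N.

Since ‖x - y‖² is a polynomial of degree two in each cube variable, replacing the kernel by a
polynomial in r² turns the whole pulled-back integrand, Jacobian included, into a polynomial of
degree below 2n in each variable. The tensor Gauss rule is exact on these and has nonnegative
weights of total mass one, so its error is at most twice the approximation error
(`abs_cubeIntegral_sub_tensorGauss_le`).

The estimate is uniform in the triangles because ψ vanishes from T on: either the integrand is zero,
or all distances lie in the fixed interval [D, T + 2h + D]. There ψ equals its extension, except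
that for the first and last basis functions the two may part at T; the additional assumption covers
this case. -/

/-- A family of functions, smooth on `s`, whose `k`-th derivatives are uniformly bounded by
`C * exp (a * k ^ 2)` for every `a > 1 / 4`. -/
def LogSq {ι : Type*} (s : Set ℝ) (f : ι → ℝ → ℝ) : Prop :=
  (∀ v, ContDiffOn ℝ ∞ (f v) s) ∧
    ∀ a : ℝ, 1 / 4 < a → ∃ C : ℝ, 0 < C ∧
      ∀ v, ∀ k : ℕ, ∀ x ∈ s, |iteratedDeriv k (f v) x| ≤ C * Real.exp (a * (k : ℝ) ^ 2)

/-! ### Absorbing lower-order growth into exp(e k²) -/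

/-- The k-th root of the quotient, K k^m exp(-e k), tends to zero. Factors such as 2^k, K^k or k!
thus cost only an arbitrarily small increase of the constant `a` in `LogSq`. -/
lemma exists_pow_mul_pow_le_exp_sq (K : ℝ) (m : ℕ) (e : ℝ) (hK : 0 ≤ K) (he : 0 < e) :
    ∃ C : ℝ, 0 < C ∧ ∀ k : ℕ, (K * (k : ℝ) ^ m) ^ k ≤ C * Real.exp (e * (k : ℝ) ^ 2) := by
  have h1 : Tendsto (fun k : ℕ => K * (k : ℝ) ^ m * Real.exp (-(e * k))) atTop (𝓝 0) := by
    have h2 : Tendsto (fun x : ℝ => x ^ m * Real.exp (-x)) atTop (𝓝 0) :=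
      Real.tendsto_pow_mul_exp_neg_atTop_nhds_zero m
    have h3 : Tendsto (fun k : ℕ => e * (k : ℝ)) atTop atTop :=
      tendsto_natCast_atTop_atTop.const_mul_atTop he
    have h4 := (h2.comp h3).const_mul (K / e ^ m)
    rw [mul_zero] at h4
    refine h4.congr fun k => ?_
    simp only [Function.comp_apply, mul_pow]
    field_simp
  have h5 : ∀ᶠ k : ℕ in atTop,
      (K * (k : ℝ) ^ m) ^ k * Real.exp (-(e * (k : ℝ) ^ 2)) ≤ 1 := by
    filter_upwards [h1.eventually (gt_mem_nhds one_pos)] with k hk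
    have h6 : Real.exp (-(e * (k : ℝ) ^ 2)) = Real.exp (-(e * k)) ^ k := by
      rw [← Real.exp_nat_mul]; ring_nf
    rw [h6, ← mul_pow]
    exact pow_le_one₀ (by positivity) hk.le
  obtain ⟨B, hB⟩ := (IsBoundedUnder.bddAbove_range ⟨1, by simpa using h5⟩ :
    BddAbove (range fun k : ℕ => (K * (k : ℝ) ^ m) ^ k * Real.exp (-(e * (k : ℝ) ^ 2))))
  refine ⟨max B 1, by positivity, fun k => ?_⟩
  have h7 := (hB (mem_range_self k)).trans (le_max_left B 1)
  rw [Real.exp_neg, ← div_eq_mul_inv, div_le_iff₀ (Real.exp_pos _)] at h7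
  exact h7

lemma exists_exp_shift_sq_le (a a' b : ℝ) (ha : a < a') :
    ∃ C : ℝ, 0 < C ∧ ∀ k : ℕ, Real.exp (a * (k : ℝ) ^ 2 + b * k) ≤
      C * Real.exp (a' * (k : ℝ) ^ 2) := by
  refine ⟨Real.exp (b ^ 2 / (4 * (a' - a))), Real.exp_pos _, fun k => ?_⟩
  rw [← Real.exp_add]
  apply Real.exp_le_exp.2
  have h : 0 < a' - a := sub_pos.2 ha
  have : 0 ≤ (a' - a) * ((k : ℝ) - b / (2 * (a' - a))) ^ 2 := by positivity
  have e : (a' - a) * ((k : ℝ) - b / (2 * (a' - a))) ^ 2 =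
      (a' - a) * (k : ℝ) ^ 2 - b * k + b ^ 2 / (4 * (a' - a)) := by
    field_simp; ring
  linarith

/-! ### Calculus of the derivative bounds -/

section LogSq

variable {ι : Type*} {s t : Set ℝ} {f g : ι → ℝ → ℝ}

lemma norm_iteratedFDerivWithin_eq_abs_iteratedDeriv (hs : IsOpen s) (k : ℕ) (f : ℝ → ℝ) {x : ℝ}
    (hx : x ∈ s) : ‖iteratedFDerivWithin ℝ k f s x‖ = |iteratedDeriv k f x| := by
  rw [norm_iteratedFDerivWithin_eq_norm_iteratedDerivWithin, iteratedDerivWithin_of_isOpen hs hx,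
    Real.norm_eq_abs]

lemma LogSq.congr (hf : LogSq s f) (hs : IsOpen s) (h : ∀ v, EqOn (g v) (f v) s) : LogSq s g := by
  refine ⟨fun v => (hf.1 v).congr (h v), fun a ha => ?_⟩
  obtain ⟨C, hC, hb⟩ := hf.2 a ha
  refine ⟨C, hC, fun v k x hx => ?_⟩
  rw [(h v).iteratedDeriv_of_isOpen hs k hx]
  exact hb v k x hx

lemma LogSq.reindex {κ : Type*} (hf : LogSq s f) (e : κ → ι) : LogSq s fun v => f (e v) := by
  refine ⟨fun v => hf.1 _, fun a ha => ?_⟩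
  obtain ⟨C, hC, hb⟩ := hf.2 a ha
  exact ⟨C, hC, fun v k x hx => hb _ k x hx⟩

lemma LogSq.add (hf : LogSq s f) (hg : LogSq s g) (hs : IsOpen s) :
    LogSq s fun v x => f v x + g v x := by
  refine ⟨fun v => (hf.1 v).add (hg.1 v), fun a ha => ?_⟩
  obtain ⟨C, hC, hb⟩ := hf.2 a ha
  obtain ⟨C', hC', hb'⟩ := hg.2 a ha
  refine ⟨C + C', by positivity, fun v k x hx => ?_⟩
  have h := iteratedDeriv_add (n := k)
    (((hf.1 v).contDiffAt (hs.mem_nhds hx)).of_le (by exact_mod_cast le_top))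
    (((hg.1 v).contDiffAt (hs.mem_nhds hx)).of_le (by exact_mod_cast le_top))
  have h' : iteratedDeriv k (fun x => f v x + g v x) x = _ := h
  rw [h', add_mul]
  exact (abs_add_le _ _).trans (add_le_add (hb v k x hx) (hb' v k x hx))

/-- In Leibniz' rule i² + (k - i)² ≤ k², so the two exponents do not add up beyond b k²; the
binomial sum 2^k is absorbed in passing from `b` to `a`. -/
lemma LogSq.mul (hf : LogSq s f) (hg : LogSq s g) (hs : IsOpen s) :
    LogSq s fun v x => f v x * g v x := by
  refine ⟨fun v => (hf.1 v).mul (hg.1 v), fun a ha => ?_⟩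
  obtain ⟨b, hb1, hb2⟩ := exists_between ha
  obtain ⟨C, hC, hb⟩ := hf.2 b hb1
  obtain ⟨C', hC', hb'⟩ := hg.2 b hb1
  obtain ⟨C₂, hC₂, h₂⟩ := exists_pow_mul_pow_le_exp_sq 2 0 (a - b) (by norm_num) (by linarith)
  refine ⟨C * C' * C₂, by positivity, fun v k x hx => ?_⟩
  have h := norm_iteratedFDerivWithin_mul_le (hf.1 v) (hg.1 v) hs.uniqueDiffOn hx (n := k)
    (by exact_mod_cast le_top)
  rw [norm_iteratedFDerivWithin_eq_abs_iteratedDeriv hs _ _ hx] at h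
  refine h.trans ?_
  have : ∀ i ∈ Finset.range (k + 1), ((k.choose i : ℝ) * ‖iteratedFDerivWithin ℝ i (f v) s x‖ *
      ‖iteratedFDerivWithin ℝ (k - i) (g v) s x‖) ≤
        k.choose i * (C * C' * Real.exp (b * (k : ℝ) ^ 2)) := by
    intro i hi
    rw [norm_iteratedFDerivWithin_eq_abs_iteratedDeriv hs _ _ hx,
      norm_iteratedFDerivWithin_eq_abs_iteratedDeriv hs _ _ hx, mul_assoc]
    refine mul_le_mul_of_nonneg_left ?_ (Nat.cast_nonneg _)
    have hik : i ≤ k := Nat.lt_succ_iff.1 (Finset.mem_range.1 hi)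
    calc _ ≤ (C * Real.exp (b * (i : ℝ) ^ 2)) * (C' * Real.exp (b * ((k - i : ℕ) : ℝ) ^ 2)) := by
          gcongr
          · exact hb v i x hx
          · exact hb' v _ x hx
      _ = C * C' * Real.exp (b * (i : ℝ) ^ 2 + b * ((k - i : ℕ) : ℝ) ^ 2) := by
          rw [Real.exp_add]; ring
      _ ≤ _ := by
          gcongr
          rw [← mul_add]
          gcongr
          rw [Nat.cast_sub hik]
          have : (i : ℝ) ≤ k := by exact_mod_cast hik
          nlinarith [mul_nonneg (Nat.cast_nonneg (α := ℝ) i) (sub_nonneg.2 this)]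
  refine (Finset.sum_le_sum this).trans ?_
  rw [← Finset.sum_mul]
  have h3 : (∑ i ∈ Finset.range (k + 1), (k.choose i : ℝ)) = 2 ^ k := by
    exact_mod_cast Nat.sum_range_choose k
  rw [h3]
  have h4 := h₂ k
  simp only [pow_zero, mul_one] at h4
  calc 2 ^ k * (C * C' * Real.exp (b * (k : ℝ) ^ 2))
      ≤ (C₂ * Real.exp ((a - b) * (k : ℝ) ^ 2)) * (C * C' * Real.exp (b * (k : ℝ) ^ 2)) := by
        gcongr
    _ = C * C' * C₂ * (Real.exp ((a - b) * (k : ℝ) ^ 2) * Real.exp (b * (k : ℝ) ^ 2)) := by ring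
    _ = _ := by rw [← Real.exp_add]; ring_nf

lemma logSq_const {c : ι → ℝ} {B : ℝ} (hc : ∀ v, |c v| ≤ B) : LogSq s fun v _ => c v := by
  refine ⟨fun v => contDiffOn_const, fun a ha => ⟨|B| + 1, by positivity, fun v k x hx => ?_⟩⟩
  have h1 : |c v| ≤ |B| + 1 := (hc v).trans ((le_abs_self B).trans (by linarith))
  have h2 : 1 ≤ Real.exp (a * (k : ℝ) ^ 2) := Real.one_le_exp (by positivity)
  have h3 : |iteratedDeriv k (fun _ : ℝ => c v) x| ≤ |c v| := by
    rw [iteratedDeriv_const]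
    split_ifs <;> simp
  nlinarith [abs_nonneg B]

/-- Composition with inner functions that have analytic derivative bounds. -/
lemma LogSq.comp (hf : LogSq t f) {φ : ι → ℝ → ℝ} {K : ℝ} (hK : 0 ≤ K) (hs : IsOpen s)
    (ht : IsOpen t) (hφ : ∀ v, ContDiffOn ℝ ∞ (φ v) s) (hst : ∀ v, MapsTo (φ v) s t)
    (hb : ∀ v, ∀ k : ℕ, 1 ≤ k → ∀ x ∈ s, |iteratedDeriv k (φ v) x| ≤ K ^ k * k.factorial) :
    LogSq s fun v x => f v (φ v x) := by
  refine ⟨fun v => (hf.1 v).comp (hφ v) (hst v), fun a ha => ?_⟩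
  obtain ⟨b, hb1, hb2⟩ := exists_between ha
  obtain ⟨C, hC, hCb⟩ := hf.2 b hb1
  obtain ⟨C₂, hC₂, h₂⟩ := exists_pow_mul_pow_le_exp_sq K 2 (a - b) hK (by linarith)
  refine ⟨C * C₂, by positivity, fun v k x hx => ?_⟩
  -- The composition bound k! C D^k needs inner derivatives of order i bounded by D^i. As K^i i! ≤
  -- (K k)^i for i ≤ k, the choice D = K k works, and k! (K k)^k ≤ (K k²)^k is of absorbable size.
  have h := norm_iteratedFDerivWithin_comp_le (hf.1 v) (hφ v) (n := k)
    (by exact_mod_cast le_top) ht.uniqueDiffOn hs.uniqueDiffOn (hst v) hx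
    (C := C * Real.exp (b * (k : ℝ) ^ 2)) (D := K * k)
    (by
      intro i hi
      rw [norm_iteratedFDerivWithin_eq_abs_iteratedDeriv ht _ _ (hst v hx)]
      refine (hCb v i _ (hst v hx)).trans ?_
      gcongr)
    (by
      intro i hi hik
      rw [norm_iteratedFDerivWithin_eq_abs_iteratedDeriv hs _ _ hx, mul_pow]
      refine (hb v i hi x hx).trans ?_
      gcongr
      calc (i.factorial : ℝ) ≤ (i : ℝ) ^ i := by exact_mod_cast Nat.factorial_le_pow i
        _ ≤ (k : ℝ) ^ i := by gcongr)
  rw [norm_iteratedFDerivWithin_eq_abs_iteratedDeriv hs _ _ hx] at h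
  refine h.trans ?_
  calc (k.factorial : ℝ) * (C * Real.exp (b * (k : ℝ) ^ 2)) * (K * k) ^ k
      ≤ (k : ℝ) ^ k * (C * Real.exp (b * (k : ℝ) ^ 2)) * (K * k) ^ k := by
        gcongr
        exact_mod_cast Nat.factorial_le_pow k
    _ = (K * (k : ℝ) ^ 2) ^ k * (C * Real.exp (b * (k : ℝ) ^ 2)) := by
        rw [mul_pow, mul_pow, ← pow_mul, pow_mul' _ 2 k, pow_two]; ring
    _ ≤ (C₂ * Real.exp ((a - b) * (k : ℝ) ^ 2)) * (C * Real.exp (b * (k : ℝ) ^ 2)) := by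
        gcongr; exact h₂ k
    _ = C * C₂ * (Real.exp ((a - b) * (k : ℝ) ^ 2) * Real.exp (b * (k : ℝ) ^ 2)) := by ring
    _ = _ := by rw [← Real.exp_add]; ring_nf

lemma iteratedDeriv_affine (c d : ℝ) (k : ℕ) (hk : 1 ≤ k) (x : ℝ) :
    iteratedDeriv k (fun x => c * x + d) x = if k = 1 then c else 0 := by
  obtain ⟨m, rfl⟩ := Nat.exists_eq_add_of_le' hk
  rw [iteratedDeriv_succ']
  have : deriv (fun x => c * x + d) = fun _ => c := by
    ext y
    simp
  rw [this, iteratedDeriv_const]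
  simp

lemma LogSq.comp_affine (hf : LogSq t f) (hs : IsOpen s) (ht : IsOpen t) {c d : ι → ℝ} {B : ℝ}
    (hc : ∀ v, |c v| ≤ B) (hst : ∀ v, MapsTo (fun x => c v * x + d v) s t) :
    LogSq s fun v x => f v (c v * x + d v) := by
  refine hf.comp (abs_nonneg B) hs ht (fun v => by fun_prop) hst fun v k hk x _ => ?_
  rw [iteratedDeriv_affine _ _ _ hk]
  split_ifs with h
  · subst h
    simpa using (hc v).trans (le_abs_self B)
  · rw [abs_zero]; positivity

/-- The shift from k to k + 1 adds only a linear term to the exponent b k². -/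
lemma LogSq.deriv (hf : LogSq s f) (hs : IsOpen s) : LogSq s fun v => deriv (f v) := by
  refine ⟨fun v => (hf.1 v).deriv_of_isOpen hs (by simp), fun a ha => ?_⟩
  obtain ⟨b, hb1, hb2⟩ := exists_between ha
  obtain ⟨C, hC, hb⟩ := hf.2 b hb1
  obtain ⟨C', hC', hb'⟩ := exists_exp_shift_sq_le b a (2 * b) hb2
  refine ⟨C * Real.exp b * C', by positivity, fun v k x hx => ?_⟩
  rw [← iteratedDeriv_succ']
  refine (hb v _ x hx).trans ?_
  have : Real.exp (b * ((k + 1 : ℕ) : ℝ) ^ 2) =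
      Real.exp b * Real.exp (b * (k : ℝ) ^ 2 + 2 * b * k) := by
    rw [← Real.exp_add]; push_cast; ring_nf
  rw [this, mul_assoc (C * Real.exp b), ← mul_assoc]
  exact mul_le_mul_of_nonneg_left (hb' k) (by positivity)

end LogSq

lemma logSq_id {ι : Type*} (R : ℝ) : LogSq (ι := ι) (Ioo (-R) R) fun _ x => x := by
  refine ⟨fun v => contDiffOn_id, fun a ha => ⟨|R| + 1, by positivity, fun v k x hx => ?_⟩⟩
  have h2 : 1 ≤ Real.exp (a * (k : ℝ) ^ 2) := Real.one_le_exp (by positivity)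
  have h3 : |iteratedDeriv k (fun x : ℝ => x) x| ≤ |R| + 1 := by
    rcases Nat.eq_zero_or_pos k with rfl | hk
    · rw [iteratedDeriv_zero]
      have : |x| < R := abs_lt.2 hx
      exact (this.le.trans (le_abs_self R)).trans (by linarith)
    · have := iteratedDeriv_affine 1 0 k hk x
      simp only [one_mul, add_zero] at this
      rw [this]
      split_ifs
      · simp
      · rw [abs_zero]; positivity
  nlinarith [abs_nonneg R]

lemma logSq_polynomial {ι : Type*} (R : ℝ) (P : Polynomial ℝ) :
    LogSq (ι := ι) (Ioo (-R) R) fun _ x => P.eval x := by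
  induction P using Polynomial.induction_on' with
  | add p q hp hq => simpa using hp.add hq isOpen_Ioo
  | monomial n c =>
    induction n with
    | zero => simpa using logSq_const (ι := ι) (s := Ioo (-R) R) (c := fun _ => c) (fun _ => le_rfl)
    | succ n ih =>
      refine (ih.mul (logSq_id R) isOpen_Ioo).congr isOpen_Ioo fun v x _ => ?_
      simp [pow_succ, mul_assoc]

/-! ### Integrals depending on a parameter -/

lemma hasDerivAt_intervalIntegral_param {G : ℝ × ℝ → ℝ} (hG : ContDiff ℝ ∞ G) (a b r : ℝ) :
    HasDerivAt (fun r => ∫ v in a..b, G (r, v))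
      (∫ v in a..b, deriv (fun r => G (r, v)) r) r := by
  have hd : ∀ r v, HasDerivAt (fun r => G (r, v)) (fderiv ℝ G (r, v) (1, 0)) r := by
    intro r v
    have h1 : HasFDerivAt G (fderiv ℝ G (r, v)) (r, v) :=
      (hG.differentiable (by simp) (r, v)).hasFDerivAt
    have h2 : HasDerivAt (fun r : ℝ => (r, v)) (1, 0) r :=
      (hasDerivAt_id r).prodMk (hasDerivAt_const r v)
    exact h1.comp_hasDerivAt r h2
  have hc : Continuous fun p : ℝ × ℝ => fderiv ℝ G p (1, 0) :=
    (hG.continuous_fderiv (by simp)).clm_apply continuous_const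
  obtain ⟨M, hM⟩ := ((isCompact_Icc (a := r - 1) (b := r + 1)).prod
    (isCompact_uIcc (a := a) (b := b))).exists_bound_of_continuousOn hc.continuousOn
  have := (intervalIntegral.hasDerivAt_integral_of_dominated_loc_of_deriv_le
    (F := fun r v => G (r, v)) (F' := fun r v => fderiv ℝ G (r, v) (1, 0)) (x₀ := r)
    (s := Icc (r - 1) (r + 1)) (bound := fun _ => M) (a := a) (b := b)
    (μ := MeasureTheory.volume)
    (Icc_mem_nhds (by linarith) (by linarith))
    (Eventually.of_forall fun x =>
      (hG.continuous.comp (by fun_prop)).aestronglyMeasurable)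
    ((hG.continuous.comp (by fun_prop : Continuous fun v : ℝ => (r, v))).intervalIntegrable _ _)
    (hc.comp (by fun_prop : Continuous fun v : ℝ => (r, v))).aestronglyMeasurable
    (MeasureTheory.ae_of_all _ fun v hv x hx => hM (x, v) ⟨hx, uIoc_subset_uIcc hv⟩)
    intervalIntegrable_const
    (MeasureTheory.ae_of_all _ fun v hv x hx => hd x v)).2
  simpa only [(hd r _).deriv] using this

lemma contDiff_partialDeriv {G : ℝ × ℝ → ℝ} (hG : ContDiff ℝ ∞ G) :
    ContDiff ℝ ∞ fun p : ℝ × ℝ => deriv (fun r => G (r, p.2)) p.1 := by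
  have hd : ∀ p : ℝ × ℝ, deriv (fun r => G (r, p.2)) p.1 = fderiv ℝ G p (1, 0) := by
    intro p
    have h1 : HasFDerivAt G (fderiv ℝ G p) (p.1, p.2) :=
      (hG.differentiable (by simp) p).hasFDerivAt
    have h2 : HasDerivAt (fun r : ℝ => (r, p.2)) (1, 0) p.1 :=
      (hasDerivAt_id _).prodMk (hasDerivAt_const _ _)
    exact (h1.comp_hasDerivAt p.1 h2).deriv
  simp only [hd]
  exact (hG.fderiv_right (m := ∞) (by simp)).clm_apply contDiff_const

lemma iteratedDeriv_intervalIntegral_param (a b : ℝ) (k : ℕ) {G : ℝ × ℝ → ℝ}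
    (hG : ContDiff ℝ ∞ G) :
    iteratedDeriv k (fun r => ∫ v in a..b, G (r, v)) =
      fun r => ∫ v in a..b, iteratedDeriv k (fun r => G (r, v)) r := by
  induction k generalizing G with
  | zero => simp
  | succ k ih =>
    have h1 : _root_.deriv (fun r => ∫ v in a..b, G (r, v)) =
        fun r => ∫ v in a..b, (fun p : ℝ × ℝ => deriv (fun r => G (r, p.2)) p.1) (r, v) :=
      funext fun r => (hasDerivAt_intervalIntegral_param hG a b r).deriv
    rw [iteratedDeriv_succ', h1, ih (contDiff_partialDeriv hG)]
    simp only [iteratedDeriv_succ']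

lemma contDiff_intervalIntegral_param (a b : ℝ) {G : ℝ × ℝ → ℝ} (hG : ContDiff ℝ ∞ G) :
    ContDiff ℝ ∞ fun r => ∫ v in a..b, G (r, v) := by
  refine contDiff_of_differentiable_iteratedDeriv fun m _ => ?_
  have key : ∀ (m : ℕ) {G : ℝ × ℝ → ℝ}, ContDiff ℝ ∞ G →
      Differentiable ℝ (iteratedDeriv m fun r => ∫ v in a..b, G (r, v)) := by
    intro m
    induction m with
    | zero =>
      intro G hG r
      simpa using (hasDerivAt_intervalIntegral_param hG a b r).differentiableAt
    | succ m ih =>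
      intro G hG
      have h1 : _root_.deriv (fun r => ∫ v in a..b, G (r, v)) =
          fun r => ∫ v in a..b, (fun p : ℝ × ℝ => deriv (fun r => G (r, p.2)) p.1) (r, v) :=
        funext fun r => (hasDerivAt_intervalIntegral_param hG a b r).deriv
      rw [iteratedDeriv_succ', h1]
      exact ih (contDiff_partialDeriv hG)
  exact key m hG

lemma LogSq.intervalIntegral {s : Set ℝ} {G : ℝ × ℝ → ℝ} (hG : ContDiff ℝ ∞ G)
    (h : LogSq (ι := Icc (0 : ℝ) 1) s fun v r => G (r, v)) :
    LogSq (ι := Unit) s fun _ r => ∫ v in (0 : ℝ)..1, G (r, v) := by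
  refine ⟨fun v => (contDiff_intervalIntegral_param 0 1 hG).contDiffOn, fun a ha => ?_⟩
  obtain ⟨C, hC, hb⟩ := h.2 a ha
  refine ⟨C, hC, fun _ k x hx => ?_⟩
  rw [iteratedDeriv_intervalIntegral_param 0 1 k hG]
  have := intervalIntegral.norm_integral_le_of_norm_le_const (a := (0 : ℝ)) (b := 1)
    (f := fun v => iteratedDeriv k (fun r => G (r, v)) x) (C := C * Real.exp (a * (k : ℝ) ^ 2))
    (by
      intro v hv
      rw [uIoc_of_le zero_le_one] at hv
      exact hb ⟨v, hv.1.le, hv.2⟩ k x hx)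
  simpa using this

/-! ### Derivatives of the step function -/

/-- The derivative exists on both sides of x and tends to `g x`, so both one-sided derivatives at x
equal `g x`. This glues the step function and its derivatives at ±1. -/
lemma hasDerivAt_of_eventually_hasDerivAt_of_ne {f g : ℝ → ℝ} {x : ℝ}
    (h : ∀ᶠ y in 𝓝 x, y ≠ x → HasDerivAt f (g y) y) (hf : ContinuousAt f x)
    (hg : ContinuousAt g x) : HasDerivAt f (g x) x := by
  have hA : HasDerivWithinAt f (g x) (Ici x) x := by
    have hs : {y | y ≠ x → HasDerivAt f (g y) y} ∩ Ioi x ∈ 𝓝[>] x :=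
      inter_mem (mem_nhdsWithin_of_mem_nhds h) self_mem_nhdsWithin
    refine hasDerivWithinAt_Ici_of_tendsto_deriv (s := {y | y ≠ x → HasDerivAt f (g y) y} ∩ Ioi x)
      (fun y hy => (hy.1 hy.2.ne').differentiableAt.differentiableWithinAt)
      hf.continuousWithinAt hs ?_
    exact (tendsto_inf_left hg).congr'
      (mem_of_superset hs fun y hy => (hy.1 hy.2.ne').deriv.symm)
  have hB : HasDerivWithinAt f (g x) (Iic x) x := by
    have hs : {y | y ≠ x → HasDerivAt f (g y) y} ∩ Iio x ∈ 𝓝[<] x :=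
      inter_mem (mem_nhdsWithin_of_mem_nhds h) self_mem_nhdsWithin
    refine hasDerivWithinAt_Iic_of_tendsto_deriv (s := {y | y ≠ x → HasDerivAt f (g y) y} ∩ Iio x)
      (fun y hy => (hy.1 hy.2.ne).differentiableAt.differentiableWithinAt)
      hf.continuousWithinAt hs ?_
    exact (tendsto_inf_left hg).congr'
      (mem_of_superset hs fun y hy => (hy.1 hy.2.ne).deriv.symm)
  simpa using hB.union hA

/-- The holomorphic extension to the unit disc of the derivative of `step`. -/
noncomputable def stepDerivC (z : ℂ) : ℂ :=
  (2 / √Real.pi : ℝ) * Complex.exp (-(Complex.log (1 + z) - Complex.log (1 - z)) ^ 2) /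
    ((1 + z) * (1 - z))

/-- The derivative of order `k + 1` of `step`. -/
noncomputable def stepDeriv (k : ℕ) (t : ℝ) : ℝ :=
  if |t| < 1 then (iteratedDeriv k stepDerivC t).re else 0

lemma re_pos_of_norm_lt_one {z : ℂ} (hz : ‖z‖ < 1) : 0 < (1 + z).re ∧ 0 < (1 - z).re := by
  have := abs_lt.1 ((Complex.abs_re_le_norm z).trans_lt hz)
  simp only [Complex.add_re, Complex.sub_re, Complex.one_re]
  constructor <;> linarith [this.1, this.2]

lemma differentiableOn_stepDerivC : DifferentiableOn ℂ stepDerivC (Metric.ball 0 1) := by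
  intro z hz
  have h := re_pos_of_norm_lt_one (mem_ball_zero_iff.1 hz)
  have h1 : (1 + z) ∈ Complex.slitPlane := Or.inl h.1
  have h2 : (1 - z) ∈ Complex.slitPlane := Or.inl h.2
  have h3 := Complex.slitPlane_ne_zero h1
  have h4 := Complex.slitPlane_ne_zero h2
  refine DifferentiableAt.differentiableWithinAt ?_
  have e1 : DifferentiableAt ℂ (fun z => Complex.log (1 + z)) z :=
    DifferentiableAt.clog (by fun_prop) h1
  have e2 : DifferentiableAt ℂ (fun z => Complex.log (1 - z)) z :=
    DifferentiableAt.clog (by fun_prop) h2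
  unfold stepDerivC
  exact DifferentiableAt.div (((e1.sub e2).pow 2).neg.cexp.const_mul _) (by fun_prop)
    (mul_ne_zero h3 h4)

lemma hasDerivAt_stepDeriv_of_lt (k : ℕ) {t : ℝ} (ht : |t| < 1) :
    HasDerivAt (stepDeriv k) (stepDeriv (k + 1) t) t := by
  have hb : (t : ℂ) ∈ Metric.ball (0 : ℂ) 1 := by simpa using ht
  have han : AnalyticAt ℂ stepDerivC t :=
    differentiableOn_stepDerivC.analyticAt (Metric.isOpen_ball.mem_nhds hb)
  have h1 : HasDerivAt (iteratedDeriv k stepDerivC) (iteratedDeriv (k + 1) stepDerivC t) t := by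
    rw [iteratedDeriv_succ, iteratedDeriv_eq_iterate]
    exact (han.iterated_deriv k).differentiableAt.hasDerivAt
  have h2 := h1.real_of_complex
  have h3 : stepDeriv (k + 1) t = (iteratedDeriv (k + 1) stepDerivC t).re := by
    rw [stepDeriv, if_pos ht]
  rw [h3]
  refine h2.congr_of_eventuallyEq ?_
  filter_upwards [(isOpen_lt continuous_abs continuous_const).mem_nhds ht] with y hy
  rw [stepDeriv, if_pos hy]

/-- In the application p and q are the distances to the nearer and the farther of the points ±1.
Always log q - log p ≥ -log(3d). If 3d ≤ 1, the squares compare; otherwise 0 ≤ log(3d) ≤ 2, and the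
factor exp 4 suffices. -/
lemma exp_neg_log_sub_log_sq_le {p q d : ℝ} (hp : 0 < p) (hd : 0 < d) (hd1 : d ≤ 1)
    (hq2 : 1 / 2 ≤ q) (hp2 : p ≤ 3 * d / 2) :
    Real.exp (-(Real.log q - Real.log p) ^ 2) ≤ Real.exp 4 * Real.exp (-Real.log (3 * d) ^ 2) := by
  rw [← Real.exp_add]
  apply Real.exp_le_exp.2
  have h3 : Real.log (3 * d) = Real.log 2 + Real.log (3 * d / 2) := by
    rw [← Real.log_mul (by norm_num) (by positivity)]; congr 1; ring
  have h4 : -Real.log 2 ≤ Real.log q := by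
    rw [← Real.log_inv]; exact Real.log_le_log (by norm_num) (by linarith)
  have h5 : Real.log p ≤ Real.log (3 * d / 2) := Real.log_le_log hp hp2
  have h6 : Real.log (3 * d) ≤ 2 := by
    have := Real.log_le_sub_one_of_pos (x := 3 * d) (by positivity)
    linarith
  have h7 : -Real.log (3 * d) ≤ Real.log q - Real.log p := by linarith
  rcases le_total 0 (-Real.log (3 * d)) with h8 | h8
  · nlinarith
  · nlinarith [sq_nonneg (Real.log q - Real.log p)]

/-- Off the real axis, the real part of the squared logarithm loses the square of the difference of
the two arguments, which is at most (2π)². -/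
lemma norm_stepDerivC (z : ℂ) (h1 : 1 + z ≠ 0) (h2 : 1 - z ≠ 0) :
    ‖stepDerivC z‖ ≤ 2 / √Real.pi * (Real.exp (4 * Real.pi ^ 2) *
      Real.exp (-(Real.log ‖1 + z‖ - Real.log ‖1 - z‖) ^ 2)) / (‖1 + z‖ * ‖1 - z‖) := by
  rw [stepDerivC, norm_div, norm_mul, norm_mul, Complex.norm_exp, ← Real.exp_add]
  have h3 : ‖((2 / √Real.pi : ℝ) : ℂ)‖ = 2 / √Real.pi := by
    rw [Complex.norm_real, Real.norm_eq_abs, abs_of_nonneg (by positivity)]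
  rw [h3]
  gcongr
  have h4 : (-(Complex.log (1 + z) - Complex.log (1 - z)) ^ 2).re =
      -(Real.log ‖1 + z‖ - Real.log ‖1 - z‖) ^ 2 + ((1 + z).arg - (1 - z).arg) ^ 2 := by
    rw [pow_two, Complex.neg_re, Complex.mul_re, Complex.sub_re, Complex.sub_im, Complex.log_re,
      Complex.log_re, Complex.log_im, Complex.log_im]
    ring
  rw [h4, add_comm]
  gcongr
  have e1 := abs_le.1 (Complex.abs_arg_le_pi (1 + z))
  have e2 := abs_le.1 (Complex.abs_arg_le_pi (1 - z))
  have e3 : |(1 + z).arg - (1 - z).arg| ≤ 2 * Real.pi :=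
    abs_le.2 ⟨by linarith [e1.1, e2.2], by linarith [e1.2, e2.1]⟩
  calc _ = |(1 + z).arg - (1 - z).arg| ^ 2 := (sq_abs _).symm
    _ ≤ (2 * Real.pi) ^ 2 := by gcongr
    _ = _ := by ring

/-- The constant in the bound for `stepDerivC` near real points. -/
noncomputable def stepConst : ℝ := 2 / √Real.pi * (Real.exp (4 * Real.pi ^ 2) * Real.exp 4) * 4

/-- Within distance d/2 of t, the distance to the nearer of ±1 stays between d/2 and 3d/2, and the
distance to the other one is at least 1/2. -/
lemma norm_stepDerivC_le {t : ℝ} (ht : |t| < 1) {z : ℂ} (hz : ‖z - t‖ ≤ (1 - |t|) / 2) :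
    ‖stepDerivC z‖ ≤ stepConst * Real.exp (-Real.log (3 * (1 - |t|)) ^ 2) / (1 - |t|) := by
  set d := 1 - |t| with hd
  have hd0 : 0 < d := by linarith
  have hd1 : d ≤ 1 := by linarith [abs_nonneg t]
  have hz1 : ‖z‖ < 1 := by
    calc ‖z‖ = ‖(z - t) + t‖ := by rw [sub_add_cancel]
      _ ≤ ‖z - t‖ + ‖(t : ℂ)‖ := norm_add_le _ _
      _ ≤ d / 2 + |t| := by gcongr; rw [Complex.norm_real, Real.norm_eq_abs]
      _ < 1 := by linarith
  have hre := re_pos_of_norm_lt_one hz1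
  have h1 : 1 + z ≠ 0 := fun h => by rw [h] at hre; simp at hre
  have h2 : 1 - z ≠ 0 := fun h => by rw [h] at hre; simp at hre
  have hp1 : |‖1 + z‖ - (1 + t)| ≤ d / 2 := by
    have : ‖(1 + t : ℂ)‖ = 1 + t := by
      have : (1 + t : ℂ) = ((1 + t : ℝ) : ℂ) := by push_cast; rfl
      rw [this, Complex.norm_real, Real.norm_eq_abs, abs_of_pos]
      linarith [neg_abs_le t]
    rw [← this]
    refine (abs_norm_sub_norm_le _ _).trans ?_
    rwa [add_sub_add_left_eq_sub]
  have hp2 : |‖1 - z‖ - (1 - t)| ≤ d / 2 := by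
    have : ‖(1 - t : ℂ)‖ = 1 - t := by
      have : (1 - t : ℂ) = ((1 - t : ℝ) : ℂ) := by push_cast; rfl
      rw [this, Complex.norm_real, Real.norm_eq_abs, abs_of_pos]
      linarith [le_abs_self t]
    rw [← this]
    refine (abs_norm_sub_norm_le _ _).trans ?_
    rwa [sub_sub_sub_cancel_left, norm_sub_rev]
  rw [abs_le] at hp1 hp2
  have hn1 := norm_pos_iff.2 h1
  have hn2 := norm_pos_iff.2 h2
  have key : Real.exp (-(Real.log ‖1 + z‖ - Real.log ‖1 - z‖) ^ 2) ≤
      Real.exp 4 * Real.exp (-Real.log (3 * d) ^ 2) ∧ d / 4 ≤ ‖1 + z‖ * ‖1 - z‖ := by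
    rcases le_total 0 t with h0 | h0
    · rw [abs_of_nonneg h0] at hd
      have a1 : d / 2 ≤ ‖1 - z‖ := by linarith [hp2.1]
      have a2 : 1 / 2 ≤ ‖1 + z‖ := by linarith [hp1.1]
      exact ⟨exp_neg_log_sub_log_sq_le hn2 hd0 hd1 a2 (by linarith [hp2.2]), by nlinarith⟩
    · rw [abs_of_nonpos h0] at hd
      have a1 : d / 2 ≤ ‖1 + z‖ := by linarith [hp1.1]
      have a2 : 1 / 2 ≤ ‖1 - z‖ := by linarith [hp2.1]
      rw [← neg_sub (Real.log ‖1 - z‖), neg_sq]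
      exact ⟨exp_neg_log_sub_log_sq_le hn1 hd0 hd1 a2 (by linarith [hp1.2]), by nlinarith⟩
  refine (norm_stepDerivC z h1 h2).trans ?_
  calc _ ≤ 2 / √Real.pi * (Real.exp (4 * Real.pi ^ 2) *
        (Real.exp 4 * Real.exp (-Real.log (3 * d) ^ 2))) / (d / 4) := by
        gcongr
        · exact key.1
        · exact key.2
    _ = _ := by rw [stepConst]; field_simp

/-- Cauchy's estimate on the circle of radius (1 - |t|)/2, played off against the Gaussian in log(1
- |t|). The remaining factor 1 - |t| is kept because it makes every derivative vanish at ±1. -/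
lemma abs_stepDeriv_le (k : ℕ) {t : ℝ} (ht : |t| < 1) :
    |stepDeriv k t| ≤ stepConst * (2 * (k : ℝ) ^ 1) ^ k *
      Real.exp (1 / 4 * (k : ℝ) ^ 2 + (1 + Real.log 3) * k + (1 + 2 * Real.log 3)) *
        (1 - |t|) := by
  set d := 1 - |t| with hd
  have hd0 : 0 < d := by linarith
  have hc : 0 < stepConst := by unfold stepConst; positivity
  have hsub : Metric.closedBall (t : ℂ) (d / 2) ⊆ Metric.ball 0 1 := by
    intro z hz
    rw [mem_closedBall_iff_norm] at hz
    rw [mem_ball_zero_iff]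
    calc ‖z‖ = ‖(z - t) + t‖ := by rw [sub_add_cancel]
      _ ≤ ‖z - t‖ + ‖(t : ℂ)‖ := norm_add_le _ _
      _ ≤ d / 2 + |t| := by gcongr; rw [Complex.norm_real, Real.norm_eq_abs]
      _ < 1 := by linarith
  have h := Complex.norm_iteratedDeriv_le_of_forall_mem_sphere_norm_le k (by positivity : 0 < d / 2)
    (f := stepDerivC) (c := t)
    (differentiableOn_stepDerivC.mono
      (Metric.closure_ball_subset_closedBall.trans hsub)).diffContOnCl
    (C := stepConst * Real.exp (-Real.log (3 * d) ^ 2) / d)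
    (fun z hz => norm_stepDerivC_le ht (mem_sphere_iff_norm.1 hz).le)
  rw [stepDeriv, if_pos ht]
  refine (Complex.abs_re_le_norm _).trans (h.trans ?_)
  have h3 : Real.log (3 * d) = Real.log 3 + Real.log d :=
    Real.log_mul (by norm_num) hd0.ne'
  -- With u = log(3d), completing the square gives -u² ≤ (k+2) u + (k+2)²/4; this is the origin of
  -- 1/4. Of the k + 2 powers of d, k cancel the radius in Cauchy's estimate, one cancels 1/d, and
  -- one survives.
  have key : Real.exp (-Real.log (3 * d) ^ 2) ≤
      Real.exp (1 / 4 * (k : ℝ) ^ 2 + (1 + Real.log 3) * k + (1 + 2 * Real.log 3)) *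
        d ^ (k + 2) := by
    have : d ^ (k + 2) = Real.exp (((k : ℝ) + 2) * Real.log d) := by
      rw [← Real.exp_log hd0, ← Real.exp_nat_mul, Real.log_exp]; push_cast; rfl
    rw [this, ← Real.exp_add]
    apply Real.exp_le_exp.2
    rw [h3]
    nlinarith [sq_nonneg (Real.log 3 + Real.log d + ((k : ℝ) + 2) / 2)]
  calc (k.factorial : ℝ) * (stepConst * Real.exp (-Real.log (3 * d) ^ 2) / d) / (d / 2) ^ k
      ≤ (k : ℝ) ^ k * (stepConst * (Real.exp (1 / 4 * (k : ℝ) ^ 2 + (1 + Real.log 3) * k +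
          (1 + 2 * Real.log 3)) * d ^ (k + 2)) / d) / (d / 2) ^ k := by
        gcongr
        exact_mod_cast Nat.factorial_le_pow k
    _ = _ := by
        rw [mul_pow, div_pow, pow_add]
        field_simp

lemma exists_abs_stepDeriv_le (a : ℝ) (ha : 1 / 4 < a) :
    ∃ C : ℝ, 0 < C ∧ ∀ k : ℕ, ∀ t : ℝ, |t| < 1 →
      |stepDeriv k t| ≤ C * Real.exp (a * (k : ℝ) ^ 2) * (1 - |t|) := by
  obtain ⟨b, hb1, hb2⟩ := exists_between ha
  obtain ⟨C₁, hC₁, h₁⟩ := exists_pow_mul_pow_le_exp_sq 2 1 (a - b) (by norm_num) (by linarith)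
  obtain ⟨C₂, hC₂, h₂⟩ := exists_exp_shift_sq_le (1 / 4) b (1 + Real.log 3) hb1
  have hc : 0 < stepConst := by unfold stepConst; positivity
  refine ⟨stepConst * C₁ * C₂ * Real.exp (1 + 2 * Real.log 3), by positivity, fun k t ht => ?_⟩
  refine (abs_stepDeriv_le k ht).trans ?_
  refine mul_le_mul_of_nonneg_right ?_ (by linarith)
  rw [Real.exp_add _ (1 + 2 * Real.log 3)]
  calc stepConst * (2 * (k : ℝ) ^ 1) ^ k *
        (Real.exp (1 / 4 * (k : ℝ) ^ 2 + (1 + Real.log 3) * k) * Real.exp (1 + 2 * Real.log 3))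
      ≤ stepConst * (C₁ * Real.exp ((a - b) * (k : ℝ) ^ 2)) *
        ((C₂ * Real.exp (b * (k : ℝ) ^ 2)) * Real.exp (1 + 2 * Real.log 3)) := by
        gcongr
        · exact h₁ k
        · exact h₂ k
    _ = stepConst * C₁ * C₂ * Real.exp (1 + 2 * Real.log 3) *
          (Real.exp ((a - b) * (k : ℝ) ^ 2) * Real.exp (b * (k : ℝ) ^ 2)) := by ring
    _ = _ := by rw [← Real.exp_add]; ring_nf

lemma stepDeriv_of_one_le (k : ℕ) {t : ℝ} (ht : 1 ≤ |t|) : stepDeriv k t = 0 := by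
  rw [stepDeriv, if_neg (not_lt.2 ht)]

lemma continuousAt_stepDeriv_of_abs_eq_one (k : ℕ) {t : ℝ} (ht : |t| = 1) :
    ContinuousAt (stepDeriv k) t := by
  obtain ⟨C, hC, h⟩ := exists_abs_stepDeriv_le 1 (by norm_num)
  have h1 : ∀ y, ‖stepDeriv k y‖ ≤ C * Real.exp (1 * (k : ℝ) ^ 2) * abs (1 - |y|) := by
    intro y
    rcases lt_or_ge (|y|) 1 with hy | hy
    · rw [abs_of_pos (a := 1 - |y|) (by linarith)]; exact h k y hy
    · rw [stepDeriv_of_one_le k hy, norm_zero]; positivity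
  rw [ContinuousAt, stepDeriv_of_one_le k ht.ge]
  refine squeeze_zero_norm h1 ?_
  have : Continuous fun y : ℝ => C * Real.exp (1 * (k : ℝ) ^ 2) * abs (1 - |y|) := by fun_prop
  have h2 := this.tendsto t
  rwa [ht, sub_self, abs_zero, mul_zero] at h2

lemma eventually_near_one_hasDerivAt {f g : ℝ → ℝ} (h1 : ∀ t, |t| < 1 → HasDerivAt f (g t) t)
    (h2 : ∀ t, 1 < |t| → HasDerivAt f (g t) t) {x : ℝ} (hx : |x| = 1) :
    ∀ᶠ y in 𝓝 x, y ≠ x → HasDerivAt f (g y) y := by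
  have hx0 : x ≠ 0 := fun h => by simp [h] at hx
  -- On this neighbourhood y has the sign of x, which excludes the other point of modulus one.
  have : {y : ℝ | 0 < y * x} ∈ 𝓝 x :=
    (isOpen_lt continuous_const (by fun_prop)).mem_nhds (mul_self_pos.2 hx0)
  filter_upwards [this] with y hy hyx
  rcases lt_trichotomy (|y|) 1 with h | h | h
  · exact h1 y h
  · rcases (abs_eq zero_le_one).1 h with rfl | rfl <;>
      rcases (abs_eq zero_le_one).1 hx with rfl | rfl <;> first | exact absurd rfl hyx | norm_num at hy
  · exact h2 y h

lemma hasDerivAt_stepDeriv (k : ℕ) (t : ℝ) :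
    HasDerivAt (stepDeriv k) (stepDeriv (k + 1) t) t := by
  have h2 : ∀ t, 1 < |t| → HasDerivAt (stepDeriv k) (stepDeriv (k + 1) t) t := by
    intro t ht
    rw [stepDeriv_of_one_le _ ht.le]
    refine (hasDerivAt_const t (0 : ℝ)).congr_of_eventuallyEq ?_
    filter_upwards [(isOpen_lt continuous_const continuous_abs).mem_nhds ht] with y hy
    exact stepDeriv_of_one_le k (le_of_lt hy)
  rcases lt_trichotomy (|t|) 1 with h | h | h
  · exact hasDerivAt_stepDeriv_of_lt k h
  · exact hasDerivAt_of_eventually_hasDerivAt_of_ne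
      (eventually_near_one_hasDerivAt (fun t ht => hasDerivAt_stepDeriv_of_lt k ht) h2 h)
      (continuousAt_stepDeriv_of_abs_eq_one k h) (continuousAt_stepDeriv_of_abs_eq_one _ h)
  · exact h2 t h

lemma erf_neg (x : ℝ) : erf (-x) = -erf x := by
  have h := intervalIntegral.integral_comp_neg (a := 0) (b := x)
    (fun s : ℝ => Real.exp (-s ^ 2))
  simp only [neg_sq, neg_zero] at h
  rw [erf, erf, h, intervalIntegral.integral_symm]
  ring

lemma tendsto_erf_atTop : Tendsto erf atTop (𝓝 1) := by
  have h := MeasureTheory.intervalIntegral_tendsto_integral_Ioi (μ := MeasureTheory.volume)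
    (f := fun s : ℝ => Real.exp (-1 * s ^ 2)) 0
    (integrable_exp_neg_mul_sq one_pos).integrableOn tendsto_id
  rw [integral_gaussian_Ioi] at h
  have h2 := h.const_mul (2 / √Real.pi)
  have e : 2 / √Real.pi * (√(Real.pi / 1) / 2) = 1 := by
    rw [div_one]
    have : √Real.pi ≠ 0 := (Real.sqrt_pos.2 Real.pi_pos).ne'
    field_simp
  rw [e] at h2
  refine h2.congr fun x => ?_
  simp [erf]

lemma hasDerivAt_erf (x : ℝ) : HasDerivAt erf (2 / √Real.pi * Real.exp (-x ^ 2)) x := by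
  have hc : Continuous fun s : ℝ => Real.exp (-s ^ 2) := by fun_prop
  exact (hc.integral_hasStrictDerivAt 0 x).hasDerivAt.const_mul _

lemma two_mul_artanh {t : ℝ} (ht : |t| ≤ 1) :
    2 * Real.artanh t = Real.log ((1 + t) / (1 - t)) := by
  rw [Real.artanh_eq_half_log (abs_le.1 ht)]; ring

lemma step_of_abs_lt {t : ℝ} (ht : |t| < 1) :
    step t = 1 / 2 * erf (Real.log ((1 + t) / (1 - t))) + 1 / 2 := by
  have := abs_lt.1 ht
  rw [step, if_neg (by linarith [this.1]), if_neg (by linarith [this.2]), two_mul_artanh ht.le]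

lemma hasDerivAt_step_of_abs_lt {t : ℝ} (ht : |t| < 1) : HasDerivAt step (stepDeriv 0 t) t := by
  have h0 := abs_lt.1 ht
  have hp : 0 < 1 + t := by linarith [h0.1]
  have hm : 0 < 1 - t := by linarith [h0.2]
  have e1 : HasDerivAt (fun t : ℝ => Real.log ((1 + t) / (1 - t))) (2 / ((1 + t) * (1 - t))) t := by
    have := (((hasDerivAt_id t).const_add 1).div ((hasDerivAt_id t).const_sub 1) hm.ne').log
      (div_pos hp hm).ne'
    convert! this using 1
    simp only [Pi.div_apply, id]
    field_simp
    ring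
  have e2 := (((hasDerivAt_erf _).comp t e1).const_mul (1 / 2)).add_const (1 / 2)
  have e3 : stepDeriv 0 t = 1 / 2 * (2 / √Real.pi *
      Real.exp (-Real.log ((1 + t) / (1 - t)) ^ 2) * (2 / ((1 + t) * (1 - t)))) := by
    have c1 : Complex.log (1 + t) = (Real.log (1 + t) : ℝ) := by
      rw [Complex.ofReal_log hp.le]; push_cast; rfl
    have c2 : Complex.log (1 - t) = (Real.log (1 - t) : ℝ) := by
      rw [Complex.ofReal_log hm.le]; push_cast; rfl
    have c3 : stepDerivC t = ((2 / √Real.pi *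
        Real.exp (-(Real.log (1 + t) - Real.log (1 - t)) ^ 2) / ((1 + t) * (1 - t)) : ℝ) : ℂ) := by
      rw [stepDerivC, c1, c2]; push_cast; rfl
    rw [stepDeriv, if_pos ht, iteratedDeriv_zero, c3, Complex.ofReal_re,
      Real.log_div hp.ne' hm.ne']
    ring
  rw [e3]
  refine e2.congr_of_eventuallyEq ?_
  filter_upwards [(isOpen_lt continuous_abs continuous_const).mem_nhds ht] with y hy
  simpa using step_of_abs_lt hy

lemma step_of_one_le {t : ℝ} (ht : 1 ≤ t) : step t = 1 := by
  rw [step, if_neg (by linarith), if_pos ht]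

lemma step_of_le_neg_one {t : ℝ} (ht : t ≤ -1) : step t = 0 := by
  rw [step, if_pos ht]

lemma continuousAt_step_one : ContinuousAt step 1 := by
  rw [continuousAt_iff_continuous_left'_right']
  constructor
  · rw [ContinuousWithinAt, step_of_one_le le_rfl]
    have h1 : Tendsto (fun t : ℝ => (1 + t) / (1 - t)) (𝓝[<] 1) atTop := by
      have a1 : Tendsto (fun t : ℝ => 1 + t) (𝓝[<] 1) (𝓝 2) := by
        have : Continuous fun t : ℝ => 1 + t := by fun_prop
        have := this.tendsto 1
        norm_num at this
        exact this.mono_left nhdsWithin_le_nhds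
      have a2 : Tendsto (fun t : ℝ => 1 - t) (𝓝[<] 1) (𝓝[>] 0) := by
        refine tendsto_nhdsWithin_iff.2 ⟨?_, ?_⟩
        · have : Continuous fun t : ℝ => 1 - t := by fun_prop
          have := this.tendsto 1
          rw [sub_self] at this
          exact this.mono_left nhdsWithin_le_nhds
        · filter_upwards [self_mem_nhdsWithin] with t ht
          exact sub_pos.2 (mem_Iio.1 ht)
      exact a1.pos_mul_atTop (by norm_num) a2.inv_tendsto_nhdsGT_zero
    have h2 := ((tendsto_erf_atTop.comp (Real.tendsto_log_atTop.comp h1)).const_mul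
      (1 / 2)).add_const (1 / 2)
    norm_num at h2
    refine h2.congr' ?_
    filter_upwards [Ioo_mem_nhdsLT (show (-1 : ℝ) < 1 by norm_num)] with t ht
    rw [step_of_abs_lt (abs_lt.2 ht)]
  · refine (continuousWithinAt_const (b := (1 : ℝ))).congr (fun y hy => step_of_one_le (le_of_lt hy))
      (step_of_one_le le_rfl)

lemma step_neg (t : ℝ) : step (-t) = 1 - step t := by
  rcases lt_or_ge (|t|) 1 with h | h
  · have h0 := abs_lt.1 h
    rw [step_of_abs_lt h, step_of_abs_lt (by rwa [abs_neg])]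
    have : (1 + -t) / (1 - -t) = ((1 + t) / (1 - t))⁻¹ := by rw [inv_div]; ring_nf
    rw [this, Real.log_inv, erf_neg]
    ring
  · rcases le_abs'.1 h with h | h
    · rw [step_of_le_neg_one h, step_of_one_le (by linarith), sub_zero]
    · rw [step_of_one_le h, step_of_le_neg_one (by linarith), sub_self]

lemma continuousAt_step_neg_one : ContinuousAt step (-1) := by
  have h : step = fun t => 1 - step (-t) := funext fun t => by rw [step_neg]; ring
  have h2 : ContinuousAt step (-(-1)) := by rw [neg_neg]; exact continuousAt_step_one
  rw [h]
  exact continuousAt_const.sub (ContinuousAt.comp (f := fun t : ℝ => -t) h2 continuousAt_neg)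

lemma hasDerivAt_step (t : ℝ) : HasDerivAt step (stepDeriv 0 t) t := by
  have h2 : ∀ t, 1 < |t| → HasDerivAt step (stepDeriv 0 t) t := by
    intro t ht
    rw [stepDeriv_of_one_le _ ht.le]
    rcases lt_abs.1 ht with h | h
    · refine (hasDerivAt_const t (1 : ℝ)).congr_of_eventuallyEq ?_
      filter_upwards [lt_mem_nhds h] with y hy
      exact step_of_one_le hy.le
    · refine (hasDerivAt_const t (0 : ℝ)).congr_of_eventuallyEq ?_
      filter_upwards [gt_mem_nhds (show t < -1 by linarith)] with y hy
      exact step_of_le_neg_one hy.le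
  rcases lt_trichotomy (|t|) 1 with h | h | h
  · exact hasDerivAt_step_of_abs_lt h
  · refine hasDerivAt_of_eventually_hasDerivAt_of_ne
      (eventually_near_one_hasDerivAt (fun t ht => hasDerivAt_step_of_abs_lt ht) h2 h)
      ?_ (continuousAt_stepDeriv_of_abs_eq_one _ h)
    rcases (abs_eq zero_le_one).1 h with rfl | rfl
    · exact continuousAt_step_one
    · exact continuousAt_step_neg_one
  · exact h2 t h

lemma iteratedDeriv_succ_step (k : ℕ) : iteratedDeriv (k + 1) step = stepDeriv k := by
  induction k with
  | zero => rw [iteratedDeriv_one]; exact funext fun t => (hasDerivAt_step t).deriv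
  | succ k ih => rw [iteratedDeriv_succ, ih]; exact funext fun t => (hasDerivAt_stepDeriv k t).deriv

lemma contDiff_step : ContDiff ℝ ∞ step := by
  refine contDiff_of_differentiable_iteratedDeriv fun m _ => ?_
  cases m with
  | zero => rw [iteratedDeriv_zero]; exact fun t => (hasDerivAt_step t).differentiableAt
  | succ m =>
    rw [iteratedDeriv_succ_step]; exact fun t => (hasDerivAt_stepDeriv m t).differentiableAt

lemma logSq_step (R : ℝ) : LogSq (ι := Unit) (Ioo (-R) R) fun _ => step := by
  refine ⟨fun _ => contDiff_step.contDiffOn, fun a ha => ?_⟩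
  obtain ⟨C, hC, h⟩ := exists_abs_stepDeriv_le a ha
  obtain ⟨M, hM⟩ := (isCompact_Icc (a := -R) (b := R)).exists_bound_of_continuousOn
    contDiff_step.continuous.continuousOn
  refine ⟨C + |M|, by positivity, fun _ k x hx => ?_⟩
  cases k with
  | zero =>
    have := hM x ⟨hx.1.le, hx.2.le⟩
    rw [iteratedDeriv_zero]
    simp only [CharP.cast_eq_zero, ne_eq, OfNat.ofNat_ne_zero, not_false_eq_true, zero_pow,
      mul_zero, Real.exp_zero, mul_one]
    rw [Real.norm_eq_abs] at this
    linarith [le_abs_self M]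
  | succ k =>
    rw [iteratedDeriv_succ_step]
    have hm : Real.exp (a * (k : ℝ) ^ 2) ≤ Real.exp (a * ((k + 1 : ℕ) : ℝ) ^ 2) := by
      have : (k : ℝ) ≤ ((k + 1 : ℕ) : ℝ) := by push_cast; linarith
      gcongr
    rcases lt_or_ge (|x|) 1 with hx1 | hx1
    · calc |stepDeriv k x| ≤ C * Real.exp (a * (k : ℝ) ^ 2) * (1 - |x|) := h k x hx1
        _ ≤ C * Real.exp (a * (k : ℝ) ^ 2) * 1 := by gcongr; linarith [abs_nonneg x]
        _ ≤ (C + |M|) * Real.exp (a * ((k + 1 : ℕ) : ℝ) ^ 2) := by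
          rw [mul_one]; gcongr; linarith [abs_nonneg M]
    · rw [stepDeriv_of_one_le k hx1, abs_zero]; positivity

/-! ### Chebyshev expansion and a Jackson estimate -/

/-- The (unnormalised) Fourier coefficients of `θ ↦ f (cos θ)`. -/
noncomputable def chebCoeff (f : ℝ → ℝ) (j : ℤ) : ℂ :=
  ∫ θ in (-Real.pi)..Real.pi, Complex.exp (-(Complex.I * j * θ)) * (f (Real.cos θ) : ℂ)

lemma exp_neg_I_mul_pi (j : ℤ) :
    Complex.exp (-(Complex.I * j * (-Real.pi : ℝ))) =
      Complex.exp (-(Complex.I * j * (Real.pi : ℝ))) := by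
  refine Complex.exp_eq_exp_iff_exists_int.2 ⟨j, ?_⟩
  push_cast
  ring

/-- Integration by parts: the boundary terms cancel by periodicity, and writing the factor sin θ
from the chain rule as a difference of exponentials shifts the frequency by one in both directions.
-/
lemma chebCoeff_eq {f f' : ℝ → ℝ} (hf : ∀ x ∈ Icc (-1 : ℝ) 1, HasDerivAt f (f' x) x)
    (hf' : ContinuousOn f' (Icc (-1) 1)) {j : ℤ} (hj : j ≠ 0) :
    chebCoeff f j = (chebCoeff f' (j - 1) - chebCoeff f' (j + 1)) / (2 * j) := by
  have hj' : (j : ℂ) ≠ 0 := by exact_mod_cast hj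
  have hcos : ∀ θ : ℝ, Real.cos θ ∈ Icc (-1 : ℝ) 1 := Real.cos_mem_Icc
  have hc : Continuous fun θ : ℝ => f' (Real.cos θ) :=
    hf'.comp_continuous Real.continuous_cos hcos
  have hfc : Continuous fun θ : ℝ => f (Real.cos θ) := by
    refine continuous_iff_continuousAt.2 fun θ => ?_
    exact ContinuousAt.comp (f := Real.cos) (hf _ (hcos θ)).continuousAt
      Real.continuous_cos.continuousAt
  have hu : ∀ θ : ℝ, HasDerivAt (fun θ : ℝ => (f (Real.cos θ) : ℂ))
      ((f' (Real.cos θ) * -Real.sin θ : ℝ) : ℂ) θ := fun θ =>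
    ((hf _ (hcos θ)).comp θ (Real.hasDerivAt_cos θ)).ofReal_comp
  have hv : ∀ θ : ℝ, HasDerivAt
      (fun θ : ℝ => Complex.exp (-(Complex.I * j * θ)) / (-(Complex.I * j)))
      (Complex.exp (-(Complex.I * j * θ))) θ := by
    intro θ
    have h1 : HasDerivAt (fun θ : ℝ => -(Complex.I * j * (θ : ℂ))) (-(Complex.I * j)) θ := by
      have := ((hasDerivAt_id (θ : ℂ)).const_mul (Complex.I * j)).neg.comp_ofReal
      simpa using this
    have h2 := h1.cexp.div_const (-(Complex.I * j))
    rwa [mul_div_cancel_right₀] at h2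
    exact neg_ne_zero.2 (mul_ne_zero Complex.I_ne_zero hj')
  have hibp := intervalIntegral.integral_mul_deriv_eq_deriv_mul (a := -Real.pi) (b := Real.pi)
    (fun θ _ => hu θ) (fun θ _ => hv θ)
    ((Complex.continuous_ofReal.comp (hc.mul Real.continuous_sin.neg)).intervalIntegrable _ _)
    (Continuous.intervalIntegrable (by fun_prop) _ _)
  rw [exp_neg_I_mul_pi, Real.cos_neg, sub_self, zero_sub] at hibp
  have hsin : ∀ θ : ℝ, ((f' (Real.cos θ) * -Real.sin θ : ℝ) : ℂ) *
      (Complex.exp (-(Complex.I * j * θ)) / (-(Complex.I * j))) =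
        (-1 / (2 * j)) * (Complex.exp (-(Complex.I * (j - 1 : ℤ) * θ)) * (f' (Real.cos θ) : ℂ) -
          Complex.exp (-(Complex.I * (j + 1 : ℤ) * θ)) * (f' (Real.cos θ) : ℂ)) := by
    intro θ
    have e1 : Complex.exp (-(Complex.I * (j - 1 : ℤ) * θ)) =
        Complex.exp (-(Complex.I * j * θ)) * Complex.exp (θ * Complex.I) := by
      rw [← Complex.exp_add]; push_cast; ring_nf
    have e2 : Complex.exp (-(Complex.I * (j + 1 : ℤ) * θ)) =
        Complex.exp (-(Complex.I * j * θ)) * Complex.exp (-θ * Complex.I) := by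
      rw [← Complex.exp_add]; push_cast; ring_nf
    rw [e1, e2]
    push_cast
    rw [Complex.sin]
    field_simp
    ring
  simp only [hsin] at hibp
  rw [intervalIntegral.integral_const_mul, intervalIntegral.integral_sub] at hibp
  · rw [chebCoeff]
    simp only [mul_comm (Complex.exp (-(Complex.I * (j : ℂ) * _)))]
    rw [hibp, chebCoeff, chebCoeff]
    ring
  · exact ((by fun_prop : Continuous fun θ : ℝ => Complex.exp (-(Complex.I * (j - 1 : ℤ) * θ))).mul
      (Complex.continuous_ofReal.comp hc)).intervalIntegrable _ _
  · exact ((by fun_prop : Continuous fun θ : ℝ => Complex.exp (-(Complex.I * (j + 1 : ℤ) * θ))).mul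
      (Complex.continuous_ofReal.comp hc)).intervalIntegrable _ _

/-- Each use of `chebCoeff_eq` trades a derivative for a division by the frequency, which then moves
by one. Starting at m + k or beyond, k such steps divide by at least m every time. -/
lemma norm_chebCoeff_le {s : Set ℝ} (hs : IsOpen s) (hsub : Icc (-1) 1 ⊆ s) (k : ℕ) :
    ∀ {f : ℝ → ℝ}, ContDiffOn ℝ ∞ f s → ∀ {M : ℝ},
      (∀ x ∈ Icc (-1 : ℝ) 1, |iteratedDeriv k f x| ≤ M) → ∀ {m : ℕ}, 1 ≤ m → ∀ {j : ℤ},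
      m + k ≤ j.natAbs → ‖chebCoeff f j‖ ≤ 2 * Real.pi * M / (m : ℝ) ^ k := by
  induction k with
  | zero =>
    intro f hf M hM m hm j hj
    rw [chebCoeff, pow_zero, div_one]
    refine (intervalIntegral.norm_integral_le_of_norm_le_const (C := M) fun θ _ => ?_).trans ?_
    · rw [norm_mul, Complex.norm_exp]
      have : (-(Complex.I * j * θ)).re = 0 := by simp
      rw [this, Real.exp_zero, one_mul, Complex.norm_real]
      exact hM _ (Real.cos_mem_Icc θ)
    · rw [abs_of_pos (by linarith [Real.pi_pos])]
      linarith
  | succ k ih =>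
    intro f hf M hM m hm j hj
    have hj0 : j ≠ 0 := by rintro rfl; simp at hj
    have hd : ContDiffOn ℝ ∞ (deriv f) s := hf.deriv_of_isOpen hs (by simp)
    have hM' : ∀ x ∈ Icc (-1 : ℝ) 1, |iteratedDeriv k (deriv f) x| ≤ M := by
      intro x hx; rw [← iteratedDeriv_succ']; exact hM x hx
    rw [chebCoeff_eq (f' := deriv f)
      (fun x hx => ((hf.contDiffAt (hs.mem_nhds (hsub hx))).differentiableAt
        (by simp)).hasDerivAt) (hd.continuousOn.mono hsub) hj0]
    have h1 := ih hd hM' hm (j := j - 1) (by omega)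
    have h2 := ih hd hM' hm (j := j + 1) (by omega)
    have hM0 : 0 ≤ M := (abs_nonneg _).trans (hM 0 ⟨by norm_num, by norm_num⟩)
    have hm0 : (0 : ℝ) < m := by exact_mod_cast hm
    have hjm : (m : ℝ) ≤ |(j : ℝ)| := by
      rw [← Int.cast_abs, Int.abs_eq_natAbs]; exact_mod_cast (by omega : m ≤ j.natAbs)
    rw [norm_div, norm_mul, Complex.norm_intCast, Complex.norm_ofNat]
    calc _ ≤ (2 * Real.pi * M / (m : ℝ) ^ k + 2 * Real.pi * M / (m : ℝ) ^ k) / (2 * m) := by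
          gcongr
          exact (norm_sub_le _ _).trans (add_le_add h1 h2)
      _ = _ := by rw [pow_succ]; field_simp; ring

/-- Here m = |j| - k ≥ |j|/2, which gives a bound of order M (2/|j|)^k. Two powers of j are kept to
make the tail summable; the other k - 2 are estimated by powers of N. -/
lemma norm_chebCoeff_le_div_sq {s : Set ℝ} (hs : IsOpen s) (hsub : Icc (-1) 1 ⊆ s)
    {f : ℝ → ℝ} (hf : ContDiffOn ℝ ∞ f s) {k N : ℕ} (hk : 2 ≤ k) (hN : 2 * k ≤ N) {M : ℝ}
    (hM : ∀ x ∈ Icc (-1 : ℝ) 1, |iteratedDeriv k f x| ≤ M) {j : ℤ} (hj : N < j.natAbs) :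
    ‖chebCoeff f j‖ ≤ 2 * Real.pi * (M * 2 ^ k * N ^ 2 / N ^ k) * (1 / (j : ℝ) ^ 2) := by
  have hM0 : 0 ≤ M := (abs_nonneg _).trans (hM 0 ⟨by norm_num, by norm_num⟩)
  refine (norm_chebCoeff_le hs hsub k hf hM (m := j.natAbs - k) (by omega) (by omega)).trans ?_
  have h1 : (j.natAbs : ℝ) / 2 ≤ ((j.natAbs - k : ℕ) : ℝ) := by
    rw [Nat.cast_sub (by omega)]
    have : (2 * k : ℝ) ≤ j.natAbs := by exact_mod_cast (by omega : 2 * k ≤ j.natAbs)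
    linarith
  have hN0 : (0 : ℝ) < N := by exact_mod_cast (by omega : 0 < N)
  have hjN : (N : ℝ) ≤ j.natAbs := by exact_mod_cast hj.le
  have hj2 : (j : ℝ) ^ 2 = (j.natAbs : ℝ) ^ 2 := by
    rw [← sq_abs, ← Int.cast_abs, Int.abs_eq_natAbs]; rfl
  have hj0 : (0 : ℝ) < j.natAbs := hN0.trans_le hjN
  obtain ⟨d, rfl⟩ := Nat.exists_eq_add_of_le' hk
  calc 2 * Real.pi * M / ((j.natAbs - (d + 2) : ℕ) : ℝ) ^ (d + 2)
      ≤ 2 * Real.pi * M / ((j.natAbs : ℝ) / 2) ^ (d + 2) := by gcongr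
    _ = 2 * Real.pi * M * 2 ^ (d + 2) / ((j.natAbs : ℝ) ^ d * (j.natAbs : ℝ) ^ 2) := by
        rw [div_pow, pow_add (j.natAbs : ℝ)]; field_simp
    _ ≤ 2 * Real.pi * M * 2 ^ (d + 2) / ((N : ℝ) ^ d * (j.natAbs : ℝ) ^ 2) := by gcongr
    _ = _ := by rw [hj2, pow_add (N : ℝ)]; field_simp

/-- The Chebyshev partial sum of a smooth function. -/
noncomputable def chebPartialSum (f : ℝ → ℝ) (N : ℕ) : Polynomial ℝ :=
  ∑ j ∈ Finset.Icc (-(N : ℤ)) N,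
    Polynomial.C ((chebCoeff f j).re / (2 * Real.pi)) * Polynomial.Chebyshev.T ℝ j

lemma natDegree_chebPartialSum_le (f : ℝ → ℝ) (N : ℕ) : (chebPartialSum f N).natDegree ≤ N := by
  refine Polynomial.natDegree_sum_le_of_forall_le _ _ fun j hj => ?_
  refine (Polynomial.natDegree_C_mul_le _ _).trans ?_
  rw [Polynomial.Chebyshev.natDegree_T]
  rw [Finset.mem_Icc] at hj
  omega

/-- The Fourier series of the even function θ ↦ f(cos θ) on the circle, averaged over θ and -θ so
that only cosines remain. -/
lemma hasSum_chebCoeff {f : ℝ → ℝ} (hf : ContinuousOn f (Icc (-1) 1))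
    (hsum : Summable fun j => ‖chebCoeff f j‖) (θ : ℝ) :
    HasSum (fun j : ℤ => (chebCoeff f j).re / (2 * Real.pi) * Real.cos (j * θ))
      (f (Real.cos θ)) := by
  have hT : Fact (0 < 2 * Real.pi) := ⟨Real.two_pi_pos⟩
  have hcont : Continuous fun x : AddCircle (2 * Real.pi) =>
      ((f (Real.Angle.cos x) : ℝ) : ℂ) := by
    refine Complex.continuous_ofReal.comp (hf.comp_continuous Real.Angle.continuous_cos fun x => ?_)
    induction x using Real.Angle.induction_on with
    | _ x => exact Real.cos_mem_Icc x
  let F : C(AddCircle (2 * Real.pi), ℂ) := ⟨_, hcont⟩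
  have hF : ∀ x : ℝ, F (x : AddCircle (2 * Real.pi)) = (f (Real.cos x) : ℂ) := fun x => rfl
  have hfour : ∀ (j : ℤ) (x : ℝ), fourier j (x : AddCircle (2 * Real.pi)) =
      Complex.exp (Complex.I * j * x) := by
    intro j x
    rw [fourier_coe_apply]
    congr 1
    have : (Real.pi : ℂ) ≠ 0 := by exact_mod_cast Real.pi_ne_zero
    push_cast
    field_simp
  have hco : ∀ j : ℤ, fourierCoeff F j = chebCoeff f j / (2 * Real.pi) := by
    intro j
    rw [fourierCoeff_eq_intervalIntegral F j (-Real.pi), chebCoeff]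
    have e : -Real.pi + 2 * Real.pi = Real.pi := by ring
    rw [e, Complex.real_smul]
    simp only [hfour, hF, smul_eq_mul]
    push_cast
    rw [one_div_mul_eq_div]
    congr 1
    refine intervalIntegral.integral_congr fun x _ => ?_
    congr 2
    ring
  have hs : Summable (fourierCoeff F) := by
    refine Summable.of_norm ?_
    refine (hsum.div_const (2 * Real.pi)).congr fun j => ?_
    rw [hco, norm_div]
    congr 1
    rw [norm_mul, Complex.norm_real, Real.norm_eq_abs, abs_of_pos Real.pi_pos]
    simp
  have h1 := has_pointwise_sum_fourier_series_of_summable hs (θ : AddCircle (2 * Real.pi))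
  have h2 := has_pointwise_sum_fourier_series_of_summable hs ((-θ : ℝ) : AddCircle (2 * Real.pi))
  rw [hF] at h1 h2
  rw [Real.cos_neg] at h2
  have h3 := (h1.add h2).mul_right (1 / 2 : ℂ)
  have h4 := Complex.hasSum_re h3
  have e : ((((f (Real.cos θ) : ℝ) : ℂ) + ((f (Real.cos θ) : ℝ) : ℂ)) * (1 / 2)).re =
      f (Real.cos θ) := by
    rw [← two_mul, mul_comm (2 : ℂ), mul_assoc]
    norm_num
  rw [e] at h4
  convert! h4 using 1
  funext j
  have e2 : Complex.exp (Complex.I * j * θ) + Complex.exp (Complex.I * j * (-θ : ℝ)) =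
      2 * ((Real.cos (j * θ) : ℝ) : ℂ) := by
    push_cast
    rw [Complex.two_cos]
    ring_nf
  rw [hfour, hfour, smul_eq_mul, smul_eq_mul, ← mul_add, e2, hco]
  have e3 : chebCoeff f j / (2 * Real.pi) * (2 * ((Real.cos (j * θ) : ℝ) : ℂ)) * (1 / 2) =
      ((Real.cos (j * θ) / (2 * Real.pi) : ℝ) : ℂ) * chebCoeff f j := by
    push_cast; ring
  rw [e3, Complex.re_ofReal_mul]
  ring

/-- Jackson-type estimate with explicit dependence on the order of differentiation. -/
lemma abs_sub_chebPartialSum_le {s : Set ℝ} (hs : IsOpen s) (hsub : Icc (-1) 1 ⊆ s)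
    {f : ℝ → ℝ} (hf : ContDiffOn ℝ ∞ f s) {k N : ℕ} (hk : 2 ≤ k) (hN : 2 * k ≤ N) {M : ℝ}
    (hM : ∀ x ∈ Icc (-1 : ℝ) 1, |iteratedDeriv k f x| ≤ M) {x : ℝ} (hx : x ∈ Icc (-1 : ℝ) 1) :
    |f x - (chebPartialSum f N).eval x| ≤
      (∑' j : ℤ, 1 / (j : ℝ) ^ 2) * (M * 2 ^ k * N ^ 2 / N ^ k) := by
  have hM0 : 0 ≤ M := (abs_nonneg _).trans (hM 0 ⟨by norm_num, by norm_num⟩)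
  set B := M * 2 ^ k * (N : ℝ) ^ 2 / (N : ℝ) ^ k with hB
  have hB0 : 0 ≤ B := by positivity
  have hsq : Summable fun j : ℤ => 1 / (j : ℝ) ^ 2 :=
    Real.summable_one_div_int_pow.2 (by norm_num)
  set J := Finset.Icc (-(N : ℤ)) N with hJ
  have hout : ∀ j ∉ J, ‖chebCoeff f j‖ ≤ 2 * Real.pi * B * (1 / (j : ℝ) ^ 2) := by
    intro j hj
    rw [hJ, Finset.mem_Icc] at hj
    exact norm_chebCoeff_le_div_sq hs hsub hf hk hN hM (by omega)
  have hsum : Summable fun j => ‖chebCoeff f j‖ := by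
    refine Summable.of_norm_bounded_eventually (hsq.mul_left (2 * Real.pi * B)) ?_
    filter_upwards [J.finite_toSet.compl_mem_cofinite] with j hj
    rw [norm_norm]
    exact hout j hj
  obtain ⟨θ, rfl⟩ : ∃ θ, Real.cos θ = x := ⟨Real.arccos x, Real.cos_arccos hx.1 hx.2⟩
  have h1 := hasSum_chebCoeff (hf.continuousOn.mono hsub) hsum θ
  have h2 : (chebPartialSum f N).eval (Real.cos θ) =
      ∑ j ∈ J, (chebCoeff f j).re / (2 * Real.pi) * Real.cos (j * θ) := by
    rw [chebPartialSum, Polynomial.eval_finsetSum]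
    simp [Polynomial.Chebyshev.T_real_cos, hJ]
  have h3 : HasSum (fun j : {j // j ∉ J} => (chebCoeff f j).re / (2 * Real.pi) * Real.cos (j * θ))
      (f (Real.cos θ) - ∑ j ∈ J, (chebCoeff f j).re / (2 * Real.pi) * Real.cos (j * θ)) :=
    (Finset.hasSum_compl_iff (f := fun j : ℤ => (chebCoeff f j).re / (2 * Real.pi) *
      Real.cos (j * θ)) J).2 (by simpa using h1)
  rw [h2, ← h3.tsum_eq]
  have h4 : ∀ j : {j // j ∉ J}, ‖(chebCoeff f j).re / (2 * Real.pi) * Real.cos (j * θ)‖ ≤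
      B * (1 / ((j : ℤ) : ℝ) ^ 2) := by
    intro j
    rw [norm_mul, norm_div, Real.norm_eq_abs, Real.norm_eq_abs, Real.norm_eq_abs,
      abs_of_pos Real.two_pi_pos]
    calc |(chebCoeff f j).re| / (2 * Real.pi) * |Real.cos (j * θ)|
        ≤ (2 * Real.pi * B * (1 / ((j : ℤ) : ℝ) ^ 2)) / (2 * Real.pi) * 1 := by
          gcongr
          · exact (Complex.abs_re_le_norm _).trans (hout j j.2)
          · exact Real.abs_cos_le_one _
      _ = _ := by have := Real.pi_pos; field_simp
  have h5 : Summable fun j : {j // j ∉ J} => B * (1 / ((j : ℤ) : ℝ) ^ 2) :=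
    (hsq.subtype _).mul_left B
  refine (tsum_of_norm_bounded h5.hasSum h4).trans ?_
  rw [tsum_mul_left, mul_comm]
  refine mul_le_mul_of_nonneg_right ?_ hB0
  exact hsq.tsum_subtype_le _ {j : ℤ | j ∉ J} (fun j => by positivity)

/-! ### Legendre polynomials and the Gauss–Legendre rule -/

open Polynomial in
lemma natDegree_X_sq_sub_one_pow (n : ℕ) : ((X ^ 2 - 1 : ℝ[X]) ^ n).natDegree = n * 2 := by
  have : (X ^ 2 - 1 : ℝ[X]) = X ^ 2 - C 1 := by simp
  rw [this, natDegree_pow, natDegree_X_pow_sub_C]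

open Polynomial in
lemma monic_X_sq_sub_one_pow (n : ℕ) : ((X ^ 2 - 1 : ℝ[X]) ^ n).Monic := by
  have : (X ^ 2 - 1 : ℝ[X]) = X ^ 2 - C 1 := by simp
  rw [this]
  exact (monic_X_pow_sub_C _ two_ne_zero).pow n

open Polynomial in
lemma coeff_legendre_ne_zero (n : ℕ) : (legendre n).coeff n ≠ 0 := by
  rw [legendre, coeff_C_mul, coeff_iterate_derivative]
  have h1 : ((X ^ 2 - 1 : ℝ[X]) ^ n).coeff (n + n) = 1 := by
    have := (monic_X_sq_sub_one_pow n).coeff_natDegree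
    rwa [natDegree_X_sq_sub_one_pow, mul_two] at this
  rw [h1, nsmul_eq_mul, mul_one]
  refine mul_ne_zero (by positivity) ?_
  exact_mod_cast (Nat.descFactorial_pos.2 (by omega)).ne'

lemma legendre_ne_zero (n : ℕ) : legendre n ≠ 0 := fun h => by
  simpa [h] using coeff_legendre_ne_zero n

open Polynomial in
lemma natDegree_legendre (n : ℕ) : (legendre n).natDegree = n := by
  refine le_antisymm ?_ (le_natDegree_of_ne_zero (coeff_legendre_ne_zero n))
  rw [legendre]
  refine (natDegree_C_mul_le _ _).trans ((natDegree_iterate_derivative _ _).trans ?_)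
  rw [natDegree_X_sq_sub_one_pow]; omega

open Polynomial in
lemma eval_iterate_derivative_X_sq_sub_one_pow {n m : ℕ} (h : m < n) {a : ℝ} (ha : a ^ 2 = 1) :
    (derivative^[m] ((X ^ 2 - 1 : ℝ[X]) ^ n)).eval a = 0 := by
  have h1 : (X - C a) ^ n ∣ (X ^ 2 - 1 : ℝ[X]) ^ n := by
    refine pow_dvd_pow_of_dvd (dvd_iff_isRoot.2 ?_) n
    simp [ha]
  have h2 := pow_sub_dvd_iterate_derivative_of_pow_dvd m h1
  have h3 : (X - C a) ∣ derivative^[m] ((X ^ 2 - 1 : ℝ[X]) ^ n) :=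
    (dvd_pow_self _ (by omega)).trans h2
  exact dvd_iff_isRoot.1 h3

open Polynomial in
-- Integration by parts m times; the derivatives of (x² - 1)^n of order below n vanish at ±1, so no
-- boundary terms arise.
lemma integral_iterate_derivative_mul (n m : ℕ) (hm : m ≤ n) (q : ℝ[X]) :
    ∫ x in (-1 : ℝ)..1, (derivative^[m] ((X ^ 2 - 1 : ℝ[X]) ^ n)).eval x * q.eval x =
      (-1) ^ m * ∫ x in (-1 : ℝ)..1, ((X ^ 2 - 1 : ℝ[X]) ^ n).eval x *
        (derivative^[m] q).eval x := by
  induction m generalizing q with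
  | zero => simp
  | succ m ih =>
    have h := intervalIntegral.integral_deriv_mul_eq_sub (a := (-1 : ℝ)) (b := 1)
      (u := fun x => (derivative^[m] ((X ^ 2 - 1 : ℝ[X]) ^ n)).eval x) (v := fun x => q.eval x)
      (u' := fun x => (derivative (derivative^[m] ((X ^ 2 - 1 : ℝ[X]) ^ n))).eval x)
      (v' := fun x => (derivative q).eval x)
      (fun x _ => Polynomial.hasDerivAt _ x) (fun x _ => Polynomial.hasDerivAt _ x)
      (Polynomial.continuous _ |>.intervalIntegrable _ _)
      (Polynomial.continuous _ |>.intervalIntegrable _ _)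
    rw [eval_iterate_derivative_X_sq_sub_one_pow (by omega) (by norm_num),
      eval_iterate_derivative_X_sq_sub_one_pow (by omega) (by norm_num),
      intervalIntegral.integral_add, ih (by omega)] at h
    · rw [Function.iterate_succ_apply', Function.iterate_succ_apply, pow_succ (-1 : ℝ)]
      linarith
    · exact ((Polynomial.continuous _).mul (Polynomial.continuous _)).intervalIntegrable _ _
    · exact ((Polynomial.continuous _).mul (Polynomial.continuous _)).intervalIntegrable _ _

open Polynomial in
/-- Orthogonality of the Legendre polynomial to polynomials of smaller degree. -/
lemma integral_legendre_mul_eq_zero {n : ℕ} {q : ℝ[X]} (hq : q.natDegree < n) :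
    ∫ x in (-1 : ℝ)..1, (legendre n).eval x * q.eval x = 0 := by
  have h := integral_iterate_derivative_mul n n le_rfl q
  rw [iterate_derivative_eq_zero hq] at h
  simp only [eval_zero, mul_zero, intervalIntegral.integral_zero] at h
  simp only [legendre, eval_mul, eval_C, mul_assoc]
  rw [intervalIntegral.integral_const_mul]
  simp only [one_div] at h ⊢
  rw [h, mul_zero]

open Polynomial in
-- By Rolle, counted with multiplicity, each differentiation loses at most one real root, and (x² -
-- 1)^n starts with 2n of them.
lemma card_roots_legendre (n : ℕ) : (legendre n).roots.card = n := by
  refine le_antisymm ((card_roots' _).trans (natDegree_legendre n).le) ?_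
  have h1 : ∀ m : ℕ, n + n ≤ (derivative^[m] ((X ^ 2 - 1 : ℝ[X]) ^ n)).roots.card + m := by
    intro m
    induction m with
    | zero =>
      have : (X ^ 2 - 1 : ℝ[X]) ^ n = (X - C 1) ^ n * (X - C (-1)) ^ n := by
        rw [← mul_pow]; congr 1; simp only [map_one, map_neg]; ring
      rw [Function.iterate_zero_apply, this, roots_mul, roots_pow, roots_pow, roots_X_sub_C,
        roots_X_sub_C]
      · simp
      · rw [← this]; exact (monic_X_sq_sub_one_pow n).ne_zero
    | succ m ih =>
      rw [Function.iterate_succ_apply']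
      have := card_roots_le_derivative (derivative^[m] ((X ^ 2 - 1 : ℝ[X]) ^ n))
      omega
  rw [legendre, roots_C_mul _ (by positivity)]
  have := h1 n
  omega

open Polynomial in
lemma exists_eval_ne_zero {p : ℝ[X]} (hp : p ≠ 0) : ∃ c ∈ Icc (-1 : ℝ) 1, p.eval c ≠ 0 := by
  by_contra! h
  exact hp (eq_zero_of_infinite_isRoot p ((Icc_infinite (by norm_num : (-1 : ℝ) < 1)).mono h))

open Polynomial in
-- If the Legendre polynomial were (x - a)² R, orthogonality to R would make the integral of ((x -
-- a) R)² vanish.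
lemma nodup_roots_legendre (n : ℕ) : (legendre n).roots.Nodup := by
  rw [Multiset.nodup_iff_count_le_one]
  intro a
  by_contra! h
  rw [count_roots, Nat.lt_iff_add_one_le, le_rootMultiplicity_iff (legendre_ne_zero n)] at h
  obtain ⟨R, hR⟩ := h
  have hne := legendre_ne_zero n
  have hR0 : R ≠ 0 := fun h0 => hne (by rw [hR, h0, mul_zero])
  have hdeg : R.natDegree < n := by
    have := natDegree_legendre n
    rw [hR, natDegree_mul (pow_ne_zero _ (X_sub_C_ne_zero a)) hR0, natDegree_pow,
      natDegree_X_sub_C] at this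
    omega
  have h0 := integral_legendre_mul_eq_zero hdeg
  obtain ⟨c, hc, hcne⟩ := exists_eval_ne_zero (mul_ne_zero (X_sub_C_ne_zero a) hR0)
  have : 0 < ∫ x in (-1 : ℝ)..1, (legendre n).eval x * R.eval x := by
    have e : ∀ x, (legendre n).eval x * R.eval x = (((X - C a) * R).eval x) ^ 2 := by
      intro x; rw [hR]; simp only [eval_mul, eval_pow]; ring
    simp only [e]
    refine intervalIntegral.integral_pos (by norm_num)
      ((Polynomial.continuous _).pow 2).continuousOn (fun x _ => sq_nonneg _) ⟨c, hc, by positivity⟩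
  linarith

open Polynomial in
-- If the Legendre polynomial is (x - a) R with a outside (-1, 1), then its product with R, (x - a)
-- R², has constant sign on [-1, 1], contradicting orthogonality to R.
lemma mem_Ioo_of_mem_gaussNodes {n : ℕ} {a : ℝ} (ha : a ∈ gaussNodes n) : a ∈ Ioo (-1 : ℝ) 1 := by
  rw [gaussNodes, Multiset.mem_toFinset, mem_roots (legendre_ne_zero n)] at ha
  obtain ⟨R, hR⟩ := dvd_iff_isRoot.2 ha
  have hne := legendre_ne_zero n
  have hR0 : R ≠ 0 := fun h0 => hne (by rw [hR, h0, mul_zero])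
  have hdeg : R.natDegree < n := by
    have := natDegree_legendre n
    rw [hR, natDegree_mul (X_sub_C_ne_zero a) hR0, natDegree_X_sub_C] at this
    omega
  have h0 := integral_legendre_mul_eq_zero hdeg
  obtain ⟨c, hc, hcne⟩ := exists_eval_ne_zero (mul_ne_zero (X_sub_C_ne_zero a) hR0)
  rw [eval_mul, eval_sub, eval_X, eval_C] at hcne
  have hca := left_ne_zero_of_mul hcne
  have hRc : 0 < R.eval c ^ 2 := by have := right_ne_zero_of_mul hcne; positivity
  have e : ∀ x, (legendre n).eval x * R.eval x = (x - a) * R.eval x ^ 2 := by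
    intro x; rw [hR]; simp only [eval_mul, eval_sub, eval_X, eval_C]; ring
  simp only [e] at h0
  have hcont : Continuous fun x : ℝ => (x - a) * R.eval x ^ 2 :=
    (continuous_id.sub continuous_const).mul ((Polynomial.continuous _).pow 2)
  by_contra hcon
  rw [mem_Ioo, not_and_or, not_lt, not_lt] at hcon
  rcases hcon with h | h
  · have : 0 < ∫ x in (-1 : ℝ)..1, (x - a) * R.eval x ^ 2 :=
      intervalIntegral.integral_pos (by norm_num) hcont.continuousOn
        (fun x hx => mul_nonneg (by linarith [hx.1]) (sq_nonneg _))
        ⟨c, hc, mul_pos (lt_of_le_of_ne (by linarith [hc.1]) hca.symm) hRc⟩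
    linarith
  · have : 0 < ∫ x in (-1 : ℝ)..1, -((x - a) * R.eval x ^ 2) :=
      intervalIntegral.integral_pos (by norm_num) hcont.neg.continuousOn
        (fun x hx => by nlinarith [hx.2, sq_nonneg (R.eval x)])
        ⟨c, hc, by
          have : c - a < 0 := lt_of_le_of_ne (by linarith [hc.2]) hca
          nlinarith⟩
    rw [intervalIntegral.integral_neg] at this
    linarith

lemma card_gaussNodes (n : ℕ) : (gaussNodes n).card = n := by
  rw [gaussNodes, Multiset.toFinset_card_of_nodup (nodup_roots_legendre n), card_roots_legendre]

open Polynomial in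
lemma integral_eq_sum_gaussWeight_of_degree_lt {n : ℕ} {r : ℝ[X]} (hr : r.degree < n) :
    ∫ x in (-1 : ℝ)..1, r.eval x = ∑ a ∈ gaussNodes n, gaussWeight n a * r.eval a := by
  have h := Lagrange.eq_interpolate (s := gaussNodes n) (v := id) (f := r)
    (Function.injective_id.injOn) (by rwa [card_gaussNodes])
  conv_lhs => rw [h]
  simp only [Lagrange.interpolate_apply, eval_finsetSum, eval_mul, eval_C, id]
  rw [intervalIntegral.integral_finsetSum]
  · refine Finset.sum_congr rfl fun a _ => ?_
    rw [intervalIntegral.integral_const_mul, mul_comm]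
    rfl
  · intro a _
    exact ((Polynomial.continuous _).const_mul _ |>.intervalIntegrable _ _)

open Polynomial in
/-- Exactness of the Gauss–Legendre rule. -/
lemma integral_eq_sum_gaussWeight {n : ℕ} {p : ℝ[X]} (hp : p.natDegree < 2 * n) :
    ∫ x in (-1 : ℝ)..1, p.eval x = ∑ a ∈ gaussNodes n, gaussWeight n a * p.eval a := by
  have hne := legendre_ne_zero n
  -- In the division by the Legendre polynomial, the multiple of it has zero integral by
  -- orthogonality and zero quadrature sum because the nodes are its roots; on the remainder the
  -- rule is interpolatory.
  have hdiv := EuclideanDomain.div_add_mod p (legendre n)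
  have hmod : (p % legendre n).degree < n := by
    have : (p % legendre n).degree < (legendre n).degree := EuclideanDomain.mod_lt p hne
    rwa [degree_eq_natDegree hne, natDegree_legendre] at this
  have hq : (p / legendre n).natDegree < n := by
    by_cases h0 : p / legendre n = 0
    · rw [h0, natDegree_zero]; omega
    · have h1 : legendre n * (p / legendre n) = p - p % legendre n := by
        rw [eq_sub_iff_add_eq]; exact hdiv
      have h2 := natDegree_mul hne h0
      rw [h1, natDegree_legendre] at h2
      have h3 := natDegree_sub_le p (p % legendre n)
      have h4 : (p % legendre n).natDegree ≤ n :=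
        natDegree_le_iff_degree_le.2 hmod.le
      have h5 := le_max_iff.1 (h2 ▸ h3)
      omega
  have hev : ∀ x, p.eval x = (legendre n).eval x * (p / legendre n).eval x +
      (p % legendre n).eval x := by
    intro x; conv_lhs => rw [← hdiv]
    simp
  simp only [hev]
  rw [intervalIntegral.integral_add
    ((by fun_prop : Continuous fun x => (legendre n).eval x * (p / legendre n).eval x
      ).intervalIntegrable _ _)
    ((Polynomial.continuous _).intervalIntegrable _ _), integral_legendre_mul_eq_zero hq, zero_add,
    integral_eq_sum_gaussWeight_of_degree_lt hmod]
  refine Finset.sum_congr rfl fun a ha => ?_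
  rw [gaussNodes, Multiset.mem_toFinset, mem_roots hne] at ha
  rw [IsRoot.def.1 ha, zero_mul, zero_add]

open Polynomial in
-- Exactness applies to the square of the Lagrange basis polynomial, whose degree is 2n - 2, and
-- identifies its integral with the weight.
lemma gaussWeight_nonneg {n : ℕ} {a : ℝ} (ha : a ∈ gaussNodes n) : 0 ≤ gaussWeight n a := by
  have hn : 0 < n := by rw [← card_gaussNodes n]; exact Finset.card_pos.2 ⟨a, ha⟩
  set B := Lagrange.basis (gaussNodes n) id a with hB
  have hdeg : (B ^ 2).natDegree < 2 * n := by
    rw [natDegree_pow]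
    have : B.natDegree = n - 1 := by
      rw [hB, natDegree_eq_of_degree_eq_some (Lagrange.degree_basis Function.injective_id.injOn ha),
        card_gaussNodes]
    omega
  have h := integral_eq_sum_gaussWeight hdeg
  rw [Finset.sum_eq_single a] at h
  · have h1 : B.eval a = 1 := Lagrange.eval_basis_self (v := id) Function.injective_id.injOn ha
    rw [eval_pow, h1, one_pow, mul_one] at h
    rw [← h]
    refine intervalIntegral.integral_nonneg (by norm_num) fun x _ => ?_
    rw [eval_pow]; positivity
  · intro b hb hba
    have : B.eval b = 0 := Lagrange.eval_basis_of_ne (v := id) hba.symm hb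
    rw [eval_pow, this]; simp
  · exact fun h => absurd ha h

lemma sum_gaussWeight {n : ℕ} (hn : 0 < n) : ∑ a ∈ gaussNodes n, gaussWeight n a = 2 := by
  have h := integral_eq_sum_gaussWeight (n := n) (p := 1) (by simpa using hn)
  simp only [Polynomial.eval_one, mul_one, intervalIntegral.integral_const] at h
  rw [← h]; norm_num

open Polynomial in
lemma gauss_eval {n : ℕ} {p : ℝ[X]} (hp : p.natDegree < 2 * n) :
    gauss n (fun x => p.eval x) = ∫ x in (0 : ℝ)..1, p.eval x := by
  have hd : (p.comp (C (1 / 2) * X + C (1 / 2))).natDegree < 2 * n := by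
    rw [natDegree_comp, natDegree_linear (by norm_num), mul_one]; exact hp
  have h := integral_eq_sum_gaussWeight hd
  have h2 := intervalIntegral.integral_comp_mul_add (a := (-1 : ℝ)) (b := 1)
    (fun x => p.eval x) (c := 1 / 2) (by norm_num) (1 / 2)
  simp only [eval_comp, eval_add, eval_mul, eval_C, eval_X] at h
  rw [h] at h2
  norm_num at h2
  rw [gauss]
  have h3 : ∀ a ∈ gaussNodes n, gaussWeight n a / 2 * p.eval ((1 + a) / 2) =
      1 / 2 * (gaussWeight n a * p.eval (1 / 2 * a + 1 / 2)) := by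
    intro a _
    rw [show (1 + a) / 2 = 1 / 2 * a + 1 / 2 by ring]; ring
  rw [Finset.sum_congr rfl h3, ← Finset.mul_sum, h2]
  ring

lemma node_mem_Icc {n : ℕ} {a : ℝ} (ha : a ∈ gaussNodes n) : (1 + a) / 2 ∈ Icc (0 : ℝ) 1 := by
  have := mem_Ioo_of_mem_gaussNodes ha
  constructor <;> linarith [this.1, this.2]

lemma abs_gauss_le {n : ℕ} (hn : 0 < n) {f : ℝ → ℝ} {e : ℝ} (h : ∀ x ∈ Icc (0 : ℝ) 1, |f x| ≤ e) :
    |gauss n f| ≤ e := by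
  calc |gauss n f| ≤ ∑ a ∈ gaussNodes n, gaussWeight n a / 2 * e := by
        refine (Finset.abs_sum_le_sum_abs _ _).trans (Finset.sum_le_sum fun a ha => ?_)
        have := gaussWeight_nonneg ha
        rw [abs_mul, abs_of_nonneg (by positivity)]
        gcongr
        exact h _ (node_mem_Icc ha)
    _ = e := by rw [← Finset.sum_mul, ← Finset.sum_div, sum_gaussWeight hn]; ring

lemma gauss_sub (n : ℕ) (f g : ℝ → ℝ) :
    gauss n (fun x => f x - g x) = gauss n f - gauss n g := by
  simp only [gauss, mul_sub, Finset.sum_sub_distrib]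

lemma gauss_const_mul (n : ℕ) (c : ℝ) (f : ℝ → ℝ) :
    gauss n (fun x => c * f x) = c * gauss n f := by
  simp only [gauss, Finset.mul_sum]
  exact Finset.sum_congr rfl fun a _ => by ring

lemma gauss_sum {ι : Type*} (n : ℕ) (s : Finset ι) (f : ι → ℝ → ℝ) :
    gauss n (fun x => ∑ i ∈ s, f i x) = ∑ i ∈ s, gauss n (f i) := by
  simp only [gauss, Finset.mul_sum]
  exact Finset.sum_comm

/-! ### Polynomials in the cube variables and the tensor rule -/

/-- `g` is a polynomial in four variables of degree at most `d` in each of them. -/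
def SepPoly (d : ℕ) (g : (Fin 4 → ℝ) → ℝ) : Prop :=
  ∃ P : MvPolynomial (Fin 4) ℝ, (∀ i, P.degreeOf i ≤ d) ∧ ∀ x, g x = MvPolynomial.eval x P

section SepPoly

variable {d e : ℕ} {f g : (Fin 4 → ℝ) → ℝ}

lemma SepPoly.mono (hf : SepPoly d f) (h : d ≤ e) : SepPoly e f := by
  obtain ⟨P, hP, hf⟩ := hf
  exact ⟨P, fun i => (hP i).trans h, hf⟩

lemma sepPoly_const (c : ℝ) : SepPoly 0 fun _ => c :=
  ⟨MvPolynomial.C c, fun i => by simp [MvPolynomial.degreeOf_C], fun x => by simp⟩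

lemma sepPoly_coord (i : Fin 4) : SepPoly 1 fun x => x i :=
  ⟨MvPolynomial.X i, fun j => by rw [MvPolynomial.degreeOf_X]; split_ifs <;> simp,
    fun x => by simp⟩

lemma SepPoly.add (hf : SepPoly d f) (hg : SepPoly d g) : SepPoly d fun x => f x + g x := by
  obtain ⟨P, hP, hf⟩ := hf
  obtain ⟨Q, hQ, hg⟩ := hg
  exact ⟨P + Q, fun i => (MvPolynomial.degreeOf_add_le i P Q).trans (max_le (hP i) (hQ i)),
    fun x => by simp [hf, hg]⟩

lemma SepPoly.mul (hf : SepPoly d f) (hg : SepPoly e g) : SepPoly (d + e) fun x => f x * g x := by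
  obtain ⟨P, hP, hf⟩ := hf
  obtain ⟨Q, hQ, hg⟩ := hg
  exact ⟨P * Q, fun i => (MvPolynomial.degreeOf_mul_le i P Q).trans (add_le_add (hP i) (hQ i)),
    fun x => by simp [hf, hg]⟩

lemma SepPoly.const_mul (c : ℝ) (hf : SepPoly d f) : SepPoly d fun x => c * f x := by
  simpa using (sepPoly_const c).mul hf

lemma SepPoly.pow (hf : SepPoly d f) (n : ℕ) : SepPoly (n * d) fun x => f x ^ n := by
  induction n with
  | zero => simpa using sepPoly_const 1
  | succ n ih =>
    simp only [pow_succ]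
    rw [Nat.succ_mul]
    exact ih.mul hf

lemma SepPoly.sum {ι : Type*} (s : Finset ι) {F : ι → (Fin 4 → ℝ) → ℝ}
    (h : ∀ i ∈ s, SepPoly d (F i)) : SepPoly d fun x => ∑ i ∈ s, F i x := by
  classical
  induction s using Finset.induction_on with
  | empty => simpa using (sepPoly_const 0).mono (Nat.zero_le d)
  | insert a s ha ih =>
    simp only [Finset.sum_insert ha]
    exact (h a (Finset.mem_insert_self a s)).add
      (ih fun i hi => h i (Finset.mem_insert_of_mem hi))

lemma SepPoly.eval_polynomial (hf : SepPoly d f) {N : ℕ} (Q : Polynomial ℝ)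
    (hQ : Q.natDegree ≤ N) : SepPoly (N * d) fun x => Q.eval (f x) := by
  simp only [Polynomial.eval_eq_sum_range]
  refine SepPoly.sum _ fun i hi => ((hf.pow i).const_mul _).mono ?_
  have := Finset.mem_range.1 hi
  gcongr
  omega

/-- The total degree is the relevant one: a cube variable may occur in both components of `a`, as ξ₁
does in (ξ₁, ξ₁ ξ₂), so the exponents add. -/
lemma SepPoly.eval_mvPolynomial {a : (Fin 4 → ℝ) → Fin 2 → ℝ} (ha : ∀ i, SepPoly 1 fun x => a x i)
    {q : ℕ} (P : MvPolynomial (Fin 2) ℝ) (hP : P.totalDegree ≤ q) :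
    SepPoly q fun x => MvPolynomial.eval (a x) P := by
  simp only [MvPolynomial.eval_eq', Fin.prod_univ_two]
  refine SepPoly.sum _ fun m hm => (SepPoly.const_mul _ (((ha 0).pow _).mul ((ha 1).pow _))).mono ?_
  have := (MvPolynomial.le_totalDegree hm).trans hP
  rw [Finsupp.sum_fintype _ _ (fun _ => rfl), Fin.sum_univ_two] at this
  omega

end SepPoly

/-- The iterated integral over the unit cube. -/
noncomputable def cubeIntegral (g : ℝ → ℝ → ℝ → ℝ → ℝ) : ℝ :=
  ∫ x in (0 : ℝ)..1, ∫ y in (0 : ℝ)..1, ∫ u in (0 : ℝ)..1, ∫ v in (0 : ℝ)..1, g x y u v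

lemma gauss_mul_const (n : ℕ) (c : ℝ) (f : ℝ → ℝ) :
    gauss n (fun x => f x * c) = gauss n f * c := by
  simp only [mul_comm _ c, gauss_const_mul]

lemma gauss_pow {n k : ℕ} (hk : k < 2 * n) :
    gauss n (fun x => x ^ k) = ∫ x in (0 : ℝ)..1, x ^ k := by
  have := gauss_eval (n := n) (p := Polynomial.X ^ k) (by rwa [Polynomial.natDegree_X_pow])
  simpa only [Polynomial.eval_pow, Polynomial.eval_X] using this

lemma integral_sum_mul_pow {ι : Type*} (s : Finset ι) (c M : ι → ℝ) (k : ι → ℕ) :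
    ∫ x in (0 : ℝ)..1, ∑ i ∈ s, c i * (x ^ k i * M i) =
      ∑ i ∈ s, c i * ((∫ x in (0 : ℝ)..1, x ^ k i) * M i) := by
  rw [intervalIntegral.integral_finsetSum]
  · simp only [intervalIntegral.integral_const_mul, intervalIntegral.integral_mul_const]
  · intro i _
    exact Continuous.intervalIntegrable (by fun_prop) _ _

lemma gauss_sum_mul_pow {ι : Type*} (n : ℕ) (s : Finset ι) (c M : ι → ℝ) (k : ι → ℕ) :
    gauss n (fun x => ∑ i ∈ s, c i * (x ^ k i * M i)) =
      ∑ i ∈ s, c i * (gauss n (fun x => x ^ k i) * M i) := by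
  simp only [gauss_sum, gauss_const_mul, gauss_mul_const]

lemma SepPoly.eval_eq_sum {d : ℕ} {g : (Fin 4 → ℝ) → ℝ} (hg : SepPoly d g) :
    ∃ (s : Finset (Fin 4 →₀ ℕ)) (c : (Fin 4 →₀ ℕ) → ℝ), (∀ m ∈ s, ∀ i, m i ≤ d) ∧
      ∀ x, g x = ∑ m ∈ s, c m * (x 0 ^ m 0 * (x 1 ^ m 1 * (x 2 ^ m 2 * x 3 ^ m 3))) := by
  obtain ⟨P, hP, hg⟩ := hg
  refine ⟨P.support, fun m => P.coeff m, fun m hm i =>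
    (MvPolynomial.degreeOf_le_iff.1 (hP i)) m hm, fun x => ?_⟩
  rw [hg, MvPolynomial.eval_eq']
  refine Finset.sum_congr rfl fun m _ => ?_
  rw [Fin.prod_univ_four]
  ring

/-- On a monomial the iterated rule and the iterated integral both factor into one-dimensional ones,
so exactness on single powers suffices. The identities `e4` to `e1` isolate the power belonging to
the variable being integrated. -/
lemma SepPoly.tensorGauss_eq {d n : ℕ} {g : (Fin 4 → ℝ) → ℝ} (hg : SepPoly d g) (hd : d < 2 * n) :
    tensorGauss n (fun x y u v => g ![x, y, u, v]) =
      cubeIntegral (fun x y u v => g ![x, y, u, v]) := by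
  obtain ⟨s, c, hs, hg⟩ := hg.eval_eq_sum
  have e4 : ∀ x y u v : ℝ, g ![x, y, u, v] =
      ∑ m ∈ s, c m * x ^ m 0 * y ^ m 1 * u ^ m 2 * (v ^ m 3 * 1) := by
    intro x y u v
    rw [hg]
    refine Finset.sum_congr rfl fun m _ => ?_
    simp only [Matrix.cons_val]
    ring
  have e3 : ∀ (x y : ℝ) (J : (Fin 4 →₀ ℕ) → ℝ) (u : ℝ),
      ∑ m ∈ s, c m * x ^ m 0 * y ^ m 1 * u ^ m 2 * J m =
        ∑ m ∈ s, c m * x ^ m 0 * y ^ m 1 * (u ^ m 2 * J m) := fun x y J u =>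
    Finset.sum_congr rfl fun m _ => by ring
  have e2 : ∀ (x : ℝ) (J : (Fin 4 →₀ ℕ) → ℝ) (u : ℝ),
      ∑ m ∈ s, c m * x ^ m 0 * u ^ m 1 * J m =
        ∑ m ∈ s, c m * x ^ m 0 * (u ^ m 1 * J m) := fun x J u =>
    Finset.sum_congr rfl fun m _ => by ring
  have e1 : ∀ (J : (Fin 4 →₀ ℕ) → ℝ) (u : ℝ),
      ∑ m ∈ s, c m * u ^ m 0 * J m = ∑ m ∈ s, c m * (u ^ m 0 * J m) := fun J u =>
    Finset.sum_congr rfl fun m _ => by ring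
  simp only [tensorGauss, cubeIntegral, e4]
  simp only [gauss_sum_mul_pow, integral_sum_mul_pow]
  simp only [e3, gauss_sum_mul_pow, integral_sum_mul_pow]
  simp only [e2, gauss_sum_mul_pow, integral_sum_mul_pow]
  simp only [e1, gauss_sum_mul_pow, integral_sum_mul_pow]
  refine Finset.sum_congr rfl fun m hm => ?_
  have h : ∀ i, m i < 2 * n := fun i => (hs m hm i).trans_lt hd
  rw [gauss_pow (h 0), gauss_pow (h 1), gauss_pow (h 2), gauss_pow (h 3)]

lemma abs_tensorGauss_sub_le {n : ℕ} (hn : 0 < n) {f g : ℝ → ℝ → ℝ → ℝ → ℝ} {ε : ℝ}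
    (h : ∀ x ∈ Icc (0 : ℝ) 1, ∀ y ∈ Icc (0 : ℝ) 1, ∀ u ∈ Icc (0 : ℝ) 1, ∀ v ∈ Icc (0 : ℝ) 1,
      |f x y u v - g x y u v| ≤ ε) : |tensorGauss n f - tensorGauss n g| ≤ ε := by
  simp only [tensorGauss, ← gauss_sub]
  exact abs_gauss_le hn fun x hx => abs_gauss_le hn fun y hy => abs_gauss_le hn fun u hu =>
    abs_gauss_le hn fun v hv => h x hx y hy u hu v hv

lemma abs_integral_sub_integral_le {f g : ℝ → ℝ} (hf : Continuous f) (hg : Continuous g) {ε : ℝ}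
    (h : ∀ x ∈ Icc (0 : ℝ) 1, |f x - g x| ≤ ε) :
    |(∫ x in (0 : ℝ)..1, f x) - ∫ x in (0 : ℝ)..1, g x| ≤ ε := by
  rw [← intervalIntegral.integral_sub (hf.intervalIntegrable _ _) (hg.intervalIntegrable _ _)]
  have := intervalIntegral.norm_integral_le_of_norm_le_const (a := (0 : ℝ)) (b := 1)
    (f := fun x => f x - g x) (C := ε) (fun x hx => by
      rw [uIoc_of_le zero_le_one] at hx
      exact h x ⟨hx.1.le, hx.2⟩)
  simpa using this

/-- Continuity of a function of four real variables. -/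
def Continuous4 (g : ℝ → ℝ → ℝ → ℝ → ℝ) : Prop :=
  Continuous fun p : ((ℝ × ℝ) × ℝ) × ℝ => g p.1.1.1 p.1.1.2 p.1.2 p.2

lemma Continuous4.integral₁ {g : ℝ → ℝ → ℝ → ℝ → ℝ} (hg : Continuous4 g) :
    Continuous fun p : (ℝ × ℝ) × ℝ => ∫ v in (0 : ℝ)..1, g p.1.1 p.1.2 p.2 v :=
  intervalIntegral.continuous_parametric_intervalIntegral_of_continuous'
    (f := fun (p : (ℝ × ℝ) × ℝ) v => g p.1.1 p.1.2 p.2 v) hg 0 1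

lemma Continuous4.integral₂ {g : ℝ → ℝ → ℝ → ℝ → ℝ} (hg : Continuous4 g) :
    Continuous fun p : ℝ × ℝ => ∫ u in (0 : ℝ)..1, ∫ v in (0 : ℝ)..1, g p.1 p.2 u v :=
  intervalIntegral.continuous_parametric_intervalIntegral_of_continuous'
    (f := fun (p : ℝ × ℝ) u => ∫ v in (0 : ℝ)..1, g p.1 p.2 u v) hg.integral₁ 0 1

lemma Continuous4.integral₃ {g : ℝ → ℝ → ℝ → ℝ → ℝ} (hg : Continuous4 g) :
    Continuous fun x : ℝ =>
      ∫ y in (0 : ℝ)..1, ∫ u in (0 : ℝ)..1, ∫ v in (0 : ℝ)..1, g x y u v :=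
  intervalIntegral.continuous_parametric_intervalIntegral_of_continuous'
    (f := fun (x : ℝ) y => ∫ u in (0 : ℝ)..1, ∫ v in (0 : ℝ)..1, g x y u v) hg.integral₂ 0 1

lemma abs_cubeIntegral_sub_le {f g : ℝ → ℝ → ℝ → ℝ → ℝ} (hf : Continuous4 f) (hg : Continuous4 g)
    {ε : ℝ} (h : ∀ x ∈ Icc (0 : ℝ) 1, ∀ y ∈ Icc (0 : ℝ) 1, ∀ u ∈ Icc (0 : ℝ) 1,
      ∀ v ∈ Icc (0 : ℝ) 1, |f x y u v - g x y u v| ≤ ε) :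
    |cubeIntegral f - cubeIntegral g| ≤ ε := by
  refine abs_integral_sub_integral_le hf.integral₃ hg.integral₃ fun x hx => ?_
  refine abs_integral_sub_integral_le (hf.integral₂.comp (by fun_prop : Continuous fun y => (x, y)))
    (hg.integral₂.comp (by fun_prop : Continuous fun y => (x, y))) fun y hy => ?_
  refine abs_integral_sub_integral_le
    (hf.integral₁.comp (by fun_prop : Continuous fun u => ((x, y), u)))
    (hg.integral₁.comp (by fun_prop : Continuous fun u => ((x, y), u))) fun u hu => ?_
  exact abs_integral_sub_integral_le
    (Continuous.comp hf (by fun_prop : Continuous fun v => (((x, y), u), v)))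
    (Continuous.comp hg (by fun_prop : Continuous fun v => (((x, y), u), v)))
    fun v hv => h x hx y hy u hu v hv

lemma cubeIntegral_congr {f g : ℝ → ℝ → ℝ → ℝ → ℝ}
    (h : ∀ x ∈ Icc (0 : ℝ) 1, ∀ y ∈ Icc (0 : ℝ) 1, ∀ u ∈ Icc (0 : ℝ) 1, ∀ v ∈ Icc (0 : ℝ) 1,
      f x y u v = g x y u v) : cubeIntegral f = cubeIntegral g := by
  have key : ∀ {F G : ℝ → ℝ}, (∀ x ∈ Icc (0 : ℝ) 1, F x = G x) →
      ∫ x in (0 : ℝ)..1, F x = ∫ x in (0 : ℝ)..1, G x := fun hFG =>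
    intervalIntegral.integral_congr fun x hx => hFG x (by rwa [uIcc_of_le zero_le_one] at hx)
  exact key fun x hx => key fun y hy => key fun u hu => key fun v hv => h x hx y hy u hu v hv

lemma SepPoly.continuous4 {d : ℕ} {g : (Fin 4 → ℝ) → ℝ} (hg : SepPoly d g) :
    Continuous4 fun x y u v => g ![x, y, u, v] := by
  obtain ⟨P, -, hg⟩ := hg
  simp only [Continuous4, hg]
  refine (MvPolynomial.continuous_eval P).comp ?_
  refine continuous_pi fun i => ?_
  fin_cases i <;> simp <;> fun_prop

/-- The quadrature error is at most twice the error of approximation by polynomials of degree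
less than `2 * n` in each variable. -/
lemma abs_cubeIntegral_sub_tensorGauss_le {d n : ℕ} (hd : d < 2 * n) {f f' : ℝ → ℝ → ℝ → ℝ → ℝ}
    (hf' : Continuous4 f')
    (hff' : ∀ x ∈ Icc (0 : ℝ) 1, ∀ y ∈ Icc (0 : ℝ) 1, ∀ u ∈ Icc (0 : ℝ) 1,
      ∀ v ∈ Icc (0 : ℝ) 1, f x y u v = f' x y u v)
    {g : (Fin 4 → ℝ) → ℝ} (hg : SepPoly d g) {ε : ℝ}
    (h : ∀ x ∈ Icc (0 : ℝ) 1, ∀ y ∈ Icc (0 : ℝ) 1, ∀ u ∈ Icc (0 : ℝ) 1,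
      ∀ v ∈ Icc (0 : ℝ) 1, |f x y u v - g ![x, y, u, v]| ≤ ε) :
    |cubeIntegral f - tensorGauss n f| ≤ 2 * ε := by
  -- Both functionals agree on `g`, and each moves by at most `ε` between `f` and `g`. Only values
  -- on the cube enter, so the continuous `f'` may stand in for `f` under the integral.
  have h1 := abs_cubeIntegral_sub_le (ε := ε) hf' hg.continuous4 (fun x hx y hy u hu v hv => by
    rw [← hff' x hx y hy u hu v hv]; exact h x hx y hy u hu v hv)
  rw [← cubeIntegral_congr hff', ← hg.tensorGauss_eq hd] at h1
  have h2 := abs_tensorGauss_sub_le (n := n) (by omega) (f := f)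
    (g := fun x y u v => g ![x, y, u, v]) h
  rw [abs_le] at *
  constructor <;> linarith [h1.1, h1.2, h2.1, h2.2]

/-! ### Surface integrals as integrals over the cube -/

/-- The reference triangle. -/
def refTriangle : Set (Fin 2 → ℝ) := {s | 0 ≤ s 1 ∧ s 1 ≤ s 0 ∧ s 0 ≤ 1}

lemma isClosed_refTriangle : IsClosed refTriangle := by
  have h1 : IsClosed {s : Fin 2 → ℝ | 0 ≤ s 1} := isClosed_le (by fun_prop) (by fun_prop)
  have h2 : IsClosed {s : Fin 2 → ℝ | s 1 ≤ s 0} := isClosed_le (by fun_prop) (by fun_prop)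
  have h3 : IsClosed {s : Fin 2 → ℝ | s 0 ≤ 1} := isClosed_le (by fun_prop) (by fun_prop)
  exact h1.inter (h2.inter h3)

lemma duffy_mem_refTriangle {x y : ℝ} (hx : x ∈ Icc (0 : ℝ) 1) (hy : y ∈ Icc (0 : ℝ) 1) :
    ![x, x * y] ∈ refTriangle := by
  refine ⟨?_, ?_, ?_⟩
  · simpa using mul_nonneg hx.1 hy.1
  · simpa using mul_le_of_le_one_right hx.1 hy.2
  · simpa using hx.2

/-- The barycentric coordinates of `chart τ s` are 1 - s₀, s₀ - s₁ and s₁. -/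
lemma image_chart_refTriangle (τ : Affine.Triangle ℝ E3) :
    chart τ '' refTriangle = τ.closedInterior := by
  ext p
  constructor
  · rintro ⟨s, ⟨h1, h2, h3⟩, rfl⟩
    have hw : ∑ i, (![1 - s 0, s 0 - s 1, s 1] : Fin 3 → ℝ) i = 1 := by
      simp [Fin.sum_univ_three]
    have : chart τ s = Finset.univ.affineCombination ℝ τ.points ![1 - s 0, s 0 - s 1, s 1] := by
      rw [Finset.affineCombination_eq_linear_combination _ _ _ hw]
      simp only [chart, Fin.sum_univ_three, Matrix.cons_val]
      module
    rw [this, Affine.Simplex.affineCombination_mem_closedInterior_iff hw]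
    intro i
    fin_cases i <;> simp <;> constructor <;> linarith
  · rintro ⟨w, hw, hI, rfl⟩
    rw [Fin.sum_univ_three] at hw
    refine ⟨![w 1 + w 2, w 2], ⟨?_, ?_, ?_⟩, ?_⟩
    · simpa using (hI 2).1
    · simpa using (hI 1).1
    · have := (hI 0).1
      simp only [Matrix.cons_val_zero]
      linarith
    · rw [Finset.affineCombination_eq_linear_combination _ _ _
        (by rw [Fin.sum_univ_three]; exact hw)]
      have : w 0 = 1 - w 1 - w 2 := by linarith
      rw [chart, Fin.sum_univ_three, this]
      simp only [Matrix.cons_val]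
      module

lemma chart_mem_closedInterior (τ : Affine.Triangle ℝ E3) {s : Fin 2 → ℝ} (hs : s ∈ refTriangle) :
    chart τ s ∈ τ.closedInterior := by
  rw [← image_chart_refTriangle]; exact mem_image_of_mem _ hs

lemma continuous_chart (τ : Affine.Triangle ℝ E3) : Continuous (chart τ) := by
  unfold chart; fun_prop

lemma edges_independent (τ : Affine.Triangle ℝ E3) {a b : ℝ}
    (h : a • (τ.points 1 - τ.points 0) + b • (τ.points 2 - τ.points 1) = 0) : a = 0 ∧ b = 0 := by
  have hw := τ.independent.eq_zero_of_sum_eq_zero (s := Finset.univ) (w := ![-a, a - b, b])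
    (by simp only [Fin.sum_univ_three, Matrix.cons_val]; ring) (by
      rw [← h]
      simp only [Fin.sum_univ_three, Matrix.cons_val]
      module)
  have h0 := hw 0 (Finset.mem_univ _)
  have h2 := hw 2 (Finset.mem_univ _)
  simp at h0 h2
  exact ⟨h0, h2⟩

lemma gram_nonneg (τ : Affine.Triangle ℝ E3) : 0 ≤ gram τ := Real.sqrt_nonneg _

/-- QR decomposition of the edge vectors of a triangle. -/
lemma exists_orthonormal_edges (τ : Affine.Triangle ℝ E3) :
    ∃ (f g : E3) (a b c : ℝ), ‖f‖ = 1 ∧ ‖g‖ = 1 ∧ inner ℝ f g = 0 ∧ 0 < a ∧ 0 < c ∧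
      τ.points 1 - τ.points 0 = a • f ∧ τ.points 2 - τ.points 1 = b • f + c • g ∧
      gram τ = a * c := by
  set u := τ.points 1 - τ.points 0 with hu
  set w := τ.points 2 - τ.points 1 with hw
  have hu0 : u ≠ 0 := fun h => by
    have := (edges_independent τ (a := 1) (b := 0) (by rw [← hu, h]; simp)).1
    norm_num at this
  have hun : 0 < ‖u‖ := norm_pos_iff.2 hu0
  set v := w - (inner ℝ u w / ‖u‖ ^ 2) • u with hv
  have hv0 : v ≠ 0 := fun h => by
    have := (edges_independent τ (a := -(inner ℝ u w / ‖u‖ ^ 2)) (b := 1) (by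
      rw [← hu, ← hw, ← h, hv]; module)).2
    norm_num at this
  have hvn : 0 < ‖v‖ := norm_pos_iff.2 hv0
  have huv : inner ℝ u v = 0 := by
    rw [hv, inner_sub_right, inner_smul_right, real_inner_self_eq_norm_sq]
    field_simp
    ring
  refine ⟨‖u‖⁻¹ • u, ‖v‖⁻¹ • v, ‖u‖, inner ℝ u w / ‖u‖, ‖v‖, ?_, ?_, ?_, hun, hvn, ?_, ?_, ?_⟩
  · rw [norm_smul, norm_inv, norm_norm, inv_mul_cancel₀ hun.ne']
  · rw [norm_smul, norm_inv, norm_norm, inv_mul_cancel₀ hvn.ne']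
  · rw [inner_smul_left, inner_smul_right, huv]; simp
  · rw [smul_smul, mul_inv_cancel₀ hun.ne', one_smul]
  · rw [smul_smul, smul_smul, mul_inv_cancel₀ hvn.ne', one_smul, hv]
    have : inner ℝ u w / ‖u‖ * ‖u‖⁻¹ = inner ℝ u w / ‖u‖ ^ 2 := by
      field_simp
    rw [this]; module
  · have hwn : ‖w‖ ^ 2 = (inner ℝ u w / ‖u‖) ^ 2 + ‖v‖ ^ 2 := by
      have e : w = (inner ℝ u w / ‖u‖ ^ 2) • u + v := by rw [hv]; module
      have h0 : inner ℝ ((inner ℝ u w / ‖u‖ ^ 2) • u) v = 0 := by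
        rw [inner_smul_left, huv, mul_zero]
      conv_lhs => rw [e]
      rw [norm_add_sq_real, h0, norm_smul, Real.norm_eq_abs, mul_pow, sq_abs]
      field_simp
      ring
    rw [gram, ← hu, ← hw, hwn]
    have : ‖u‖ ^ 2 * ((inner ℝ u w / ‖u‖) ^ 2 + ‖v‖ ^ 2) - inner ℝ u w ^ 2 = (‖u‖ * ‖v‖) ^ 2 := by
      field_simp
      ring
    rw [this, Real.sqrt_sq (by positivity)]

lemma isometry_orthonormal_pair {f g : E3} (hf : ‖f‖ = 1) (hg : ‖g‖ = 1) (hfg : inner ℝ f g = 0)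
    (A : E3) : Isometry fun s : EuclideanSpace ℝ (Fin 2) => A + s 0 • f + s 1 • g := by
  refine Isometry.of_dist_eq fun s t => ?_
  have e : (A + s 0 • f + s 1 • g) - (A + t 0 • f + t 1 • g) =
      (s 0 - t 0) • f + (s 1 - t 1) • g := by module
  rw [dist_eq_norm, e, EuclideanSpace.dist_eq, Fin.sum_univ_two,
    ← Real.sqrt_sq (norm_nonneg ((s 0 - t 0) • f + (s 1 - t 1) • g))]
  congr 1
  rw [norm_add_sq_real, inner_smul_left, inner_smul_right, hfg, norm_smul, norm_smul, hf, hg,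
    Real.dist_eq, Real.dist_eq]
  simp

/-- By Gram–Schmidt on the edges, the chart is an upper triangular linear map of the plane with
determinant `gram τ`, followed by an isometry into space. The isometry carries Lebesgue measure to
Hausdorff measure, and the linear map contributes its determinant. -/
lemma setIntegral_closedInterior (τ : Affine.Triangle ℝ E3) (F : E3 → ℝ) :
    ∫ x in τ.closedInterior, F x ∂μHE[2] = gram τ * ∫ s in refTriangle, F (chart τ s) := by
  obtain ⟨f, g, a, b, c, hf, hg, hfg, ha, hc, hu, hw, hgram⟩ := exists_orthonormal_edges τ
  set I : EuclideanSpace ℝ (Fin 2) → E3 := fun s => τ.points 0 + s 0 • f + s 1 • g with hI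
  have hIi : Isometry I := isometry_orthonormal_pair hf hg hfg _
  have hIm : MeasurableEmbedding I := hIi.isClosedEmbedding.measurableEmbedding
  set J : (Fin 2 → ℝ) → E3 := fun s => I (WithLp.toLp 2 s) with hJ
  have hJm : MeasurableEmbedding J :=
    hIm.comp (MeasurableEquiv.toLp 2 (Fin 2 → ℝ)).measurableEmbedding
  have hmap : MeasureTheory.Measure.map J MeasureTheory.volume =
      (μHE[2] : MeasureTheory.Measure E3).restrict (range I) := by
    have h1 := hIi.map_euclideanHausdorffMeasure (d := 2)
    rw [EuclideanSpace.euclideanHausdorffMeasure_eq_volume] at h1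
    rw [← h1, ← (PiLp.volume_preserving_toLp (Fin 2)).map_eq,
      MeasureTheory.Measure.map_map hIm.measurable (PiLp.volume_preserving_toLp (Fin 2)).measurable]
    rfl
  set M : (Fin 2 → ℝ) →L[ℝ] (Fin 2 → ℝ) :=
    LinearMap.toContinuousLinearMap (Matrix.toLin' !![a, b; 0, c]) with hM
  have hMs : ∀ s, M s = ![a * s 0 + b * s 1, c * s 1] := by
    intro s
    ext i
    rw [hM, LinearMap.coe_toContinuousLinearMap', Matrix.toLin'_apply]
    fin_cases i <;> simp [Matrix.mulVec, dotProduct, Fin.sum_univ_two]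
  have hMdet : |M.det| = gram τ := by
    rw [hM, LinearMap.det_toContinuousLinearMap, LinearMap.det_toLin', Matrix.det_fin_two_of, hgram,
      mul_zero, sub_zero, abs_of_pos (by positivity)]
  have hMinj : Function.Injective M := by
    intro s t h
    rw [hMs, hMs] at h
    have h0 := congrFun h 0
    have h1 := congrFun h 1
    simp only [Matrix.cons_val] at h0 h1
    have e1 : s 1 = t 1 := mul_left_cancel₀ hc.ne' h1
    rw [e1] at h0
    have e0 : s 0 = t 0 := mul_left_cancel₀ ha.ne' (by linarith)
    ext i
    fin_cases i
    · exact e0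
    · exact e1
  have hchart : ∀ s, J (M s) = chart τ s := by
    intro s
    rw [hJ, hI, chart, hu, hw, hMs]
    simp only [Matrix.cons_val]
    module
  have himg : τ.closedInterior = J '' (M '' refTriangle) := by
    rw [← image_chart_refTriangle, image_image]
    simp only [hchart]
  have hsub : τ.closedInterior ⊆ range I := by
    rw [himg]; rintro _ ⟨s, _, rfl⟩; exact mem_range_self _
  have h1 : ∫ x in τ.closedInterior, F x ∂μHE[2] =
      ∫ x in τ.closedInterior, F x ∂(MeasureTheory.Measure.map J MeasureTheory.volume) := by
    rw [hmap, MeasureTheory.Measure.restrict_restrict_of_subset hsub]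
  rw [h1, hJm.setIntegral_map, himg, preimage_image_eq _ hJm.injective,
    MeasureTheory.integral_image_eq_integral_abs_det_fderiv_smul MeasureTheory.volume
      isClosed_refTriangle.measurableSet (fun x _ => M.hasFDerivWithinAt) hMinj.injOn]
  simp only [hMdet, hchart, smul_eq_mul]
  rw [MeasureTheory.integral_const_mul]

/-- Fubini on the triangle, then the substitution y ↦ x y on the section [0, x], which produces the
factor x. -/
lemma setIntegral_refTriangle {H : (Fin 2 → ℝ) → ℝ} (hH : Continuous H) :
    ∫ s in refTriangle, H s = ∫ x in (0 : ℝ)..1, ∫ y in (0 : ℝ)..1, x * H ![x, x * y] := by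
  have hmp := (MeasureTheory.volume_preserving_finTwoArrow ℝ).symm
  set G : ℝ × ℝ → ℝ := fun p => H ![p.1, p.2] with hG
  have hGc : Continuous G := hH.comp (continuous_pi fun i => by fin_cases i <;> simp <;> fun_prop)
  set S : Set (ℝ × ℝ) := {p | 0 ≤ p.2 ∧ p.2 ≤ p.1 ∧ p.1 ≤ 1} with hS
  have hSc : IsClosed S := by
    have h1 : IsClosed {p : ℝ × ℝ | 0 ≤ p.2} := isClosed_le (by fun_prop) (by fun_prop)
    have h2 : IsClosed {p : ℝ × ℝ | p.2 ≤ p.1} := isClosed_le (by fun_prop) (by fun_prop)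
    have h3 : IsClosed {p : ℝ × ℝ | p.1 ≤ 1} := isClosed_le (by fun_prop) (by fun_prop)
    exact h1.inter (h2.inter h3)
  have hScomp : IsCompact S := by
    refine (isCompact_Icc (a := ((0 : ℝ), (0 : ℝ))) (b := (1, 1))).of_isClosed_subset hSc ?_
    rintro ⟨x, y⟩ ⟨h1, h2, h3⟩
    simp only at h1 h2 h3
    exact ⟨⟨by simp; linarith, by simpa using h1⟩, ⟨by simpa using h3, by simp; linarith⟩⟩
  have e1 : ∫ s in refTriangle, H s = ∫ p in S, G p := by
    rw [← hmp.setIntegral_preimage_emb (MeasurableEquiv.measurableEmbedding _)]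
    rfl
  have hint : MeasureTheory.Integrable (S.indicator G) :=
    (MeasureTheory.integrable_indicator_iff hSc.measurableSet).2
      (hGc.continuousOn.integrableOn_compact hScomp)
  rw [e1, ← MeasureTheory.integral_indicator hSc.measurableSet, MeasureTheory.Measure.volume_eq_prod,
    MeasureTheory.integral_prod _ hint]
  have e2 : ∀ x, ∫ y, S.indicator G (x, y) =
      (Icc (0 : ℝ) 1).indicator (fun x => ∫ y in (0 : ℝ)..1, x * H ![x, x * y]) x := by
    intro x
    by_cases hx : x ∈ Icc (0 : ℝ) 1
    · rw [indicator_of_mem hx]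
      have : (fun y => S.indicator G (x, y)) = (Icc 0 x).indicator fun y => H ![x, y] := by
        funext y
        by_cases hy : y ∈ Icc 0 x
        · rw [indicator_of_mem hy, indicator_of_mem (show (x, y) ∈ S from ⟨hy.1, hy.2, hx.2⟩)]
        · rw [indicator_of_notMem hy, indicator_of_notMem fun h => hy ⟨h.1, h.2.1⟩]
      rw [this, MeasureTheory.integral_indicator measurableSet_Icc,
        MeasureTheory.integral_Icc_eq_integral_Ioc, ← intervalIntegral.integral_of_le hx.1,
        intervalIntegral.integral_const_mul]
      have := intervalIntegral.mul_integral_comp_mul_left (a := 0) (b := 1)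
        (f := fun y => H ![x, y]) (c := x)
      rw [mul_zero, mul_one] at this
      exact this.symm
    · rw [indicator_of_notMem hx]
      have : (fun y => S.indicator G (x, y)) = fun _ => 0 := by
        funext y
        refine indicator_of_notMem (fun h => hx ⟨h.1.trans h.2.1, h.2.2⟩) _
      rw [this, MeasureTheory.integral_zero]
  simp only [e2]
  rw [MeasureTheory.integral_indicator measurableSet_Icc,
    MeasureTheory.integral_Icc_eq_integral_Ioc, ← intervalIntegral.integral_of_le zero_le_one]

lemma setIntegral_closedInterior_eq (τ : Affine.Triangle ℝ E3) {F : E3 → ℝ}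
    {H : (Fin 2 → ℝ) → ℝ} (hH : Continuous H) (hFH : ∀ s ∈ refTriangle, F (chart τ s) = H s) :
    ∫ x in τ.closedInterior, F x ∂μHE[2] =
      ∫ x in (0 : ℝ)..1, ∫ y in (0 : ℝ)..1, gram τ * x * H ![x, x * y] := by
  rw [setIntegral_closedInterior,
    MeasureTheory.setIntegral_congr_fun isClosed_refTriangle.measurableSet hFH,
    setIntegral_refTriangle hH]
  simp only [mul_assoc, ← intervalIntegral.integral_const_mul]

lemma continuous_duffy : Continuous fun p : ℝ × ℝ => (![p.1, p.1 * p.2] : Fin 2 → ℝ) :=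
  continuous_pi fun i => by fin_cases i <;> simp <;> fun_prop

/-- The surface integral as an integral over the unit cube. -/
lemma surfaceIntegral_eq_cubeIntegral (τ₁ τ₂ : Affine.Triangle ℝ E3) {k : E3 → E3 → ℝ}
    {K : (Fin 2 → ℝ) → (Fin 2 → ℝ) → ℝ} (hK : Continuous fun p : (Fin 2 → ℝ) × (Fin 2 → ℝ) => K p.1 p.2)
    (hkK : ∀ s ∈ refTriangle, ∀ s' ∈ refTriangle, k (chart τ₁ s) (chart τ₂ s') = K s s') :
    surfaceIntegral τ₁ τ₂ k = cubeIntegral (cubeIntegrand τ₁ τ₂ k) := by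
  have h1 : ∀ s ∈ refTriangle, ∫ y in τ₂.closedInterior, k (chart τ₁ s) y ∂μHE[2] =
      ∫ u in (0 : ℝ)..1, ∫ v in (0 : ℝ)..1, gram τ₂ * u * K s ![u, u * v] := fun s hs =>
    setIntegral_closedInterior_eq τ₂ (H := K s)
      (hK.comp (by fun_prop : Continuous fun s' => (s, s'))) (hkK s hs)
  have c1 : Continuous fun p : ((Fin 2 → ℝ) × ℝ) × ℝ =>
      gram τ₂ * p.1.2 * K p.1.1 ![p.1.2, p.1.2 * p.2] := by
    refine (by fun_prop : Continuous fun p : ((Fin 2 → ℝ) × ℝ) × ℝ => gram τ₂ * p.1.2).mul ?_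
    refine hK.comp (f := fun p : ((Fin 2 → ℝ) × ℝ) × ℝ => (p.1.1, ![p.1.2, p.1.2 * p.2])) ?_
    exact continuous_fst.fst.prodMk (continuous_duffy.comp
      (by fun_prop : Continuous fun p : ((Fin 2 → ℝ) × ℝ) × ℝ => (p.1.2, p.2)))
  have c2 : Continuous fun p : (Fin 2 → ℝ) × ℝ =>
      ∫ v in (0 : ℝ)..1, gram τ₂ * p.2 * K p.1 ![p.2, p.2 * v] :=
    intervalIntegral.continuous_parametric_intervalIntegral_of_continuous'
      (f := fun (p : (Fin 2 → ℝ) × ℝ) v => gram τ₂ * p.2 * K p.1 ![p.2, p.2 * v]) c1 0 1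
  have c3 : Continuous fun s : Fin 2 → ℝ =>
      ∫ u in (0 : ℝ)..1, ∫ v in (0 : ℝ)..1, gram τ₂ * u * K s ![u, u * v] :=
    intervalIntegral.continuous_parametric_intervalIntegral_of_continuous'
      (f := fun (s : Fin 2 → ℝ) u => ∫ v in (0 : ℝ)..1, gram τ₂ * u * K s ![u, u * v]) c2 0 1
  rw [surfaceIntegral, setIntegral_closedInterior_eq τ₁ c3 h1]
  simp only [← intervalIntegral.integral_const_mul]
  refine cubeIntegral_congr fun x hx y hy u hu v hv => ?_
  rw [cubeIntegrand, hkK _ (duffy_mem_refTriangle hx hy) _ (duffy_mem_refTriangle hu hv)]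
  ring

lemma gram_le (τ : Affine.Triangle ℝ E3) {h : ℝ} (hd : Metric.diam τ.closedInterior ≤ h) :
    gram τ ≤ h ^ 2 := by
  have hb : Bornology.IsBounded τ.closedInterior := τ.isCompact_closedInterior.isBounded
  have hh : ∀ i j, ‖τ.points i - τ.points j‖ ≤ h := fun i j => by
    rw [← dist_eq_norm]
    exact (Metric.dist_le_diam_of_mem hb (τ.point_mem_closedInterior i)
      (τ.point_mem_closedInterior j)).trans hd
  have h0 : 0 ≤ h := (norm_nonneg _).trans (hh 1 0)
  rw [gram, Real.sqrt_le_left (by positivity)]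
  have h1 : ‖τ.points 1 - τ.points 0‖ ^ 2 ≤ h ^ 2 := by gcongr; exact hh 1 0
  have h2 : ‖τ.points 2 - τ.points 1‖ ^ 2 ≤ h ^ 2 := by gcongr; exact hh 2 1
  nlinarith [sq_nonneg (inner ℝ (τ.points 1 - τ.points 0) (τ.points 2 - τ.points 1)),
    mul_le_mul h1 h2 (by positivity) (by positivity)]

/-! ### Smooth extensions of the basis functions in time -/

lemma _root_.Polynomial.contDiff_eval (Q : Polynomial ℝ) : ContDiff ℝ ∞ fun x => Q.eval x := by
  have := Q.contDiff_aeval (𝕜 := ℝ) ∞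
  simpa using this

lemma stepOn_eq (a b : ℝ) :
    stepOn a b = fun s => step (2 / (b - a) * s + (-(2 / (b - a) * a) - 1)) := by
  funext s
  rw [stepOn]
  congr 1
  ring

lemma contDiff_stepOn (a b : ℝ) : ContDiff ℝ ∞ (stepOn a b) := by
  rw [stepOn_eq]
  exact contDiff_step.comp (by fun_prop)

lemma stepOn_of_le {a b s : ℝ} (hab : a < b) (hs : s ≤ a) : stepOn a b s = 0 := by
  refine step_of_le_neg_one ?_
  have : (s - a) / (b - a) ≤ 0 := div_nonpos_of_nonpos_of_nonneg (by linarith) (by linarith)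
  linarith

lemma stepOn_of_ge {a b s : ℝ} (hab : a < b) (hs : b ≤ s) : stepOn a b s = 1 := by
  refine step_of_one_le ?_
  have : 1 ≤ (s - a) / (b - a) := (one_le_div (by linarith)).2 (by linarith)
  linarith

lemma logSq_stepOn (a b R : ℝ) : LogSq (ι := Unit) (Ioo (-R) R) fun _ => stepOn a b := by
  simp only [stepOn_eq]
  refine (logSq_step (|2 / (b - a)| * |R| + |-(2 / (b - a) * a) - 1| + 1)).comp_affine
    (c := fun _ => 2 / (b - a)) (d := fun _ => -(2 / (b - a) * a) - 1) isOpen_Ioo isOpen_Ioo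
    (fun _ => le_rfl) fun _ x hx => ?_
  refine abs_lt.1 ?_
  have h1 : |x| ≤ |R| := (abs_lt.2 hx).le.trans (le_abs_self R)
  calc _ ≤ |2 / (b - a) * x| + |-(2 / (b - a) * a) - 1| := abs_add_le _ _
    _ ≤ |2 / (b - a)| * |R| + |-(2 / (b - a) * a) - 1| := by rw [abs_mul]; gcongr
    _ < _ := by linarith

/-- As a difference of two smooth steps the bump is visibly smooth at its joint and its ends: up to
b the second step is 0, and from b on the first one is 1. -/
lemma bump_eq {a b c : ℝ} (hab : a < b) (hbc : b < c) (s : ℝ) :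
    bump a b c s = stepOn a b s - stepOn b c s := by
  rw [bump]
  split_ifs with h1 h2
  · rw [stepOn_of_le hbc h1.2, sub_zero]
  · rw [stepOn_of_ge hab h2.1]
  · rcases lt_or_ge s a with h | h
    · rw [stepOn_of_le hab h.le, stepOn_of_le hbc (by linarith), sub_zero]
    · have hb : b ≤ s := by by_contra hb; exact h1 ⟨h, by linarith⟩
      have hc : c ≤ s := by by_contra hc; exact h2 ⟨hb, by linarith⟩
      rw [stepOn_of_ge hab hb, stepOn_of_ge hbc hc, sub_self]

lemma IsTimeGrid.le {l : ℕ} {t : ℕ → ℝ} {T : ℝ} (hg : IsTimeGrid l t T) {i j : ℕ} (hij : i ≤ j)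
    (hj : j < l) : t i ≤ t j := by
  induction j, hij using Nat.le_induction with
  | base => exact le_rfl
  | succ j hij ih => exact (ih (by omega)).trans (hg.2.2.1 j hj).le

lemma IsTimeGrid.pos {l : ℕ} {t : ℕ → ℝ} {T : ℝ} (hg : IsTimeGrid l t T) : 0 < T := by
  have h1 := hg.2.2.1 0 (by have := hg.1; omega)
  have h2 := hg.le (i := 1) (j := l - 1) (by have := hg.1; omega) (by have := hg.1; omega)
  rw [hg.2.1] at h1
  rw [hg.2.2.2] at h2
  simp only [zero_add] at h1
  linarith

/-- A function with good derivative bounds on bounded sets that coincides with a function in time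
on `(0, T)`. -/
def IsLogSqExtension (T : ℝ) (b B : ℝ → ℝ) : Prop :=
  ContDiff ℝ ∞ B ∧ (∀ R, LogSq (ι := Unit) (Ioo (-R) R) fun _ => B) ∧
    (∀ s, 0 < s → s < T → b s = B s) ∧ ∀ s < 0, b s = 0

/-- Only the truncation at 0 for i = 1 and at T for i = l introduces jumps; the extension omits it
and continues by 1. At every other end it vanishes. The last two clauses record this because it
decides whether ψ continues smoothly past T. -/
lemma exists_partUnity_extension {l : ℕ} {t : ℕ → ℝ} {T : ℝ} (hg : IsTimeGrid l t T) {i : ℕ}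
    (hi1 : 1 ≤ i) (hil : i ≤ l) :
    ∃ B, IsLogSqExtension T (partUnity l t i) B ∧ (2 ≤ i → ∀ s ≤ 0, B s = 0) ∧
      (i ≠ l → ∀ s, T ≤ s → B s = 0) := by
  have hl := hg.1
  have ht0 := hg.2.1
  have htl := hg.2.2.2
  by_cases h1 : i = 1
  · have h01 : t 0 < t 1 := hg.2.2.1 0 (by omega)
    have h1T : t 1 ≤ T := htl ▸ hg.le (by omega) (by omega)
    refine ⟨fun s => 1 - stepOn (t 0) (t 1) s, ⟨contDiff_const.sub (contDiff_stepOn _ _),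
      fun R => ?_, ?_, ?_⟩, fun h => by omega, fun _ s hs => ?_⟩
    · refine ((logSq_const (c := fun _ => 1) (B := 1) (fun _ => by simp)).add
        ((logSq_const (c := fun _ => -1) (B := 1) (fun _ => by simp)).mul
          (logSq_stepOn (t 0) (t 1) R) isOpen_Ioo) isOpen_Ioo).congr isOpen_Ioo fun _ s _ => ?_
      simp only
      ring
    · intro s hs0 hsT
      rw [partUnity, if_pos h1]
      by_cases hs : s ≤ t 1
      · rw [indicator_of_mem (show s ∈ Icc (t 0) (t 1) from ⟨by linarith, hs⟩)]
      · simp only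
        rw [indicator_of_notMem fun h => hs h.2, stepOn_of_ge h01 (by linarith), sub_self]
    · intro s hs
      rw [partUnity, if_pos h1, indicator_of_notMem fun h => by linarith [h.1]]
    · simp only
      rw [stepOn_of_ge h01 (by linarith), sub_self]
  · by_cases h2 : i = l
    · have h01 : t (l - 2) < t (l - 1) := by
        have := hg.2.2.1 (l - 2) (by omega)
        rwa [show l - 2 + 1 = l - 1 by omega] at this
      have h0 : 0 ≤ t (l - 2) := ht0 ▸ hg.le (by omega) (by omega)
      refine ⟨stepOn (t (l - 2)) (t (l - 1)), ⟨contDiff_stepOn _ _,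
        fun R => logSq_stepOn _ _ R, ?_, ?_⟩, fun _ s hs => stepOn_of_le h01 (by linarith),
        fun h => absurd h2 h⟩
      · intro s hs0 hsT
        rw [partUnity, if_neg h1, if_pos h2]
        by_cases hs : t (l - 2) ≤ s
        · rw [indicator_of_mem (show s ∈ Icc (t (l - 2)) (t (l - 1)) from ⟨hs, by linarith⟩)]
        · rw [indicator_of_notMem fun h => hs h.1, stepOn_of_le h01 (by linarith)]
      · intro s hs
        rw [partUnity, if_neg h1, if_pos h2, indicator_of_notMem fun h => by linarith [h.1]]
    · have hab : t (i - 2) < t (i - 1) := by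
        have := hg.2.2.1 (i - 2) (by omega)
        rwa [show i - 2 + 1 = i - 1 by omega] at this
      have hbc : t (i - 1) < t i := by
        have := hg.2.2.1 (i - 1) (by omega)
        rwa [show i - 1 + 1 = i by omega] at this
      have h0 : 0 ≤ t (i - 2) := ht0 ▸ hg.le (by omega) (by omega)
      have hT : t i ≤ T := htl ▸ hg.le (by omega) (by omega)
      refine ⟨fun s => stepOn (t (i - 2)) (t (i - 1)) s - stepOn (t (i - 1)) (t i) s,
        ⟨(contDiff_stepOn _ _).sub (contDiff_stepOn _ _), fun R => ?_, ?_, ?_⟩,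
        fun _ s hs => ?_, fun _ s hs => ?_⟩
      · refine ((logSq_stepOn (t (i - 2)) (t (i - 1)) R).add
          ((logSq_const (c := fun _ => -1) (B := 1) (fun _ => by simp)).mul
            (logSq_stepOn (t (i - 1)) (t i) R) isOpen_Ioo) isOpen_Ioo).congr isOpen_Ioo
            fun _ s _ => ?_
        simp only
        ring
      · intro s _ _
        rw [partUnity, if_neg h1, if_neg h2, bump_eq hab hbc]
      · intro s hs
        rw [partUnity, if_neg h1, if_neg h2, bump_eq hab hbc, stepOn_of_le hab (by linarith),
          stepOn_of_le hbc (by linarith), sub_zero]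
      · simp only
        rw [stepOn_of_le hab (by linarith), stepOn_of_le hbc (by linarith), sub_zero]
      · simp only
        rw [stepOn_of_ge hab (by linarith), stepOn_of_ge hbc (by linarith), sub_self]

open Polynomial in
lemma exists_timeBasis_eq_partUnity_mul (l : ℕ) (t : ℕ → ℝ) (i m : ℕ) :
    ∃ Q : ℝ[X], ∀ s, timeBasis l t i m s = partUnity l t i s * Q.eval s := by
  have key : ∀ (a b : ℝ) (P : ℝ[X]), ∃ Q : ℝ[X], ∀ s, P.eval (2 * ((s - a) / b) - 1) = Q.eval s :=
    fun a b P => ⟨P.comp (C 2 * (C b⁻¹ * (X - C a)) - 1), fun s => by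
      rw [eval_comp]; congr 1; simp; ring⟩
  by_cases h1 : i = 1
  · refine ⟨C 8 * (C (t 1)⁻¹ * X) ^ 2 * (legendre (m - 2)).comp (C (2 / t 1) * X - 1), fun s => ?_⟩
    rw [timeBasis, if_pos h1, h1]
    simp only [eval_mul, eval_C, eval_pow, eval_X, eval_comp, eval_sub, eval_one]
    ring
  · by_cases h2 : i = l
    · obtain ⟨Q, hQ⟩ := key (t (l - 2)) (t (l - 1) - t (l - 2)) (legendre m)
      exact ⟨Q, fun s => by rw [timeBasis, if_neg h1, if_pos h2, hQ, h2]⟩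
    · obtain ⟨Q, hQ⟩ := key (t (i - 2)) (t i - t (i - 2)) (legendre m)
      exact ⟨Q, fun s => by rw [timeBasis, if_neg h1, if_neg h2, hQ]⟩

lemma exists_timeBasis_extension {l : ℕ} {t : ℕ → ℝ} {T : ℝ} (hg : IsTimeGrid l t T) {i : ℕ}
    (m : ℕ) (hi1 : 1 ≤ i) (hil : i ≤ l) :
    ∃ B, IsLogSqExtension T (timeBasis l t i m) B ∧ (2 ≤ i → ∀ s ≤ 0, B s = 0) ∧
      (i ≠ l → ∀ s, T ≤ s → B s = 0) := by
  obtain ⟨B, ⟨hB1, hB2, hB3, hB4⟩, hB5, hB6⟩ := exists_partUnity_extension hg hi1 hil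
  obtain ⟨Q, hQ⟩ := exists_timeBasis_eq_partUnity_mul l t i m
  refine ⟨fun s => B s * Q.eval s, ⟨hB1.mul Q.contDiff_eval,
    fun R => (hB2 R).mul (logSq_polynomial R Q) isOpen_Ioo,
    fun s h0 hT => by rw [hQ, hB3 s h0 hT], fun s hs => by rw [hQ, hB4 s hs, zero_mul]⟩,
    fun h s hs => by simp only [hB5 h s hs, zero_mul],
    fun h s hs => by simp only [hB6 h s hs, zero_mul]⟩

/-! ### The time convolution and its smooth extension -/

/-- The smooth extension of `psi`. -/
noncomputable def psiExt (T : ℝ) (B B' : ℝ → ℝ) (r : ℝ) : ℝ :=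
  (T - r) * ∫ v in (0 : ℝ)..1, deriv B ((T - r) * v) * B' (r + (T - r) * v)

lemma deriv_eq_zero_of_forall_lt {b : ℝ → ℝ} (hb : ∀ s < 0, b s = 0) {s : ℝ} (hs : s < 0) :
    deriv b s = 0 := by
  have : b =ᶠ[𝓝 s] fun _ => 0 := by
    filter_upwards [gt_mem_nhds hs] with y hy using hb y hy
  rw [this.deriv_eq, deriv_const]

lemma psi_eq_zero {T : ℝ} (hT : 0 < T) {b β : ℝ → ℝ} (hb : ∀ s < 0, b s = 0) {r : ℝ} (hr : T ≤ r) :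
    psi T b β r = 0 := by
  rw [psi, intervalIntegral.integral_of_le hT.le, MeasureTheory.integral_Ioc_eq_integral_Ioo]
  refine MeasureTheory.setIntegral_eq_zero_of_forall_eq_zero fun s hs => ?_
  rw [deriv_eq_zero_of_forall_lt hb (by linarith [hs.2]), zero_mul]

/-- The integrand of ψ vanishes for s < r, and for r < s < T both arguments lie in (0, T), where the
extensions may be used. The substitution s = r + (T - r) v then moves the dependence on r from the
limits into the integrand. -/
lemma psi_eq_psiExt {T : ℝ} {b β B B' : ℝ → ℝ} (hb : IsLogSqExtension T b B)
    (hβ : IsLogSqExtension T β B') {r : ℝ} (hr : 0 < r) (hrT : r ≤ T) :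
    psi T b β r = psiExt T B B' r := by
  have h1 : psi T b β r = ∫ s in Ioo r T, deriv b (s - r) * β s := by
    rw [psi, intervalIntegral.integral_of_le (hr.le.trans hrT)]
    refine MeasureTheory.setIntegral_eq_of_subset_of_ae_sdiff_eq_zero
      measurableSet_Ioc.nullMeasurableSet (fun s hs => ⟨hr.trans hs.1, hs.2.le⟩) ?_
    have e1 : ∀ᵐ s : ℝ, s ≠ r := MeasureTheory.Measure.ae_ne _ r
    have e2 : ∀ᵐ s : ℝ, s ≠ T := MeasureTheory.Measure.ae_ne _ T
    filter_upwards [e1, e2] with s hs1 hs2 hs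
    have : s < r := by
      by_contra hcon
      exact hs.2 ⟨lt_of_le_of_ne (not_lt.1 hcon) hs1.symm, lt_of_le_of_ne hs.1.2 hs2⟩
    rw [deriv_eq_zero_of_forall_lt hb.2.2.2 (by linarith), zero_mul]
  have h2 : ∫ s in Ioo r T, deriv b (s - r) * β s = ∫ s in r..T, deriv B (s - r) * B' s := by
    rw [intervalIntegral.integral_of_le hrT, MeasureTheory.integral_Ioc_eq_integral_Ioo]
    refine MeasureTheory.setIntegral_congr_fun measurableSet_Ioo fun s hs => ?_
    have hs1 : 0 < s - r := sub_pos.2 hs.1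
    have hs2 : s - r < T := by linarith [hs.2]
    have e : b =ᶠ[𝓝 (s - r)] B := by
      filter_upwards [lt_mem_nhds hs1, gt_mem_nhds hs2] with y h1 h2 using hb.2.2.1 y h1 h2
    rw [e.deriv_eq, hβ.2.2.1 s (hr.trans hs.1) hs.2]
  have h3 := intervalIntegral.mul_integral_comp_add_mul (a := 0) (b := 1)
    (f := fun s => deriv B (s - r) * B' s) (T - r) r
  rw [h1, h2, psiExt]
  simp only [add_sub_cancel_left, mul_zero, add_zero, mul_one, add_sub_cancel] at h3
  exact h3.symm

lemma psiExt_eq_zero_of_left {T : ℝ} {B B' : ℝ → ℝ} (hB : ∀ s ≤ 0, B s = 0) {r : ℝ} (hr : T ≤ r) :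
    psiExt T B B' r = 0 := by
  rcases hr.eq_or_lt with rfl | hr
  · rw [psiExt, sub_self, zero_mul]
  · rw [psiExt, intervalIntegral.integral_of_le zero_le_one,
      MeasureTheory.setIntegral_eq_zero_of_forall_eq_zero, mul_zero]
    intro v hv
    rw [deriv_eq_zero_of_forall_lt (fun s hs => hB s hs.le)
      (mul_neg_of_neg_of_pos (by linarith) hv.1), zero_mul]

/-- The argument r + (T - r) v is a convex combination of r and T, hence at least T. -/
lemma psiExt_eq_zero_of_right {T : ℝ} {B B' : ℝ → ℝ} (hB : ∀ s, T ≤ s → B' s = 0) {r : ℝ}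
    (hr : T ≤ r) : psiExt T B B' r = 0 := by
  rw [psiExt, intervalIntegral.integral_of_le zero_le_one,
    MeasureTheory.setIntegral_eq_zero_of_forall_eq_zero, mul_zero]
  intro v hv
  rw [hB _ (by nlinarith [hv.1, hv.2]), mul_zero]

lemma contDiff_psiExt_integrand (T : ℝ) {B B' : ℝ → ℝ} (hB : ContDiff ℝ ∞ B)
    (hB' : ContDiff ℝ ∞ B') : ContDiff ℝ ∞ fun p : ℝ × ℝ =>
      deriv B ((T - p.1) * p.2) * B' (p.1 + (T - p.1) * p.2) := by
  have hd : ContDiff ℝ ∞ (deriv B) := by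
    have := (contDiff_infty_iff_deriv.1 hB).2
    exact this
  exact (hd.comp (by fun_prop)).mul (hB'.comp (by fun_prop))

/-- For fixed v in [0, 1] the arguments (T - r) v and r + (T - r) v are affine in r with slopes of
modulus at most one and stay below R + T in modulus. The bounds are therefore uniform in v and
survive the integration. -/
lemma logSq_psiExt {T R : ℝ} (hT : 0 < T) (hR : 0 < R) {b β B B' : ℝ → ℝ}
    (hb : IsLogSqExtension T b B) (hβ : IsLogSqExtension T β B') :
    LogSq (ι := Unit) (Ioo (-R) R) fun _ => psiExt T B B' := by
  have hG := contDiff_psiExt_integrand T hb.1 hβ.1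
  have h1 : LogSq (ι := Icc (0 : ℝ) 1) (Ioo (-R) R) fun v r =>
      deriv B ((T - r) * v) := by
    refine ((((hb.2.1 (R + T)).deriv isOpen_Ioo).reindex fun _ : Icc (0 : ℝ) 1 => ()).comp_affine
      (c := fun v => -v) (d := fun v => T * v) (B := 1) (s := Ioo (-R) R) isOpen_Ioo isOpen_Ioo
      (fun v => ?_) fun v r hr => ?_).congr isOpen_Ioo fun v r _ => ?_
    · rw [abs_neg, abs_of_nonneg v.2.1]; exact v.2.2
    · have := v.2.1
      have := v.2.2
      have := hr.1
      have := hr.2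
      constructor <;> nlinarith
    · simp only
      congr 1
      ring
  have h2 : LogSq (ι := Icc (0 : ℝ) 1) (Ioo (-R) R) fun v r =>
      B' (r + (T - r) * v) := by
    refine (((hβ.2.1 (R + T)).reindex fun _ : Icc (0 : ℝ) 1 => ()).comp_affine
      (c := fun v => 1 - v) (d := fun v => T * v) (B := 1) (s := Ioo (-R) R) isOpen_Ioo isOpen_Ioo
      (fun v => ?_) fun v r hr => ?_).congr isOpen_Ioo fun v r _ => ?_
    · rw [abs_of_nonneg (by linarith [v.2.2])]; linarith [v.2.1]
    · have := v.2.1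
      have := v.2.2
      have := hr.1
      have := hr.2
      constructor <;> nlinarith
    · simp only
      congr 1
      ring
  have h3 := LogSq.intervalIntegral hG (h1.mul h2 isOpen_Ioo)
  have h4 := (logSq_polynomial (ι := Unit) R (Polynomial.C T - Polynomial.X)).mul h3 isOpen_Ioo
  refine h4.congr isOpen_Ioo fun _ r _ => ?_
  simp [psiExt]

/-! ### Passage to the squared distance -/

lemma abs_descPochhammer_eval_le {p : ℝ} (hp : |p| ≤ 1) (k : ℕ) :
    |(descPochhammer ℝ k).eval p| ≤ k.factorial := by
  induction k with
  | zero => simp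
  | succ k ih =>
    rw [descPochhammer_succ_right, Polynomial.eval_mul, abs_mul, Nat.factorial_succ, mul_comm]
    push_cast
    refine mul_le_mul ?_ ih (abs_nonneg _) (by positivity)
    rw [Polynomial.eval_sub, Polynomial.eval_X, Polynomial.eval_natCast]
    refine (abs_sub _ _).trans ?_
    rw [Nat.abs_cast]
    linarith

lemma rpow_le_add_rpow {c E y : ℝ} (hc : 0 < c) (hy : y ∈ Ioo c E) (p : ℝ) :
    y ^ p ≤ c ^ p + E ^ p := by
  have hy0 : 0 < y := hc.trans hy.1
  have hE : 0 < E := hy0.trans hy.2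
  rcases le_total 0 p with h | h
  · have := Real.rpow_le_rpow hy0.le hy.2.le h
    linarith [Real.rpow_nonneg hc.le p]
  · have := Real.rpow_le_rpow_of_nonpos hc hy.1.le h
    linarith [Real.rpow_nonneg hE.le p]

/-- The derivative is a falling factorial, at most k!, times y^p y^(-k); here y^(-k) ≤ c^(-k), and
y^p ≤ c^p + E^p whatever the sign of p. -/
lemma abs_iteratedDeriv_rpow_le {c E p : ℝ} (hc : 0 < c) (hE : 0 < E) (hp : |p| ≤ 1) :
    ∃ K : ℝ, 0 ≤ K ∧ ∀ k : ℕ, 1 ≤ k → ∀ y ∈ Ioo c E,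
      |iteratedDeriv k (fun y : ℝ => y ^ p) y| ≤ K ^ k * k.factorial := by
  have hY : 0 ≤ c ^ p + E ^ p := add_nonneg (Real.rpow_nonneg hc.le _) (Real.rpow_nonneg hE.le _)
  refine ⟨(c ^ p + E ^ p + 1) * c⁻¹, by positivity, fun k hk y hy => ?_⟩
  have hy0 : 0 < y := hc.trans hy.1
  rw [iteratedDeriv_eq_iterate, Real.iter_deriv_rpow_const, abs_mul, mul_comm,
    Real.rpow_sub hy0, Real.rpow_natCast, abs_of_pos (div_pos (Real.rpow_pos_of_pos hy0 _)
      (pow_pos hy0 k)), mul_pow, inv_pow]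
  refine mul_le_mul ?_ (abs_descPochhammer_eval_le hp k) (abs_nonneg _) (by positivity)
  rw [div_eq_mul_inv]
  have h1 : y ^ p ≤ (c ^ p + E ^ p + 1) ^ k := by
    refine (rpow_le_add_rpow hc hy p).trans ?_
    calc c ^ p + E ^ p ≤ (c ^ p + E ^ p + 1) ^ 1 := by linarith
      _ ≤ _ := pow_le_pow_right₀ (by linarith) hk
  have h2 : c ^ k ≤ y ^ k := by gcongr; exact hy.1.le
  gcongr

lemma contDiffOn_rpow {c E : ℝ} (hc : 0 < c) (p : ℝ) :
    ContDiffOn ℝ ∞ (fun y : ℝ => y ^ p) (Ioo c E) := fun _ hy =>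
  (Real.contDiffAt_rpow_const_of_ne (hc.trans hy.1).ne').contDiffWithinAt

lemma logSq_rpow {c E p : ℝ} (hc : 0 < c) (hE : 0 < E) (hp : |p| ≤ 1) :
    LogSq (ι := Unit) (Ioo c E) fun _ y => y ^ p := by
  obtain ⟨K, hK, hb⟩ := abs_iteratedDeriv_rpow_le hc hE hp
  refine (logSq_id (ι := Unit) (c ^ p + E ^ p + 1)).comp (φ := fun _ y => y ^ p) hK isOpen_Ioo
    isOpen_Ioo (fun _ => contDiffOn_rpow hc p) (fun _ y hy => ?_) fun _ => hb
  have := rpow_le_add_rpow hc hy p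
  have := Real.rpow_pos_of_pos (hc.trans hy.1) p
  constructor <;> linarith

/-- If `f` has good derivative bounds, then so has `y ↦ f (√y) / √y`. -/
lemma logSq_comp_sqrt_div_sqrt {f : ℝ → ℝ} {c R : ℝ} (hc : 0 < c) (hR : 0 < R)
    (hf : LogSq (ι := Unit) (Ioo (-R) R) fun _ => f) :
    LogSq (ι := Unit) (Ioo c (R ^ 2)) fun _ y => f (y ^ (1 / 2 : ℝ)) * y ^ (-1 / 2 : ℝ) := by
  obtain ⟨K, hK, hb⟩ := abs_iteratedDeriv_rpow_le (p := 1 / 2) hc (by positivity : 0 < R ^ 2)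
    (by rw [abs_of_pos] <;> norm_num)
  refine LogSq.mul ?_ (logSq_rpow hc (by positivity) (by rw [abs_le]; constructor <;> norm_num))
    isOpen_Ioo
  refine hf.comp (φ := fun _ y => y ^ (1 / 2 : ℝ)) hK isOpen_Ioo isOpen_Ioo
    (fun _ => contDiffOn_rpow hc _) (fun _ y hy => ?_) fun _ => hb
  have h0 : 0 < y := hc.trans hy.1
  simp only
  rw [← Real.sqrt_eq_rpow]
  refine ⟨by linarith [Real.sqrt_nonneg y], (Real.sqrt_lt' hR).2 hy.2⟩

/-! ### Polynomial approximation and rates -/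

/-- Functions with good derivative bounds are approximated by polynomials at a rate that beats
every power. -/
lemma LogSq.exists_polynomial_approx {s : Set ℝ} (hs : IsOpen s) (hsub : Icc (-1) 1 ⊆ s)
    {f : ℝ → ℝ} (hf : LogSq (ι := Unit) s fun _ => f) :
    ∃ C : ℝ, 0 < C ∧ ∀ᶠ N : ℕ in atTop, ∃ Q : Polynomial ℝ, Q.natDegree ≤ N ∧
      ∀ x ∈ Icc (-1 : ℝ) 1, |f x - Q.eval x| ≤
        C * Real.exp (-(5 / 6) * Real.log N ^ 2 + 4 * Real.log N) := by
  -- A constant a yields the rate 1/(4a). Any a strictly between 1/4 and 3/8 would beat 2/3; 3/10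
  -- gives 5/6.
  obtain ⟨C, hC, hb⟩ := hf.2 (3 / 10) (by norm_num)
  set S := ∑' j : ℤ, 1 / (j : ℝ) ^ 2 with hS
  have hS0 : 0 ≤ S := tsum_nonneg fun j => by positivity
  refine ⟨(S + 1) * C * Real.exp (3 / 10), by positivity, ?_⟩
  have hlog : Tendsto (fun N : ℕ => Real.log N) atTop atTop :=
    Real.tendsto_log_atTop.comp tendsto_natCast_atTop_atTop
  have hsmall : ∀ᶠ N : ℕ in atTop, ‖Real.log N‖ ≤ 1 / 4 * ‖(N : ℝ)‖ :=
    tendsto_natCast_atTop_atTop.eventually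
      (Real.isLittleO_log_id_atTop.bound (by norm_num : (0 : ℝ) < 1 / 4))
  filter_upwards [hlog.eventually_ge_atTop 2, hsmall, eventually_gt_atTop 0] with N hN2 hNs hN0
  set L := Real.log N with hL
  rw [Real.norm_eq_abs, Real.norm_eq_abs, abs_of_nonneg (by linarith), Nat.abs_cast] at hNs
  -- The minimiser of 3/10 k² - k L, rounded down. Since 3/10 k² - k L = -5/6 L² + 3/10 (5/3 L -
  -- k)², rounding costs at most exp(3/10); 2^k and N² together cost at most exp(4 L).
  set k := ⌊5 / 3 * L⌋₊ with hk
  have hk1 : (k : ℝ) ≤ 5 / 3 * L := Nat.floor_le (by linarith)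
  have hk2 : 5 / 3 * L < k + 1 := Nat.lt_floor_add_one _
  have hk3 : 2 ≤ k := Nat.le_floor (by push_cast; linarith)
  have hk4 : 2 * k ≤ N := by
    have : (2 * k : ℝ) ≤ N := by linarith
    exact_mod_cast this
  refine ⟨chebPartialSum f N, natDegree_chebPartialSum_le f N, fun x hx => ?_⟩
  refine (abs_sub_chebPartialSum_le hs hsub (hf.1 ()) hk3 hk4
    (fun x hx => hb () k x (hsub hx)) hx).trans ?_
  have hNe : (N : ℝ) = Real.exp L := (Real.exp_log (by exact_mod_cast hN0)).symm
  have h2k : (2 : ℝ) ^ k ≤ Real.exp (5 / 3 * L) := by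
    calc (2 : ℝ) ^ k ≤ Real.exp 1 ^ k := by
          gcongr
          linarith [Real.add_one_le_exp 1]
      _ = Real.exp k := by rw [← Real.exp_nat_mul, mul_one]
      _ ≤ _ := Real.exp_le_exp.2 hk1
  rw [hNe, ← Real.exp_nat_mul, ← Real.exp_nat_mul]
  calc S * (C * Real.exp (3 / 10 * (k : ℝ) ^ 2) * 2 ^ k * Real.exp ((2 : ℕ) * L) /
        Real.exp (k * L))
      ≤ (S + 1) * (C * Real.exp (3 / 10 * (k : ℝ) ^ 2) * Real.exp (5 / 3 * L) *
        Real.exp ((2 : ℕ) * L) / Real.exp (k * L)) := by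
        gcongr
        linarith
    _ = (S + 1) * C * Real.exp (3 / 10 * (k : ℝ) ^ 2 + 5 / 3 * L + (2 : ℕ) * L - k * L) := by
        rw [Real.exp_sub, Real.exp_add, Real.exp_add]; ring
    _ ≤ (S + 1) * C * Real.exp (3 / 10 + (-(5 / 6) * L ^ 2 + 4 * L)) := by
        gcongr
        push_cast
        have : (5 / 3 * L - k) ^ 2 ≤ 1 := by nlinarith
        nlinarith
    _ = _ := by rw [Real.exp_add]; ring

/-- Approximation of `f r / r` by polynomials in `r ^ 2`. -/
lemma exists_polynomial_sq_approx {f : ℝ → ℝ} (hf : ∀ R, 0 < R → LogSq (ι := Unit) (Ioo (-R) R) fun _ => f)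
    {D R : ℝ} (hD : 0 < D) (hDR : D < R) :
    ∃ C : ℝ, 0 < C ∧ ∀ᶠ N : ℕ in atTop, ∃ Q : Polynomial ℝ, Q.natDegree ≤ N ∧
      ∀ r ∈ Icc D R, |f r / r - Q.eval (r ^ 2)| ≤
        C * Real.exp (-(5 / 6) * Real.log N ^ 2 + 4 * Real.log N) := by
  set w := (R ^ 2 - D ^ 2) / 2 with hw
  set m := (R ^ 2 + D ^ 2) / 2 with hm
  have hw0 : 0 < w := by rw [hw]; nlinarith
  have h1 := logSq_comp_sqrt_div_sqrt (c := D ^ 2 / 2) (by positivity) (by linarith : 0 < R + D)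
    (hf (R + D) (by linarith))
  -- The open interval must exceed [-1, 1] while its image under x ↦ w x + m stays in (D²/2, (R +
  -- D)²). This δ widens the image [D², R²] by D²/2 on either side.
  set δ := D ^ 2 / (2 * w) with hδ
  have hδ0 : 0 < δ := by positivity
  have hwδ : w * δ = D ^ 2 / 2 := by rw [hδ]; field_simp
  have h2 := h1.comp_affine (s := Ioo (-1 - δ) (1 + δ)) (c := fun _ => w) (d := fun _ => m)
    isOpen_Ioo isOpen_Ioo (fun _ => le_rfl) (by
      intro _ x hx
      have a1 : w * (-1 - δ) < w * x := mul_lt_mul_of_pos_left hx.1 hw0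
      have a2 : w * x < w * (1 + δ) := mul_lt_mul_of_pos_left hx.2 hw0
      have a3 : w * (-1 - δ) = -w - D ^ 2 / 2 := by rw [← hwδ]; ring
      have a4 : w * (1 + δ) = w + D ^ 2 / 2 := by rw [← hwδ]; ring
      have a5 : m - w = D ^ 2 := by rw [hm, hw]; ring
      have a6 : m + w = R ^ 2 := by rw [hm, hw]; ring
      constructor
      · simp only; linarith
      · simp only; nlinarith)
  obtain ⟨C, hC, hev⟩ := h2.exists_polynomial_approx isOpen_Ioo
    (fun x hx => ⟨by linarith [hx.1], by linarith [hx.2]⟩)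
  refine ⟨C, hC, ?_⟩
  filter_upwards [hev] with N hN
  obtain ⟨Q, hQ, hQa⟩ := hN
  refine ⟨Q.comp (Polynomial.C w⁻¹ * Polynomial.X + Polynomial.C (-(m / w))), ?_, fun r hr => ?_⟩
  · rw [Polynomial.natDegree_comp, Polynomial.natDegree_linear (inv_ne_zero hw0.ne'), mul_one]
    exact hQ
  · have hr0 : 0 < r := hD.trans_le hr.1
    have hx : w * ((r ^ 2 - m) / w) + m = r ^ 2 := by field_simp; ring
    have hmem : (r ^ 2 - m) / w ∈ Icc (-1 : ℝ) 1 := by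
      have b1 : D ^ 2 ≤ r ^ 2 := by have := hr.1; gcongr
      have b2 : r ^ 2 ≤ R ^ 2 := by have := hr.2; gcongr
      constructor
      · rw [le_div_iff₀ hw0]; linarith
      · rw [div_le_iff₀ hw0]; linarith
    have h3 := hQa _ hmem
    rw [hx] at h3
    have e1 : (r ^ 2) ^ (1 / 2 : ℝ) = r := by
      rw [← Real.sqrt_eq_rpow, Real.sqrt_sq hr0.le]
    have e2 : (r ^ 2) ^ (-1 / 2 : ℝ) = r⁻¹ := by
      rw [neg_div, Real.rpow_neg (by positivity), e1]
    rw [e1, e2] at h3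
    rw [Polynomial.eval_comp]
    simp only [Polynomial.eval_add, Polynomial.eval_mul, Polynomial.eval_C, Polynomial.eval_X]
    have e3 : w⁻¹ * r ^ 2 + -(m / w) = (r ^ 2 - m) / w := by field_simp; ring
    rw [e3, div_eq_mul_inv]
    exact h3

/-- Since n - 1 - q ≥ n/2 eventually, its logarithm is at least log n - 1. The gap between 5/6 and
2/3 is a positive multiple of log² n and dominates the linear terms and log C. -/
lemma eventually_rate_le (C : ℝ) (hC : 0 < C) (q : ℕ) :
    ∀ᶠ n : ℕ in atTop, C * Real.exp (-(5 / 6) * Real.log (n - 1 - q : ℕ) ^ 2 +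
      4 * Real.log (n - 1 - q : ℕ)) ≤ Real.exp (-(2 / 3) * Real.log n ^ 2) := by
  have hlog : Tendsto (fun N : ℕ => Real.log N) atTop atTop :=
    Real.tendsto_log_atTop.comp tendsto_natCast_atTop_atTop
  filter_upwards [hlog.eventually_ge_atTop (60 + 6 * |Real.log C|),
    eventually_ge_atTop (2 * (q + 1))] with n hn hnq
  set L := Real.log n with hL
  set N := n - 1 - q with hN
  have hN0 : (0 : ℝ) < N := by exact_mod_cast (by omega : 0 < N)
  have h1 : Real.log N ≤ L := Real.log_le_log hN0 (by exact_mod_cast (by omega : N ≤ n))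
  have h2 : L ≤ Real.log 2 + Real.log N := by
    rw [← Real.log_mul (by norm_num) hN0.ne']
    exact Real.log_le_log (by exact_mod_cast (by omega : 0 < n))
      (by exact_mod_cast (by omega : n ≤ 2 * N))
  have h3 : Real.log 2 < 1 := by linarith [Real.log_two_lt_d9]
  have h4 : L - 1 ≤ Real.log N := by linarith
  have hc0 := abs_nonneg (Real.log C)
  rw [← Real.exp_log hC, ← Real.exp_add]
  apply Real.exp_le_exp.2
  have h5 : (L - 1) ^ 2 ≤ Real.log N ^ 2 := by
    apply pow_le_pow_left₀ <;> linarith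
  have h6 := le_abs_self (Real.log C)
  nlinarith

/-- The left side already decays at least as fast as n^(-λ log n); for log n ≥ 3 the remaining
factor n² √(log n) / (log n - 2) is at least one. -/
lemma rate_le_rhs {lam : ℝ} (h2 : lam < 2 / 3) {n : ℕ} (hn : 3 ≤ Real.log n) :
    Real.exp (-(2 / 3) * Real.log n ^ 2) ≤
      Real.log n ^ (1 / 2 : ℝ) / (Real.log n - 2) * (n : ℝ) ^ (-lam * Real.log n + 2) := by
  set L := Real.log n with hL
  have hn0 : (0 : ℝ) < n := by
    rcases Nat.eq_zero_or_pos n with h | h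
    · rw [hL, h] at hn; simp at hn; norm_num at hn
    · exact_mod_cast h
  rw [Real.rpow_def_of_pos hn0, ← hL]
  have e1 : Real.exp (L * (-lam * L + 2)) = Real.exp (-lam * L ^ 2) * Real.exp (2 * L) := by
    rw [← Real.exp_add]; ring_nf
  rw [e1]
  have h3 : Real.exp (-(2 / 3) * L ^ 2) ≤ Real.exp (-lam * L ^ 2) :=
    Real.exp_le_exp.2 (by nlinarith [sq_nonneg L])
  have h4 : 1 ≤ L ^ (1 / 2 : ℝ) := Real.one_le_rpow (by linarith) (by norm_num)
  have h5 : L - 2 ≤ Real.exp (2 * L) := by linarith [Real.add_one_le_exp (2 * L)]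
  have h6 : 1 ≤ L ^ (1 / 2 : ℝ) / (L - 2) * Real.exp (2 * L) := by
    rw [div_mul_eq_mul_div, one_le_div (by linarith)]
    nlinarith
  calc Real.exp (-(2 / 3) * L ^ 2) ≤ Real.exp (-lam * L ^ 2) * 1 := by rw [mul_one]; exact h3
    _ ≤ Real.exp (-lam * L ^ 2) * (L ^ (1 / 2 : ℝ) / (L - 2) * Real.exp (2 * L)) := by gcongr
    _ = _ := by ring

/-! ### Quadrature error for radial kernels -/

lemma sepPoly_coord_mul {i j : Fin 4} (hij : i ≠ j) : SepPoly 1 fun x => x i * x j := by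
  refine ⟨MvPolynomial.X i * MvPolynomial.X j, fun a => ?_, fun x => by simp⟩
  refine (MvPolynomial.degreeOf_mul_le _ _ _).trans ?_
  rw [MvPolynomial.degreeOf_X, MvPolynomial.degreeOf_X]
  split_ifs with h1 h2
  · exact absurd (h1.symm.trans h2) hij
  all_goals simp

/-- The coordinates in the reference triangles, as functions on the cube, are polynomials of
degree at most one in each variable. -/
lemma sepPoly_duffy₁ (i : Fin 2) : SepPoly 1 fun x => (![x 0, x 0 * x 1] : Fin 2 → ℝ) i := by
  fin_cases i
  · exact sepPoly_coord 0
  · exact sepPoly_coord_mul (by decide)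

lemma sepPoly_duffy₂ (i : Fin 2) : SepPoly 1 fun x => (![x 2, x 2 * x 3] : Fin 2 → ℝ) i := by
  fin_cases i
  · exact sepPoly_coord 2
  · exact sepPoly_coord_mul (by decide)

lemma sepPoly_sq_norm_chart_sub (τ₁ τ₂ : Affine.Triangle ℝ E3) {A B : (Fin 4 → ℝ) → Fin 2 → ℝ}
    (hA : ∀ i, SepPoly 1 fun x => A x i) (hB : ∀ i, SepPoly 1 fun x => B x i) :
    SepPoly 2 fun x => ‖chart τ₁ (A x) - chart τ₂ (B x)‖ ^ 2 := by
  simp only [EuclideanSpace.norm_sq_eq, Real.norm_eq_abs, sq_abs]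
  refine SepPoly.sum _ fun i _ => SepPoly.pow (d := 1) ?_ 2
  have hc : ∀ c : ℝ, SepPoly 1 fun _ => c := fun c => (sepPoly_const c).mono zero_le_one
  have := ((hc ((τ₁.points 0 - τ₂.points 0) i)).add
    (((hA 0).const_mul ((τ₁.points 1 - τ₁.points 0) i)).add
    ((hA 1).const_mul ((τ₁.points 2 - τ₁.points 1) i)))).add
    (((hB 0).const_mul (-(τ₂.points 1 - τ₂.points 0) i)).add
    ((hB 1).const_mul (-(τ₂.points 2 - τ₂.points 1) i)))
  convert! this using 2 with x
  simp only [chart, PiLp.sub_apply, PiLp.add_apply, PiLp.smul_apply, smul_eq_mul]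
  ring

/-- The polynomial on the cube that results from replacing the radial kernel by a polynomial in
the squared distance. -/
noncomputable def cubePoly (τ₁ τ₂ : Affine.Triangle ℝ E3) (P₁ P₂ : MvPolynomial (Fin 2) ℝ) (Q : Polynomial ℝ)
    (x : Fin 4 → ℝ) : ℝ :=
  gram τ₁ * gram τ₂ / (4 * Real.pi) * (x 0 * x 2 *
    (MvPolynomial.eval ![x 2, x 2 * x 3] P₂ * MvPolynomial.eval ![x 0, x 0 * x 1] P₁) *
      Q.eval (‖chart τ₁ ![x 0, x 0 * x 1] - chart τ₂ ![x 2, x 2 * x 3]‖ ^ 2))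

/-- One degree comes from the Jacobian, at most q from each of the two polynomials, and two from the
squared distance for every degree of `Q`. -/
lemma sepPoly_cubePoly (τ₁ τ₂ : Affine.Triangle ℝ E3) {P₁ P₂ : MvPolynomial (Fin 2) ℝ} {q : ℕ}
    (hP₁ : P₁.totalDegree ≤ q) (hP₂ : P₂.totalDegree ≤ q) {Q : Polynomial ℝ} {N : ℕ}
    (hQ : Q.natDegree ≤ N) : SepPoly (1 + 2 * q + 2 * N) (cubePoly τ₁ τ₂ P₁ P₂ Q) := by
  have h1 : SepPoly 1 fun x => x 0 * x 2 := sepPoly_coord_mul (by decide)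
  have h2 := SepPoly.eval_mvPolynomial sepPoly_duffy₂ P₂ hP₂
  have h3 := SepPoly.eval_mvPolynomial sepPoly_duffy₁ P₁ hP₁
  have h4 := (sepPoly_sq_norm_chart_sub τ₁ τ₂ sepPoly_duffy₁ sepPoly_duffy₂).eval_polynomial Q hQ
  have h5 := ((h1.mul (h2.mul h3)).mul h4).const_mul (gram τ₁ * gram τ₂ / (4 * Real.pi))
  exact h5.mono (by omega)

/-- The pull-back to the reference triangles of an integrand with radial kernel `H`. -/
noncomputable def refKernel (τ₁ τ₂ : Affine.Triangle ℝ E3) (P₁ P₂ : MvPolynomial (Fin 2) ℝ) (H : ℝ → ℝ)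
    (s s' : Fin 2 → ℝ) : ℝ :=
  MvPolynomial.eval s' P₂ * MvPolynomial.eval s P₁ / (4 * Real.pi) * H ‖chart τ₁ s - chart τ₂ s'‖

lemma continuous_refKernel (τ₁ τ₂ : Affine.Triangle ℝ E3) (P₁ P₂ : MvPolynomial (Fin 2) ℝ)
    {H : ℝ → ℝ} (hH : Continuous H) :
    Continuous fun p : (Fin 2 → ℝ) × (Fin 2 → ℝ) => refKernel τ₁ τ₂ P₁ P₂ H p.1 p.2 := by
  refine Continuous.mul (Continuous.div_const (Continuous.mul
    ((MvPolynomial.continuous_eval P₂).comp continuous_snd)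
    ((MvPolynomial.continuous_eval P₁).comp continuous_fst)) _) (hH.comp ?_)
  exact (((continuous_chart τ₁).comp continuous_fst).sub
    ((continuous_chart τ₂).comp continuous_snd)).norm

lemma continuous4_duffy {K : (Fin 2 → ℝ) → (Fin 2 → ℝ) → ℝ}
    (hK : Continuous fun p : (Fin 2 → ℝ) × (Fin 2 → ℝ) => K p.1 p.2) (a b : ℝ) :
    Continuous4 fun x y u v => a * x * (b * u) * K ![x, x * y] ![u, u * v] := by
  have h1 : Continuous fun p : ((ℝ × ℝ) × ℝ) × ℝ => a * p.1.1.1 * (b * p.1.2) := by fun_prop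
  have h2 : Continuous fun p : ((ℝ × ℝ) × ℝ) × ℝ =>
      (![p.1.1.1, p.1.1.1 * p.1.1.2] : Fin 2 → ℝ) :=
    continuous_duffy.comp (g := fun p : ℝ × ℝ => (![p.1, p.1 * p.2] : Fin 2 → ℝ))
      (f := fun p : ((ℝ × ℝ) × ℝ) × ℝ => (p.1.1.1, p.1.1.2)) (by fun_prop)
  have h3 : Continuous fun p : ((ℝ × ℝ) × ℝ) × ℝ =>
      (![p.1.2, p.1.2 * p.2] : Fin 2 → ℝ) :=
    continuous_duffy.comp (g := fun p : ℝ × ℝ => (![p.1, p.1 * p.2] : Fin 2 → ℝ))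
      (f := fun p : ((ℝ × ℝ) × ℝ) × ℝ => (p.1.2, p.2)) (by fun_prop)
  exact h1.mul (hK.comp (h2.prodMk h3))

lemma abs_pullback_error_le {g₁ g₂ x u a b e M₁ M₂ ε h : ℝ} (hg₁ : 0 ≤ g₁) (hg₂ : 0 ≤ g₂)
    (hg₁' : g₁ ≤ h ^ 2) (hg₂' : g₂ ≤ h ^ 2) (hx : x ∈ Icc (0 : ℝ) 1) (hu : u ∈ Icc (0 : ℝ) 1)
    (ha : |a| ≤ M₂) (hb : |b| ≤ M₁) (he : |e| ≤ ε) :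
    |g₁ * g₂ * (x * u) * (a * b) * e * (1 / (4 * Real.pi))| ≤ h ^ 4 * M₂ * M₁ * ε / 2 := by
  have hM₁ := (abs_nonneg _).trans hb
  have hM₂ := (abs_nonneg _).trans ha
  have hε := (abs_nonneg _).trans he
  simp only [abs_mul]
  rw [abs_of_nonneg hg₁, abs_of_nonneg hg₂, abs_of_nonneg hx.1, abs_of_nonneg hu.1]
  -- The bound 1/2 compensates the factor 2 in `abs_cubeIntegral_sub_tensorGauss_le`.
  have hpi : |1 / (4 * Real.pi)| ≤ 1 / 2 := by
    rw [abs_of_pos (by positivity)]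
    exact one_div_le_one_div_of_le (by norm_num) (by linarith [Real.pi_gt_three])
  have := hx.1
  have := hu.1
  calc _ ≤ h ^ 2 * h ^ 2 * (1 * 1) * (M₂ * M₁) * ε * (1 / 2) := by
        gcongr
        · exact hx.2
        · exact hu.2
    _ = _ := by ring

/-- The quadrature error for an integrand that factors through the squared distance. -/
lemma quadError_integrand_le {τ₁ τ₂ : Affine.Triangle ℝ E3} {h : ℝ}
    (hd₁ : Metric.diam τ₁.closedInterior ≤ h) (hd₂ : Metric.diam τ₂.closedInterior ≤ h)
    {q N n : ℕ} (hn : 1 + 2 * q + 2 * N < 2 * n) {φj φl : E3 → ℝ} {Mj Ml : ℝ}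
    (hφj : IsPolyOn τ₂ q φj) (hφl : IsPolyOn τ₁ q φl)
    (hMj : ∀ y ∈ τ₂.closedInterior, |φj y| ≤ Mj) (hMl : ∀ x ∈ τ₁.closedInterior, |φl x| ≤ Ml)
    {ψ H : ℝ → ℝ} (hH : Continuous H)
    (hψ : ∀ x ∈ τ₁.closedInterior, ∀ y ∈ τ₂.closedInterior, ψ ‖x - y‖ / ‖x - y‖ = H ‖x - y‖)
    {Q : Polynomial ℝ} (hQ : Q.natDegree ≤ N) {ε : ℝ}
    (hε : ∀ x ∈ τ₁.closedInterior, ∀ y ∈ τ₂.closedInterior,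
      |H ‖x - y‖ - Q.eval (‖x - y‖ ^ 2)| ≤ ε) :
    quadError n τ₁ τ₂ (integrand φj φl ψ) ≤ h ^ 4 * Mj * Ml * ε := by
  obtain ⟨P₂, hP₂, hφP₂⟩ := hφj
  obtain ⟨P₁, hP₁, hφP₁⟩ := hφl
  have hKc := continuous_refKernel τ₁ τ₂ P₁ P₂ hH
  have hkK : ∀ s ∈ refTriangle, ∀ s' ∈ refTriangle,
      integrand φj φl ψ (chart τ₁ s) (chart τ₂ s') = refKernel τ₁ τ₂ P₁ P₂ H s s' := by
    intro s hs s' hs'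
    have := hψ _ (chart_mem_closedInterior τ₁ hs) _ (chart_mem_closedInterior τ₂ hs')
    rw [refKernel, integrand, ← this, hφP₂ s' hs'.1 hs'.2.1 hs'.2.2,
      hφP₁ s hs.1 hs.2.1 hs.2.2]
    ring
  rw [quadError, surfaceIntegral_eq_cubeIntegral τ₁ τ₂ hKc hkK]
  have hfK : ∀ x ∈ Icc (0 : ℝ) 1, ∀ y ∈ Icc (0 : ℝ) 1, ∀ u ∈ Icc (0 : ℝ) 1, ∀ v ∈ Icc (0 : ℝ) 1,
      cubeIntegrand τ₁ τ₂ (integrand φj φl ψ) x y u v =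
        gram τ₁ * x * (gram τ₂ * u) * refKernel τ₁ τ₂ P₁ P₂ H ![x, x * y] ![u, u * v] := by
    intro x hx y hy u hu v hv
    rw [cubeIntegrand, hkK _ (duffy_mem_refTriangle hx hy) _ (duffy_mem_refTriangle hu hv)]
  have key := abs_cubeIntegral_sub_tensorGauss_le (ε := h ^ 4 * Mj * Ml * ε / 2) hn
    (continuous4_duffy hKc (gram τ₁) (gram τ₂)) hfK
    (sepPoly_cubePoly τ₁ τ₂ hP₁ hP₂ hQ) ?_
  · linarith
  intro x hx y hy u hu v hv
  rw [hfK x hx y hy u hu v hv]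
  have m1 := duffy_mem_refTriangle hx hy
  have m2 := duffy_mem_refTriangle hu hv
  have c1 := chart_mem_closedInterior τ₁ m1
  have c2 := chart_mem_closedInterior τ₂ m2
  have e1 := hφP₁ _ m1.1 m1.2.1 m1.2.2
  have e2 := hφP₂ _ m2.1 m2.2.1 m2.2.2
  have e : gram τ₁ * x * (gram τ₂ * u) * refKernel τ₁ τ₂ P₁ P₂ H ![x, x * y] ![u, u * v] -
      cubePoly τ₁ τ₂ P₁ P₂ Q ![x, y, u, v] =
      gram τ₁ * gram τ₂ * (x * u) * (φj (chart τ₂ ![u, u * v]) * φl (chart τ₁ ![x, x * y])) *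
        (H ‖chart τ₁ ![x, x * y] - chart τ₂ ![u, u * v]‖ -
          Q.eval (‖chart τ₁ ![x, x * y] - chart τ₂ ![u, u * v]‖ ^ 2)) *
          (1 / (4 * Real.pi)) := by
    rw [e1, e2, cubePoly, refKernel]
    simp only [Matrix.cons_val]
    ring
  rw [e]
  exact abs_pullback_error_le (gram_nonneg τ₁) (gram_nonneg τ₂) (gram_le τ₁ hd₁) (gram_le τ₂ hd₂)
    hx hu (hMj _ c2) (hMl _ c1) (hε _ c1 _ c2)

lemma IsTimeIndex.bounds {l p i m : ℕ} (hl : 2 ≤ l) (h : IsTimeIndex l p i m) :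
    1 ≤ i ∧ i ≤ l ∧ m ≤ max 2 p := by
  rcases h with ⟨h1, _, h3⟩ | ⟨h1, h2, h3⟩
  · exact ⟨h1.ge, by omega, h3⟩
  · exact ⟨by omega, h2, h3.trans (le_max_right _ _)⟩

lemma continuous_psiExt (T : ℝ) {B B' : ℝ → ℝ} (hB : ContDiff ℝ ∞ B) (hB' : ContDiff ℝ ∞ B') :
    Continuous (psiExt T B B') :=
  (by fun_prop : Continuous fun r : ℝ => T - r).mul
    (contDiff_intervalIntegral_param 0 1 (contDiff_psiExt_integrand T hB hB')).continuous

/-- Approximation of `K r / r` by polynomials in `r ^ 2`, at the rate needed for the quadrature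
estimate. -/
lemma eventually_exists_polynomial {K : ℝ → ℝ}
    (hK : ∀ R, 0 < R → LogSq (ι := Unit) (Ioo (-R) R) fun _ => K) {D R : ℝ} (hD : 0 < D)
    (hDR : D < R) (q : ℕ) :
    ∀ᶠ n : ℕ in atTop, ∃ Q : Polynomial ℝ, Q.natDegree ≤ n - 1 - q ∧
      ∀ r ∈ Icc D R, |K r / r - Q.eval (r ^ 2)| ≤ Real.exp (-(2 / 3) * Real.log n ^ 2) := by
  obtain ⟨C, hC, h⟩ := exists_polynomial_sq_approx hK hD hDR
  have ht : Tendsto (fun n : ℕ => n - 1 - q) atTop atTop :=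
    (tendsto_sub_atTop_nat q).comp (tendsto_sub_atTop_nat 1)
  filter_upwards [ht.eventually h, eventually_rate_le C hC q] with n ⟨Q, hQ, hQr⟩ hn
  exact ⟨Q, hQ, fun r hr => (hQr r hr).trans hn⟩

/-- The quadrature error for a kernel that agrees with a smooth one on `[D, R]`. -/
lemma quadError_integrand_le_of_eqOn {τ₁ τ₂ : Affine.Triangle ℝ E3} {h D R : ℝ} (hD : 0 < D)
    (hd₁ : Metric.diam τ₁.closedInterior ≤ h) (hd₂ : Metric.diam τ₂.closedInterior ≤ h)
    (hdist : ∀ x ∈ τ₁.closedInterior, ∀ y ∈ τ₂.closedInterior, dist x y ∈ Icc D R)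
    {q n : ℕ} (hn : q + 1 ≤ n) {φj φl : E3 → ℝ} {Mj Ml : ℝ}
    (hφj : IsPolyOn τ₂ q φj) (hφl : IsPolyOn τ₁ q φl)
    (hMj : ∀ y ∈ τ₂.closedInterior, |φj y| ≤ Mj) (hMl : ∀ x ∈ τ₁.closedInterior, |φl x| ≤ Ml)
    {ψ K : ℝ → ℝ} (hK : Continuous K)
    (hψ : ∀ x ∈ τ₁.closedInterior, ∀ y ∈ τ₂.closedInterior, ψ (dist x y) = K (dist x y))
    {Q : Polynomial ℝ} (hQ : Q.natDegree ≤ n - 1 - q) {ε : ℝ}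
    (hε : ∀ r ∈ Icc D R, |K r / r - Q.eval (r ^ 2)| ≤ ε) :
    quadError n τ₁ τ₂ (integrand φj φl ψ) ≤ h ^ 4 * Mj * Ml * ε := by
  have hmax : ∀ r : ℝ, 0 < max D r := fun r => lt_max_of_lt_left hD
  -- Truncating at D leaves the kernel unchanged on the distances that occur and removes its
  -- singularity at 0.
  have hH : Continuous fun r : ℝ => K (max D r) / max D r :=
    (hK.comp (by fun_prop)).div (by fun_prop) fun r => (hmax r).ne'
  -- With N = n - 1 - q the degree 1 + 2q + 2N equals 2n - 1, the largest one covered by the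
  -- exactness of the rule.
  refine quadError_integrand_le hd₁ hd₂ (N := n - 1 - q) (by omega) hφj hφl hMj hMl hH
    (fun x hx y hy => ?_) hQ fun x hx y hy => ?_
  all_goals
    have hxy := hdist x hx y hy
    rw [← dist_eq_norm, max_eq_right hxy.1]
  · rw [hψ x hx y hy]
  · exact hε _ hxy

lemma dist_le_of_diam_le {X : Type*} [PseudoMetricSpace X] {s t : Set X} (hs : Bornology.IsBounded s)
    (ht : Bornology.IsBounded t) {h d : ℝ} (hs' : Metric.diam s ≤ h) (ht' : Metric.diam t ≤ h)
    {x₀ y₀ : X} (hx₀ : x₀ ∈ s) (hy₀ : y₀ ∈ t) (hd : dist x₀ y₀ ≤ d) {x y : X} (hx : x ∈ s)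
    (hy : y ∈ t) : dist x y ≤ d + 2 * h := by
  have h1 := (Metric.dist_le_diam_of_mem hs hx hx₀).trans hs'
  have h2 := (Metric.dist_le_diam_of_mem ht hy₀ hy).trans ht'
  linarith [dist_triangle4 x x₀ y₀ y]

/-- `psi` agrees with its smooth extension before `T`, and also beyond if one of the two functions
in time vanishes at the relevant end point. -/
lemma psi_eq_psiExt_of_cases {T : ℝ} (hT : 0 < T) {b β B B' : ℝ → ℝ} (hb : IsLogSqExtension T b B)
    (hβ : IsLogSqExtension T β B') {r : ℝ} (hr : 0 < r)
    (h : r ≤ T ∨ (∀ s ≤ 0, B s = 0) ∨ ∀ s, T ≤ s → B' s = 0) :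
    psi T b β r = psiExt T B B' r := by
  rcases le_total r T with hrT | hrT
  · exact psi_eq_psiExt hb hβ hr hrT
  rcases h with h | h | h
  · exact psi_eq_psiExt hb hβ hr h
  · rw [psi_eq_zero hT hb.2.2.2 hrT, psiExt_eq_zero_of_left h hrT]
  · rw [psi_eq_zero hT hb.2.2.2 hrT, psiExt_eq_zero_of_right h hrT]

/-- The quadrature error for fixed basis functions in time, uniformly in the triangles. -/
lemma eventually_quadError_le {l : ℕ} {t : ℕ → ℝ} {T : ℝ} (hgrid : IsTimeGrid l t T) (q : ℕ)
    {D h : ℝ} (hD : 0 < D) (hh : 0 < h) {i k : ℕ} (hi : 1 ≤ i) (hil : i ≤ l) (hk : 1 ≤ k)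
    (hkl : k ≤ l) (mi mk : ℕ) :
    ∀ᶠ n : ℕ in atTop, ∀ τ₁ τ₂ : Affine.Triangle ℝ E3,
      Metric.diam τ₁.closedInterior ≤ h → Metric.diam τ₂.closedInterior ≤ h →
      (∀ x ∈ τ₁.closedInterior, ∀ y ∈ τ₂.closedInterior, D ≤ dist x y) →
      (i = 1 → k = l →
        (∀ x ∈ τ₁.closedInterior, ∀ y ∈ τ₂.closedInterior, dist x y ≤ T) ∨
        (∀ x ∈ τ₁.closedInterior, ∀ y ∈ τ₂.closedInterior, T ≤ dist x y)) →
      ∀ (φj φl : E3 → ℝ) (Mj Ml : ℝ), IsPolyOn τ₂ q φj → IsPolyOn τ₁ q φl →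
        (∀ y ∈ τ₂.closedInterior, |φj y| ≤ Mj) → (∀ x ∈ τ₁.closedInterior, |φl x| ≤ Ml) →
        quadError n τ₁ τ₂ (integrand φj φl (psi T (timeBasis l t i mi) (timeBasis l t k mk))) ≤
          h ^ 4 * Mj * Ml * Real.exp (-(2 / 3) * Real.log n ^ 2) := by
  have hT := hgrid.pos
  obtain ⟨B, hB, hB0, -⟩ := exists_timeBasis_extension hgrid mi hi hil
  obtain ⟨B', hB', -, hBT⟩ := exists_timeBasis_extension hgrid mk hk hkl
  filter_upwards [eventually_ge_atTop (q + 1),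
    eventually_exists_polynomial (fun R hR => logSq_psiExt hT hR hB hB') hD
      (by linarith : D < T + 2 * h + D) q] with n hn ⟨Q, hQ, hQr⟩ τ₁ τ₂ hd₁ hd₂ hdist hcase
      φj φl Mj Ml hφj hφl hMj hMl
  have hb₁ := τ₁.isCompact_closedInterior.isBounded
  have hb₂ := τ₂.isCompact_closedInterior.isBounded
  -- This makes the threshold for n independent of the triangles, which may be arbitrarily far
  -- apart. If all distances are at least T, then ψ = 0 and the zero polynomial is exact; otherwise
  -- one distance is below T and the diameters bound all others by T + 2h. The extra D in `R` only
  -- ensures D < R.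
  by_cases hfar : ∀ x ∈ τ₁.closedInterior, ∀ y ∈ τ₂.closedInterior, T ≤ dist x y
  · refine quadError_integrand_le hd₁ hd₂ (N := n - 1 - q) (by omega) hφj hφl hMj hMl
      (H := fun _ => 0) continuous_const (fun x hx y hy => ?_) (Q := 0) (by simp) fun x _ y _ => ?_
    · rw [← dist_eq_norm, psi_eq_zero hT hB.2.2.2 (hfar x hx y hy), zero_div]
    · simpa using (Real.exp_pos _).le
  · push Not at hfar
    obtain ⟨x₀, hx₀, y₀, hy₀, h₀⟩ := hfar
    refine quadError_integrand_le_of_eqOn hD hd₁ hd₂ (R := T + 2 * h + D) (fun x hx y hy => ?_) hn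
      hφj hφl hMj hMl (continuous_psiExt T hB.1 hB'.1) (fun x hx y hy => ?_) hQ hQr
    · exact ⟨hdist x hx y hy, by
        linarith [dist_le_of_diam_le hb₁ hb₂ hd₁ hd₂ hx₀ hy₀ h₀.le hx hy]⟩
    · refine psi_eq_psiExt_of_cases hT hB hB' (hD.trans_le (hdist x hx y hy)) ?_
      -- Beyond T, ψ is zero. So is its extension, if the differentiated function vanishes left of 0
      -- (i ≥ 2) or the test function right of T (k ≠ l). Only for i = 1 and k = l must the
      -- distances be confined to r ≤ T.
      by_cases hi1 : i = 1
      · by_cases hkl' : k = l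
        · rcases hcase hi1 hkl' with h1 | h1
          · exact Or.inl (h1 x hx y hy)
          · exact absurd (h1 x₀ hx₀ y₀ hy₀) (not_le.2 h₀)
        · exact Or.inr (Or.inr (hBT hkl'))
      · exact Or.inr (Or.inl (hB0 (by omega)))

end RetardedQuad

theorem theorem1 (l : ℕ) (t : ℕ → ℝ) (T : ℝ) (hgrid : RetardedQuad.IsTimeGrid l t T)
    (p q : ℕ) (D h : ℝ) (hD : 0 < D) (hh : 0 < h) :
    ∃ C : ℝ, 0 < C ∧ ∀ lam : ℝ, 0 < lam → lam < 2 / 3 →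
      ∃ nlam : ℕ, ∀ n : ℕ, nlam < n →
        ∀ τ₁ τ₂ : Affine.Triangle ℝ RetardedQuad.E3,
          Metric.diam τ₁.closedInterior ≤ h → Metric.diam τ₂.closedInterior ≤ h →
          (∀ x ∈ τ₁.closedInterior, ∀ y ∈ τ₂.closedInterior, D ≤ dist x y) →
          ∀ i mi k mk : ℕ, RetardedQuad.IsTimeIndex l p i mi → RetardedQuad.IsTimeIndex l p k mk →
            (i = 1 → k = l →
              (∀ x ∈ τ₁.closedInterior, ∀ y ∈ τ₂.closedInterior, dist x y ≤ T) ∨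
              (∀ x ∈ τ₁.closedInterior, ∀ y ∈ τ₂.closedInterior, T ≤ dist x y)) →
            ∀ (φj φl : RetardedQuad.E3 → ℝ) (Mj Ml : ℝ),
              RetardedQuad.IsPolyOn τ₂ q φj → RetardedQuad.IsPolyOn τ₁ q φl →
              (∀ y ∈ τ₂.closedInterior, |φj y| ≤ Mj) → (∀ x ∈ τ₁.closedInterior, |φl x| ≤ Ml) →
              RetardedQuad.quadError n τ₁ τ₂
                  (RetardedQuad.integrand φj φl
                    (RetardedQuad.psi T (RetardedQuad.timeBasis l t i mi)
                      (RetardedQuad.timeBasis l t k mk)))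
                ≤ C * Mj * Ml * (Real.log n ^ (1 / 2 : ℝ) / (Real.log n - 2)) *
                  (n : ℝ) ^ (-lam * Real.log n + 2) := by
  have hlog : Filter.Tendsto (fun n : ℕ => Real.log n) Filter.atTop Filter.atTop :=
    Real.tendsto_log_atTop.comp tendsto_natCast_atTop_atTop
  have hev := (Filter.eventually_all_finset
    (Finset.Icc 1 l ×ˢ Finset.range (max 2 p + 1) ×ˢ Finset.Icc 1 l ×ˢ
      Finset.range (max 2 p + 1))).2 fun x hx => by
    simp only [Finset.mem_product, Finset.mem_Icc, Finset.mem_range] at hx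
    exact RetardedQuad.eventually_quadError_le hgrid q hD hh hx.1.1 hx.1.2 hx.2.2.1.1 hx.2.2.1.2
      x.2.1 x.2.2.2
  obtain ⟨n₀, hn₀⟩ := Filter.eventually_atTop.1 (hev.and (hlog.eventually_ge_atTop 3))
  -- Neither the constant nor the threshold depends on λ, as exp(-2/3 log² n) lies below the
  -- right-hand side for every λ < 2/3. The requirement log n ≥ 3 keeps the denominator log n - 2
  -- positive.
  refine ⟨h ^ 4, by positivity, fun lam _ hlam => ⟨n₀, ?_⟩⟩
  intro n hn τ₁ τ₂ hd₁ hd₂ hdist i mi k mk hi hk hcase φj φl Mj Ml hφj hφl hMj hMl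
  obtain ⟨hev', hn3⟩ := hn₀ n hn.le
  have bi := hi.bounds hgrid.1
  have bk := hk.bounds hgrid.1
  have hMj0 : 0 ≤ Mj := (abs_nonneg _).trans (hMj _ (τ₂.point_mem_closedInterior 0))
  have hMl0 : 0 ≤ Ml := (abs_nonneg _).trans (hMl _ (τ₁.point_mem_closedInterior 0))
  refine (hev' (i, mi, k, mk) (by
    simp only [Finset.mem_product, Finset.mem_Icc, Finset.mem_range]
    omega) τ₁ τ₂ hd₁ hd₂ hdist hcase φj φl Mj Ml hφj hφl hMj hMl).trans ?_
  rw [mul_assoc (h ^ 4 * Mj * Ml)]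
  exact mul_le_mul_of_nonneg_left (RetardedQuad.rate_le_rhs hlam hn3) (by positivity)
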